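/- Let $1/2\le\theta<1$. For $C>0$ let $\|f\|_{C}=\sup_{\alpha,\beta\in\mathbb N^d}\sup_{x\in\mathbb R^d}C^{-|\alpha|-|\beta|}(\alpha!\,\beta!)^{-\theta}|x^\alpha\partial^\beta f(x)|$, let $\mathcal S_\theta(\mathbb R^d)$ be the space of all $f\in C^\infty(\mathbb R^d)$ with $\|f\|_{C}<\infty$ for some $C>0$, and let $\mathcal S'_\theta(\mathbb R^d)$ be the space of linear forms $u$ on $\mathcal S_\theta(\mathbb R^d)$ such that for every $\varepsilon>0$ there is $C_\varepsilon$ with $|u(f)|\le C_\varepsilon\|f\|_{\varepsilon}$ for all $f$ with $\|f\|_\varepsilon<\infty$, with the weak topology. A function $g$ is regarded as the ultradistribution $h\mapsto\int g h\,dx$. For $u\in\mathcal S'_\theta(\mathbb R^d)$ and $z\in\mathbb C^d$ put $$Tu(z)=2^{-d/2}\pi^{-3d/4}\,\big\langle u_y,\ e^{i\langle z,y\rangle-\frac12|y|^2}\big\rangle,\qquad \Phi(z)=\tfrac12|\operatorname{Im}z|^2,\qquad \chi(x,\xi)=-\xi-ix .$$ The global wave front set $\mathrm{WF}(u)$ consists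 of those $(x,\xi)\in\mathbb R^{2d}\setminus\{0\}$ for which there are no open conic neighbourhood $L$ of $\chi(x,\xi)$ and $C,\varepsilon>0$ with $|Tu(z)|\le Ce^{-\varepsilon|z|^{1/\theta}+\Phi(z)}$ for all $z\in L$. For a set $\Gamma\subset\mathbb R^{2d}\setminus\{0\}$ let $\mathcal S'_{\theta,\Gamma}(\mathbb R^d)=\{u\in\mathcal S'_\theta(\mathbb R^d):\mathrm{WF}(u)\subset\Gamma\}$. In this space $u_n\to u$ means that $u_n-u\to0$ weakly in $\mathcal S'_\theta(\mathbb R^d)$ and that for every $p\in\mathbb R^{2d}\setminus(\Gamma\cup\{0\})$ there are an open conic neighbourhood $L$ of $\chi(p)$ and $C,\varepsilon>0$ with $|T(u_n-u)(z)|\le Ce^{-\varepsilon|z|^{1/\theta}+\Phi(z)}$ for all $n\in\mathbb N$ and $z\in L$; a map between such spaces is called continuous if it preserves convergence of sequences. **Theorem.** Let $A:\mathbb R^m\to\mathbb R^d$ be linear and let $\Gamma\subset\mathbb R^{2d}\setminus\{0\}$ be a cone, closed in $\mathbb R^{2d}\setminus\{0\}$, with $\Gamma\cap\{(0,\xi):{}^tA\xi=0\}=\emptyset$.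 Put $$A^*\Gamma=\{(x,{}^tA\xi):(Ax,\xi)\in\Gamma\},\qquad \Delta=A^*\Gamma\,\cup\,\big((\ker A\setminus\{0\})\times\{0\}\big).$$ Then $\Delta$ is a closed cone in $\mathbb R^{2m}\setminus\{0\}$, $\mathcal S_\theta(\mathbb R^d)\subset\mathcal S'_{\theta,\Gamma}(\mathbb R^d)$, and the pull-back $A^*f=f\circ A$, $f\in\mathcal S_\theta(\mathbb R^d)$, extends uniquely to a continuous map $\mathcal S'_{\theta,\Gamma}(\mathbb R^d)\to\mathcal S'_{\theta,\Delta}(\mathbb R^m)$, and this map is linear. If $A$ is injective, then $\Delta=A^*\Gamma$ and $A^*$ maps $\mathcal S_\theta(\mathbb R^d)$ into $\mathcal S_\theta(\mathbb R^m)$, so that $A^*:\mathcal S_\theta(\mathbb R^d)\to\mathcal S_\theta(\mathbb R^m)$ extends uniquely to a continuous map $\mathcal S'_{\theta,\Gamma}(\mathbb R^d)\to\mathcal S'_{\theta,A^*\Gamma}(\mathbb R^m)$. -/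

import Mathlib

open scoped ContDiff

noncomputable section

namespace GelfandShilov

/-! ## Gelfand-Shilov functions -/

/-- The partial derivative `∂ᵢ f`. -/
def partialDeriv {d : ℕ} (i : Fin d) (f : EuclideanSpace ℝ (Fin d) → ℂ) :
    EuclideanSpace ℝ (Fin d) → ℂ :=
  fun x => fderiv ℝ f x (EuclideanSpace.single i 1)

/-- The derivative `∂^β f = ∂₁^{β₁} ⋯ ∂_d^{β_d} f` for a multi-index `β`. -/
def multiDeriv {d : ℕ} (β : Fin d → ℕ) (f : EuclideanSpace ℝ (Fin d) → ℂ) :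
    EuclideanSpace ℝ (Fin d) → ℂ :=
  (List.finRange d).foldr (fun i g => (partialDeriv i)^[β i] g) f

/-- The multi-index factorial `α! = α₁! ⋯ α_d!`, as a real number. -/
def multiFactorial {d : ℕ} (α : Fin d → ℕ) : ℝ := ∏ i, ((α i).factorial : ℝ)

/-- `GSBound θ C M f` says that the norm of `f` in the Banach space `S^θ_{θ,C}` is at most `M`:
`|x^α ∂^β f(x)| ≤ M C^{|α|+|β|} (α!)^θ (β!)^θ` for all `α`, `β`, `x`. -/
def GSBound {d : ℕ} (θ C M : ℝ) (f : EuclideanSpace ℝ (Fin d) → ℂ) : Prop :=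
  ∀ (α β : Fin d → ℕ) (x : EuclideanSpace ℝ (Fin d)),
    ‖(∏ i, ((x i : ℝ) : ℂ) ^ α i) * multiDeriv β f x‖ ≤
      M * C ^ (∑ i, α i + ∑ i, β i) * multiFactorial α ^ θ * multiFactorial β ^ θ

/-- `f` is a Gelfand-Shilov function of index `θ`. -/
def IsGS {d : ℕ} (θ : ℝ) (f : EuclideanSpace ℝ (Fin d) → ℂ) : Prop :=
  ContDiff ℝ ∞ f ∧ ∃ C > 0, ∃ M, GSBound θ C M f

section Linear

variable {d : ℕ}

lemma contDiff_partialDeriv (i : Fin d) {f : EuclideanSpace ℝ (Fin d) → ℂ}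
    (hf : ContDiff ℝ ∞ f) : ContDiff ℝ ∞ (partialDeriv i f) := by
  unfold partialDeriv
  exact (hf.fderiv_right (m := ∞) (by simp)).clm_apply contDiff_const

lemma partialDeriv_lin (i : Fin d) {f g : EuclideanSpace ℝ (Fin d) → ℂ}
    (hf : ContDiff ℝ ∞ f) (hg : ContDiff ℝ ∞ g) (a b : ℂ) :
    partialDeriv i (a • f + b • g) = a • partialDeriv i f + b • partialDeriv i g := by
  funext x
  have hf' : DifferentiableAt ℝ f x := (hf.differentiable (by simp)) x
  have hg' : DifferentiableAt ℝ g x := (hg.differentiable (by simp)) x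
  simp only [partialDeriv, Pi.add_apply, Pi.smul_apply]
  rw [fderiv_add (hf'.const_smul a) (hg'.const_smul b), fderiv_const_smul hf',
    fderiv_const_smul hg']
  rfl

lemma iterate_partialDeriv_lin (i : Fin d) (n : ℕ) {f g : EuclideanSpace ℝ (Fin d) → ℂ}
    (hf : ContDiff ℝ ∞ f) (hg : ContDiff ℝ ∞ g) (a b : ℂ) :
    ContDiff ℝ ∞ ((partialDeriv i)^[n] f) ∧ ContDiff ℝ ∞ ((partialDeriv i)^[n] g) ∧
    (partialDeriv i)^[n] (a • f + b • g) =
      a • (partialDeriv i)^[n] f + b • (partialDeriv i)^[n] g := by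
  induction n with
  | zero => exact ⟨hf, hg, rfl⟩
  | succ n ih =>
    obtain ⟨h1, h2, h3⟩ := ih
    simp only [Function.iterate_succ_apply']
    refine ⟨contDiff_partialDeriv i h1, contDiff_partialDeriv i h2, ?_⟩
    rw [h3, partialDeriv_lin i h1 h2]

lemma multiDeriv_lin (β : Fin d → ℕ) {f g : EuclideanSpace ℝ (Fin d) → ℂ}
    (hf : ContDiff ℝ ∞ f) (hg : ContDiff ℝ ∞ g) (a b : ℂ) :
    multiDeriv β (a • f + b • g) = a • multiDeriv β f + b • multiDeriv β g := by
  unfold multiDeriv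
  have key : ∀ l : List (Fin d),
      ContDiff ℝ ∞ (l.foldr (fun i g => (partialDeriv i)^[β i] g) f) ∧
      ContDiff ℝ ∞ (l.foldr (fun i g => (partialDeriv i)^[β i] g) g) ∧
      l.foldr (fun i g => (partialDeriv i)^[β i] g) (a • f + b • g) =
        a • l.foldr (fun i g => (partialDeriv i)^[β i] g) f +
        b • l.foldr (fun i g => (partialDeriv i)^[β i] g) g := by
    intro l
    induction l with
    | nil => exact ⟨hf, hg, rfl⟩
    | cons i l ih =>
      obtain ⟨h1, h2, h3⟩ := ih
      simp only [List.foldr_cons]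
      rw [h3]
      exact iterate_partialDeriv_lin i (β i) h1 h2 a b
  exact (key _).2.2

lemma multiFactorial_ge_one (α : Fin d → ℕ) : 1 ≤ multiFactorial α := by
  unfold multiFactorial
  rw [← Nat.cast_prod]
  exact_mod_cast Nat.one_le_iff_ne_zero.2
    (Finset.prod_ne_zero_iff.2 fun i _ => Nat.factorial_ne_zero _)

lemma GSBound.mono {θ C C' M M' : ℝ} {f : EuclideanSpace ℝ (Fin d) → ℂ}
    (h : GSBound θ C M f) (hC : 0 < C) (hCC : C ≤ C') (hM : M ≤ M') (hM' : 0 ≤ M') :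
    GSBound θ C' M' f := by
  intro α β x
  refine (h α β x).trans ?_
  have h1 : 0 ≤ multiFactorial α ^ θ :=
    Real.rpow_nonneg (zero_le_one.trans (multiFactorial_ge_one α)) _
  have h2 : 0 ≤ multiFactorial β ^ θ :=
    Real.rpow_nonneg (zero_le_one.trans (multiFactorial_ge_one β)) _
  gcongr

lemma GSBound.lin {θ C M N : ℝ} {f g : EuclideanSpace ℝ (Fin d) → ℂ}
    (hf : ContDiff ℝ ∞ f) (hg : ContDiff ℝ ∞ g)
    (h : GSBound θ C M f) (h' : GSBound θ C N g) (a b : ℂ) :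
    GSBound θ C (‖a‖ * M + ‖b‖ * N) (a • f + b • g) := by
  intro α β x
  rw [multiDeriv_lin β hf hg]
  simp only [Pi.add_apply, Pi.smul_apply, smul_eq_mul]
  set p := ∏ i, ((x i : ℝ) : ℂ) ^ α i
  calc ‖p * (a * multiDeriv β f x + b * multiDeriv β g x)‖
      = ‖a * (p * multiDeriv β f x) + b * (p * multiDeriv β g x)‖ := by ring_nf
    _ ≤ ‖a‖ * ‖p * multiDeriv β f x‖ + ‖b‖ * ‖p * multiDeriv β g x‖ := by
        refine (norm_add_le _ _).trans (le_of_eq ?_)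
        rw [norm_mul a, norm_mul b]
    _ ≤ _ := by
        have e1 := mul_le_mul_of_nonneg_left (h α β x) (norm_nonneg a)
        have e2 := mul_le_mul_of_nonneg_left (h' α β x) (norm_nonneg b)
        refine (add_le_add e1 e2).trans (le_of_eq ?_)
        ring

lemma IsGS.lin {θ : ℝ} {f g : EuclideanSpace ℝ (Fin d) → ℂ}
    (hf : IsGS θ f) (hg : IsGS θ g) (a b : ℂ) : IsGS θ (a • f + b • g) := by
  obtain ⟨sf, C, hC, M, hM⟩ := hf
  obtain ⟨sg, D, hD, N, hN⟩ := hg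
  refine ⟨(sf.const_smul a).add (sg.const_smul b), max C D, lt_max_of_lt_left hC,
    ‖a‖ * max M 0 + ‖b‖ * max N 0, ?_⟩
  exact GSBound.lin sf sg
    (hM.mono hC (le_max_left _ _) (le_max_left M 0) (le_max_right _ _))
    (hN.mono hD (le_max_right _ _) (le_max_left N 0) (le_max_right _ _)) a b

lemma isGS_zero (θ : ℝ) : IsGS θ (0 : EuclideanSpace ℝ (Fin d) → ℂ) := by
  have h0 : ContDiff ℝ ∞ (0 : EuclideanSpace ℝ (Fin d) → ℂ) := contDiff_const
  refine ⟨h0, 1, one_pos, 0, fun α β x => ?_⟩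
  have := multiDeriv_lin β h0 h0 0 0
  simp only [zero_smul, add_zero] at this
  simp [this]

end Linear

/-- The Gelfand-Shilov space `S_θ(ℝ^d) = S^θ_θ(ℝ^d)`. -/
def GS (θ : ℝ) (d : ℕ) : Submodule ℂ (EuclideanSpace ℝ (Fin d) → ℂ) where
  carrier := {f | IsGS θ f}
  zero_mem' := isGS_zero θ
  add_mem' {f g} hf hg := by
    have := IsGS.lin hf hg 1 1
    simpa using this
  smul_mem' c f hf := by
    have := IsGS.lin hf hf c 0
    simpa using this

/-! ## Tempered ultradistributions -/

/-- The dual `S'_θ(ℝ^d)`: linear forms on `S_θ(ℝ^d)` that are bounded with respect to the norm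
of `S^θ_{θ,ε}` for every `ε > 0`. -/
def GSDual (θ : ℝ) (d : ℕ) : Submodule ℂ (GS θ d →ₗ[ℂ] ℂ) where
  carrier := {u | ∀ ε > 0, ∃ K, ∀ (f : GS θ d) (M : ℝ), 0 ≤ M → GSBound θ ε M f.1 →
    ‖u f‖ ≤ K * M}
  zero_mem' := fun _ _ => ⟨0, fun _ _ _ _ => by simp⟩
  add_mem' {u v} hu hv := by
    intro ε hε
    obtain ⟨K, hK⟩ := hu ε hε
    obtain ⟨L, hL⟩ := hv ε hε
    refine ⟨K + L, fun f M hM hf => ?_⟩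
    rw [LinearMap.add_apply, add_mul]
    exact (norm_add_le _ _).trans (add_le_add (hK f M hM hf) (hL f M hM hf))
  smul_mem' c u hu := by
    intro ε hε
    obtain ⟨K, hK⟩ := hu ε hε
    refine ⟨‖c‖ * K, fun f M hM hf => ?_⟩
    rw [LinearMap.smul_apply, norm_smul, mul_assoc]
    exact mul_le_mul_of_nonneg_left (hK f M hM hf) (norm_nonneg _)

/-- The ultradistribution `u` is the function `g`, i.e. `⟨u, h⟩ = ∫ g h` for all test
functions `h`. -/
def IsFunction {θ : ℝ} {d : ℕ} (u : GSDual θ d) (g : EuclideanSpace ℝ (Fin d) → ℂ) : Prop :=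
  ∀ h : GS θ d, MeasureTheory.Integrable (fun x => g x * h.1 x) ∧ u.1 h = ∫ x, g x * h.1 x

/-! ## The FBI transform with the standard phase -/

/-- The standard phase `φ(z,y) = ⟨z,y⟩ + (i/2)|y|²`, with `⟨·,·⟩` bilinear. -/
def phase {d : ℕ} (z : EuclideanSpace ℂ (Fin d)) (y : EuclideanSpace ℝ (Fin d)) : ℂ :=
  ∑ j, z j * ((y j : ℝ) : ℂ) + Complex.I / 2 * ((‖y‖ ^ 2 : ℝ) : ℂ)

/-- The function `y ↦ e^{iφ(z,y)}`. -/
def fbiKernel {d : ℕ} (z : EuclideanSpace ℂ (Fin d)) (y : EuclideanSpace ℝ (Fin d)) : ℂ :=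
  Complex.exp (Complex.I * phase z y)

section Kernel

/-- The one-dimensional kernel on the complex line. -/
def kernelOne (w s : ℂ) : ℂ := Complex.exp (Complex.I * (w * s + Complex.I / 2 * s ^ 2))

lemma differentiable_kernelOne (w : ℂ) : Differentiable ℂ (kernelOne w) := by
  unfold kernelOne; fun_prop

lemma norm_kernelOne_le (w s : ℂ) (t R : ℝ) (hs : ‖s - t‖ ≤ R) :
    ‖kernelOne w s‖ ≤ Real.exp (3 * ‖w‖ ^ 2 + 2 * R ^ 2 - t ^ 2 / 8) := by
  unfold kernelOne
  rw [Complex.norm_exp]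
  apply Real.exp_le_exp.2
  have hR : 0 ≤ R := (norm_nonneg _).trans hs
  set h : ℂ := s - t with hh
  have hs' : s = t + h := by simp [hh]
  have h1 : (Complex.I * (w * s)).re ≤ ‖w‖ * (|t| + R) := by
    refine (Complex.re_le_norm _).trans ?_
    rw [norm_mul, norm_mul, Complex.norm_I, one_mul]
    gcongr
    rw [hs']
    refine (norm_add_le _ _).trans ?_
    rw [Complex.norm_real, Real.norm_eq_abs]
    gcongr
  have h2 : (Complex.I * (w * s + Complex.I / 2 * s ^ 2)).re =
      (Complex.I * (w * s)).re - (s ^ 2).re / 2 := by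
    have : Complex.I * (w * s + Complex.I / 2 * s ^ 2) = Complex.I * (w * s) - s ^ 2 / 2 := by
      have := Complex.I_sq
      linear_combination (s ^ 2 / 2) * this
    rw [this, Complex.sub_re]
    congr 1
    simp
  have h3 : (s ^ 2).re = (t + h.re) ^ 2 - h.im ^ 2 := by
    rw [hs', sq, Complex.mul_re]; simp; ring
  have h4 : h.re ^ 2 + h.im ^ 2 ≤ R ^ 2 := by
    have : ‖h‖ ^ 2 ≤ R ^ 2 := by gcongr
    rw [Complex.sq_norm, Complex.normSq_apply] at this
    linarith
  rw [h2, h3]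
  have h5 : |t| ^ 2 = t ^ 2 := sq_abs t
  nlinarith [sq_nonneg (t + 2 * h.re), sq_nonneg (|t| - 4 * ‖w‖), sq_nonneg (‖w‖ - R),
    sq_nonneg (h.re), sq_nonneg h.im]

lemma iteratedDeriv_real_kernelOne (w : ℂ) (n : ℕ) (t : ℝ) :
    iteratedDeriv n (fun s : ℝ => kernelOne w s) t = iteratedDeriv n (kernelOne w) (t : ℂ) := by
  induction n generalizing t with
  | zero => simp
  | succ n ih =>
    rw [iteratedDeriv_succ, iteratedDeriv_succ]
    have hfun : iteratedDeriv n (fun s : ℝ => kernelOne w s) =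
        fun s : ℝ => iteratedDeriv n (kernelOne w) (s : ℂ) := funext ih
    rw [hfun]
    have hd : DifferentiableAt ℂ (iteratedDeriv n (kernelOne w)) (t : ℂ) :=
      (((differentiable_kernelOne w).contDiff (n := ∞)).differentiable_iteratedDeriv n
        (by exact_mod_cast WithTop.coe_lt_top _)) _
    exact hd.hasDerivAt.comp_ofReal.deriv

lemma kernelOne_bound (w : ℂ) (k n : ℕ) (t : ℝ) :
    |t| ^ k * ‖iteratedDeriv n (fun s : ℝ => kernelOne w s) t‖ ≤
      Real.exp (3 * ‖w‖ ^ 2) * Real.exp 2 ^ (k + n) *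
        Real.sqrt (k.factorial) * Real.sqrt (n.factorial) := by
  rw [iteratedDeriv_real_kernelOne]
  have hk : |t| ^ k ≤ 2 ^ k * Real.sqrt k.factorial * Real.exp (t ^ 2 / 8) := by
    have h1 := Real.pow_div_factorial_le_exp (t ^ 2 / 4) (by positivity) k
    rw [div_le_iff₀ (by positivity)] at h1
    refine (sq_le_sq₀ (by positivity) (by positivity)).1 ?_
    have e1 : Real.exp (t ^ 2 / 8) ^ 2 = Real.exp (t ^ 2 / 4) := by
      rw [← Real.exp_nat_mul]; congr 1; push_cast; ring
    have e2 : (|t| ^ k) ^ 2 = (t ^ 2 / 4) ^ k * 4 ^ k := by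
      rw [← mul_pow, div_mul_cancel₀ _ (by norm_num), ← pow_mul, mul_comm k 2, pow_mul, sq_abs]
    rw [e2, mul_pow, mul_pow, Real.sq_sqrt (by positivity), e1, ← pow_mul, mul_comm k 2, pow_mul]
    norm_num
    nlinarith [pow_pos (show (0:ℝ) < 4 by norm_num) k]
  have hn : ‖iteratedDeriv n (kernelOne w) (t : ℂ)‖ ≤
      Real.sqrt n.factorial * Real.exp (3 * ‖w‖ ^ 2 + 2 * n - t ^ 2 / 8) := by
    rcases Nat.eq_zero_or_pos n with rfl | hpos
    · have := norm_kernelOne_le w t t 0 (by simp)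
      simpa using this
    · have hnR : (0 : ℝ) < n := by exact_mod_cast hpos
      have hR : 0 < Real.sqrt n := Real.sqrt_pos.2 hnR
      have hc := Complex.norm_iteratedDeriv_le_of_forall_mem_sphere_norm_le (c := (t : ℂ))
        (f := kernelOne w) (C := Real.exp (3 * ‖w‖ ^ 2 + 2 * n - t ^ 2 / 8)) n hR
        (differentiable_kernelOne w).diffContOnCl
        (fun s hs => by
          have := norm_kernelOne_le w s t (Real.sqrt n) (by
            rw [mem_sphere_iff_norm] at hs; exact hs.le)
          rwa [Real.sq_sqrt hnR.le] at this)
      refine hc.trans ?_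
      rw [div_le_iff₀ (by positivity)]
      have hf : (n.factorial : ℝ) ≤ Real.sqrt n.factorial * Real.sqrt n ^ n := by
        have h1 : Real.sqrt (n.factorial : ℝ) ≤ Real.sqrt n ^ n := by
          refine Real.sqrt_le_iff.2 ⟨by positivity, ?_⟩
          rw [← pow_mul, mul_comm n 2, pow_mul, Real.sq_sqrt hnR.le]
          exact_mod_cast Nat.factorial_le_pow n
        calc (n.factorial : ℝ) = Real.sqrt n.factorial * Real.sqrt n.factorial :=
              (Real.mul_self_sqrt (by positivity)).symm
          _ ≤ _ := by gcongr
      have := mul_le_mul_of_nonneg_right hf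
        (Real.exp_pos (3 * ‖w‖ ^ 2 + 2 * n - t ^ 2 / 8)).le
      linarith
  calc |t| ^ k * ‖iteratedDeriv n (kernelOne w) (t : ℂ)‖
      ≤ (2 ^ k * Real.sqrt k.factorial * Real.exp (t ^ 2 / 8)) *
        (Real.sqrt n.factorial * Real.exp (3 * ‖w‖ ^ 2 + 2 * n - t ^ 2 / 8)) := by gcongr
    _ = Real.exp (3 * ‖w‖ ^ 2) * (2 ^ k * Real.exp 2 ^ n) *
        Real.sqrt k.factorial * Real.sqrt n.factorial := by
        have : Real.exp (3 * ‖w‖ ^ 2 + 2 * n - t ^ 2 / 8) =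
          Real.exp (3 * ‖w‖ ^ 2) * Real.exp 2 ^ n * (Real.exp (t ^ 2 / 8))⁻¹ := by
          rw [← Real.exp_nat_mul, ← Real.exp_neg, ← Real.exp_add, ← Real.exp_add]
          congr 1; ring
        rw [this]
        field_simp
    _ ≤ _ := by
        rw [pow_add]
        have : (2 : ℝ) ≤ Real.exp 2 := by linarith [Real.add_one_le_exp (2 : ℝ)]
        gcongr

variable {d : ℕ}

/-- The product of one-dimensional derivatives of the kernel. -/
def kernelProd (z : EuclideanSpace ℂ (Fin d)) (n : Fin d → ℕ) (y : EuclideanSpace ℝ (Fin d)) : ℂ :=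
  ∏ j, iteratedDeriv (n j) (fun s : ℝ => kernelOne (z j) s) (y j)

lemma contDiff_kernelOne (w : ℂ) : ContDiff ℝ ∞ (fun s : ℝ => kernelOne w s) :=
  (((differentiable_kernelOne w).contDiff (n := ∞)).restrict_scalars ℝ).comp
    Complex.ofRealCLM.contDiff

lemma fbiKernel_eq (z : EuclideanSpace ℂ (Fin d)) : fbiKernel z = kernelProd z 0 := by
  funext y
  simp only [fbiKernel, kernelProd, Pi.zero_apply, iteratedDeriv_zero, kernelOne, phase]
  rw [← Complex.exp_sum]
  congr 1
  rw [EuclideanSpace.norm_sq_eq, ← Finset.mul_sum, Finset.sum_add_distrib]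
  congr 2
  rw [Complex.ofReal_sum, Finset.mul_sum]
  refine Finset.sum_congr rfl fun j _ => ?_
  rw [Real.norm_eq_abs, sq_abs]
  push_cast
  rfl

lemma partialDeriv_kernelProd (z : EuclideanSpace ℂ (Fin d)) (n : Fin d → ℕ) (i : Fin d) :
    partialDeriv i (kernelProd z n) = kernelProd z (Function.update n i (n i + 1)) := by
  funext y
  unfold partialDeriv
  have hfac : ∀ j ∈ Finset.univ, HasFDerivAt (𝕜 := ℝ)
      (fun y : EuclideanSpace ℝ (Fin d) =>
        iteratedDeriv (n j) (fun s : ℝ => kernelOne (z j) s) (y j))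
      ((ContinuousLinearMap.toSpanSingleton ℝ
        (iteratedDeriv (n j + 1) (fun s : ℝ => kernelOne (z j) s) (y j))).comp
        (EuclideanSpace.proj j : EuclideanSpace ℝ (Fin d) →L[ℝ] ℝ)) y := by
    intro j _
    have hd : DifferentiableAt ℝ (iteratedDeriv (n j) (fun s : ℝ => kernelOne (z j) s)) (y j) :=
      ((contDiff_kernelOne (z j)).differentiable_iteratedDeriv (n j)
        (by exact_mod_cast WithTop.coe_lt_top _)) _
    have h1 := hd.hasDerivAt.hasFDerivAt.comp y
      (EuclideanSpace.proj j : EuclideanSpace ℝ (Fin d) →L[ℝ] ℝ).hasFDerivAt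
    rw [← iteratedDeriv_succ] at h1
    exact h1
  have h := HasFDerivAt.finsetProd (u := Finset.univ) hfac
  have h' : fderiv ℝ (kernelProd z n) y = _ := HasFDerivAt.fderiv (h.congr_of_eventuallyEq
    (Filter.Eventually.of_forall fun y => by simp [kernelProd]))
  rw [h']
  have hp : ∀ j, (EuclideanSpace.proj j : EuclideanSpace ℝ (Fin d) →L[ℝ] ℝ)
      (EuclideanSpace.single i 1) = if j = i then 1 else 0 := fun j => by simp
  simp only [sum_apply, smul_apply, ContinuousLinearMap.comp_apply,
    ContinuousLinearMap.toSpanSingleton_apply, hp]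
  rw [Finset.sum_eq_single i]
  · simp only [if_true, one_smul, kernelProd]
    rw [← Finset.mul_prod_erase Finset.univ _ (Finset.mem_univ i), Function.update_self,
      smul_eq_mul, mul_comm]
    congr 1
    refine Finset.prod_congr rfl fun j hj => ?_
    rw [Function.update_of_ne (Finset.ne_of_mem_erase hj)]
  · intro j _ hj
    simp [hj]
  · simp

lemma iterate_partialDeriv_kernelProd (z : EuclideanSpace ℂ (Fin d)) (n : Fin d → ℕ) (i : Fin d)
    (k : ℕ) : (partialDeriv i)^[k] (kernelProd z n) =
      kernelProd z (Function.update n i (n i + k)) := by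
  induction k with
  | zero => simp
  | succ k ih =>
    rw [Function.iterate_succ_apply', ih, partialDeriv_kernelProd]
    simp [add_assoc]

lemma multiDeriv_fbiKernel (z : EuclideanSpace ℂ (Fin d)) (β : Fin d → ℕ) :
    multiDeriv β (fbiKernel z) = kernelProd z β := by
  rw [fbiKernel_eq]
  unfold multiDeriv
  have key : ∀ l : List (Fin d), l.Nodup →
      l.foldr (fun i g => (partialDeriv i)^[β i] g) (kernelProd z 0) =
        kernelProd z (fun i => if i ∈ l then β i else 0) := by
    intro l
    induction l with
    | nil => intro _; simp; rfl
    | cons i l ih =>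
      intro hl
      obtain ⟨h1, h2⟩ := List.nodup_cons.1 hl
      simp only [List.foldr_cons]
      rw [ih h2, iterate_partialDeriv_kernelProd]
      congr 1
      funext j
      by_cases hj : j = i
      · subst hj; simp [h1]
      · simp [hj]
  rw [key _ (List.nodup_finRange d)]
  congr 1
  funext i
  simp

lemma isGS_fbiKernel {θ : ℝ} (hθ : 1 / 2 ≤ θ) (z : EuclideanSpace ℂ (Fin d)) :
    IsGS θ (fbiKernel z) := by
  refine ⟨?_, Real.exp 2, Real.exp_pos _, ∏ j, Real.exp (3 * ‖z j‖ ^ 2), ?_⟩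
  · have hs : ContDiff ℝ ∞ (fun y : EuclideanSpace ℝ (Fin d) => ∏ j, kernelOne (z j) (y j)) := by
      apply contDiff_prod
      intro j _
      exact (contDiff_kernelOne (z j)).comp
        (EuclideanSpace.proj j : EuclideanSpace ℝ (Fin d) →L[ℝ] ℝ).contDiff
    rw [fbiKernel_eq]
    convert hs using 1
    funext y
    simp [kernelProd]
  · intro α β x
    rw [multiDeriv_fbiKernel]
    unfold kernelProd
    rw [← Finset.prod_mul_distrib, norm_prod]
    have hsq : ∀ γ : Fin d → ℕ, ∏ j, Real.sqrt ((γ j).factorial : ℝ) ≤ multiFactorial γ ^ θ := by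
      intro γ
      calc ∏ j, Real.sqrt ((γ j).factorial : ℝ) = multiFactorial γ ^ (1 / 2 : ℝ) := by
            unfold multiFactorial
            rw [← Real.finsetProd_rpow _ _ (fun i _ => by positivity)]
            simp only [Real.sqrt_eq_rpow]
        _ ≤ _ := Real.rpow_le_rpow_of_exponent_le (multiFactorial_ge_one γ) hθ
    calc ∏ j, ‖((x j : ℝ) : ℂ) ^ α j * iteratedDeriv (β j) (fun s : ℝ => kernelOne (z j) s) (x j)‖
        ≤ ∏ j, (Real.exp (3 * ‖z j‖ ^ 2) * Real.exp 2 ^ (α j + β j) *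
            Real.sqrt ((α j).factorial) * Real.sqrt ((β j).factorial)) := by
          refine Finset.prod_le_prod (fun _ _ => norm_nonneg _) fun j _ => ?_
          rw [norm_mul, norm_pow, Complex.norm_real, Real.norm_eq_abs]
          exact kernelOne_bound (z j) (α j) (β j) (x j)
      _ = (∏ j, Real.exp (3 * ‖z j‖ ^ 2)) * Real.exp 2 ^ (∑ i, α i + ∑ i, β i) *
            (∏ j, Real.sqrt ((α j).factorial : ℝ)) * ∏ j, Real.sqrt ((β j).factorial : ℝ) := by
          simp only [Finset.prod_mul_distrib]
          rw [Finset.prod_pow_eq_pow_sum, Finset.sum_add_distrib]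
      _ ≤ _ := by
          have h0 : 0 ≤ multiFactorial α ^ θ :=
            Real.rpow_nonneg (zero_le_one.trans (multiFactorial_ge_one α)) _
          gcongr
          · exact hsq α
          · exact hsq β

end Kernel

/-- The FBI transform `T_φ u(z) = c_φ ⟨u_y, e^{iφ(z,y)}⟩`, `c_φ = 2^{-d/2} π^{-3d/4}`. -/
def fbi {θ : ℝ} {d : ℕ} (hθ : 1 / 2 ≤ θ) (u : GSDual θ d) (z : EuclideanSpace ℂ (Fin d)) : ℂ :=
  (((2 : ℝ) ^ (-(d : ℝ) / 2) * Real.pi ^ (-(3 * (d : ℝ)) / 4) : ℝ) : ℂ) *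
    u.1 ⟨fbiKernel z, isGS_fbiKernel hθ z⟩

/-- The weight `Φ(z) = max_y (-Im φ(z,y)) = |Im z|² / 2`. -/
def weight {d : ℕ} (z : EuclideanSpace ℂ (Fin d)) : ℝ := (∑ j, (z j).im ^ 2) / 2

/-- The map `χ^b_φ : T^*ℝ^d → ℂ^d`, `(x,ξ) ↦ -ξ - ix`. -/
def chi {d : ℕ} (p : EuclideanSpace ℝ (Fin d) × EuclideanSpace ℝ (Fin d)) :
    EuclideanSpace ℂ (Fin d) :=
  WithLp.toLp 2 fun j => -((p.2 j : ℝ) : ℂ) - Complex.I * ((p.1 j : ℝ) : ℂ)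

/-! ## Cones and the global wave front set -/

/-- `L` is an open conic neighbourhood of `z`. -/
def IsConicNhd {d : ℕ} (L : Set (EuclideanSpace ℂ (Fin d))) (z : EuclideanSpace ℂ (Fin d)) :
    Prop :=
  IsOpen L ∧ z ∈ L ∧ ∀ t : ℝ, 0 < t → ∀ w ∈ L, t • w ∈ L

/-- The uniform decay estimate at a point `p` of phase space, for a family of ultradistributions:
`|T_φ u_i(z)| ≤ C e^{-ε|z|^{1/θ} + Φ(z)}` for all `i` and all `z` in an open conic
neighbourhood of `χ^b_φ(p)`. -/
def DecaysAt {θ : ℝ} {d : ℕ} (hθ : 1 / 2 ≤ θ) {I : Type} (u : I → GSDual θ d)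
    (p : EuclideanSpace ℝ (Fin d) × EuclideanSpace ℝ (Fin d)) : Prop :=
  ∃ L, IsConicNhd L (chi p) ∧ ∃ C > 0, ∃ ε > 0, ∀ i, ∀ z ∈ L,
    ‖fbi hθ (u i) z‖ ≤ C * Real.exp (-ε * ‖z‖ ^ (1 / θ) + weight z)

/-- The global wave front set of `u`, a subset of `T^*ℝ^d \ 0`. -/
def waveFront {θ : ℝ} {d : ℕ} (hθ : 1 / 2 ≤ θ) (u : GSDual θ d) :
    Set (EuclideanSpace ℝ (Fin d) × EuclideanSpace ℝ (Fin d)) :=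
  {p | p ≠ 0 ∧ ¬ DecaysAt hθ (fun _ : Unit => u) p}

/-- `Γ` is a closed cone in `T^*ℝ^d \ 0` (closed relative to `T^*ℝ^d \ 0`). -/
def IsClosedCone {d : ℕ} (Γ : Set (EuclideanSpace ℝ (Fin d) × EuclideanSpace ℝ (Fin d))) : Prop :=
  0 ∉ Γ ∧ (∀ t : ℝ, 0 < t → ∀ p ∈ Γ, t • p ∈ Γ) ∧ IsClosed (insert 0 Γ)

lemma DecaysAt.lin {θ : ℝ} {d : ℕ} {hθ : 1 / 2 ≤ θ} {u v : GSDual θ d}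
    {p : EuclideanSpace ℝ (Fin d) × EuclideanSpace ℝ (Fin d)}
    (hu : DecaysAt hθ (fun _ : Unit => u) p) (hv : DecaysAt hθ (fun _ : Unit => v) p) (a b : ℂ) :
    DecaysAt hθ (fun _ : Unit => a • u + b • v) p := by
  obtain ⟨L, ⟨hL1, hL2, hL3⟩, C, hC, ε, hε, h⟩ := hu
  obtain ⟨L', ⟨hL1', hL2', hL3'⟩, C', hC', ε', hε', h'⟩ := hv
  refine ⟨L ∩ L', ⟨hL1.inter hL1', ⟨hL2, hL2'⟩, fun t ht w hw =>
    ⟨hL3 t ht w hw.1, hL3' t ht w hw.2⟩⟩, ‖a‖ * C + ‖b‖ * C' + 1, by positivity,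
    min ε ε', lt_min hε hε', fun i z hz => ?_⟩
  have e : fbi hθ (a • u + b • v) z = a * fbi hθ u z + b * fbi hθ v z := by
    simp only [fbi, Submodule.coe_add, Submodule.coe_smul, LinearMap.add_apply,
      LinearMap.smul_apply, smul_eq_mul]
    ring
  simp only [e]
  have hz0 : 0 ≤ ‖z‖ ^ (1 / θ) := Real.rpow_nonneg (norm_nonneg _) _
  set X := Real.exp (-(min ε ε') * ‖z‖ ^ (1 / θ) + weight z) with hX
  have b1 : ‖fbi hθ u z‖ ≤ C * X := by
    refine (h i z hz.1).trans ?_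
    rw [hX]
    gcongr
    exact min_le_left _ _
  have b2 : ‖fbi hθ v z‖ ≤ C' * X := by
    refine (h' i z hz.2).trans ?_
    rw [hX]
    gcongr
    exact min_le_right _ _
  have hXpos : 0 < X := Real.exp_pos _
  calc ‖a * fbi hθ u z + b * fbi hθ v z‖ ≤ ‖a‖ * ‖fbi hθ u z‖ + ‖b‖ * ‖fbi hθ v z‖ := by
        refine (norm_add_le _ _).trans ?_
        rw [norm_mul, norm_mul]
    _ ≤ ‖a‖ * (C * X) + ‖b‖ * (C' * X) := by gcongr
    _ ≤ _ := by nlinarith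

/-- The space `S'_{θ,Γ}(ℝ^d)` of ultradistributions whose global wave front set lies in `Γ`. -/
def GSDualCone {θ : ℝ} {d : ℕ} (hθ : 1 / 2 ≤ θ)
    (Γ : Set (EuclideanSpace ℝ (Fin d) × EuclideanSpace ℝ (Fin d))) :
    Submodule ℂ (GSDual θ d) where
  carrier := {u | waveFront hθ u ⊆ Γ}
  zero_mem' := by
    rintro p ⟨_, hp⟩
    exact absurd ⟨Set.univ, ⟨isOpen_univ, trivial, fun _ _ _ _ => trivial⟩, 1, one_pos, 1, one_pos,
      fun _ z _ => by
        simp only [fbi, Submodule.coe_zero, LinearMap.zero_apply, mul_zero, norm_zero]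
        positivity⟩ hp
  add_mem' {u v} hu hv := by
    rintro p ⟨hp0, hp⟩
    by_contra hΓ
    have h1 : DecaysAt hθ (fun _ : Unit => u) p := by
      by_contra h; exact hΓ (hu ⟨hp0, h⟩)
    have h2 : DecaysAt hθ (fun _ : Unit => v) p := by
      by_contra h; exact hΓ (hv ⟨hp0, h⟩)
    exact hp (by simpa using h1.lin h2 1 1)
  smul_mem' c u hu := by
    rintro p ⟨hp0, hp⟩
    by_contra hΓ
    have h1 : DecaysAt hθ (fun _ : Unit => u) p := by
      by_contra h; exact hΓ (hu ⟨hp0, h⟩)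
    exact hp (by simpa using h1.lin h1 c 0)

/-- Convergence `u_n → v` in `S'_{θ,Γ}(ℝ^d)`, i.e. `u_n - v → 0`: weak convergence in
`S'_θ(ℝ^d)`, and decay estimates that are uniform in `n` at every point of `T^*ℝ^d \ 0`
outside `Γ`. -/
def ConvergesTo {θ : ℝ} {d : ℕ} {hθ : 1 / 2 ≤ θ}
    {Γ : Set (EuclideanSpace ℝ (Fin d) × EuclideanSpace ℝ (Fin d))}
    (u : ℕ → GSDualCone hθ Γ) (v : GSDualCone hθ Γ) : Prop :=
  (∀ f : GS θ d, Filter.Tendsto (fun n => (u n - v).1.1 f) Filter.atTop (nhds 0)) ∧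
  ∀ p, p ≠ 0 → p ∉ Γ → DecaysAt hθ (fun n => (u n - v).1) p

/-- Continuity of a map `S'_{θ,Γ}(ℝ^d) → S'_{θ,Δ}(ℝ^m)`, in the sense of the above notion of
convergence of sequences. -/
def IsContinuousMap {θ : ℝ} {d m : ℕ} {hθ : 1 / 2 ≤ θ}
    {Γ : Set (EuclideanSpace ℝ (Fin d) × EuclideanSpace ℝ (Fin d))}
    {Δ : Set (EuclideanSpace ℝ (Fin m) × EuclideanSpace ℝ (Fin m))}
    (F : GSDualCone hθ Γ → GSDualCone hθ Δ) : Prop :=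
  ∀ (u : ℕ → GSDualCone hθ Γ) (v : GSDualCone hθ Γ),
    ConvergesTo u v → ConvergesTo (fun n => F (u n)) (F v)

/-! ## Pull-back by a linear map -/

/-- `A^*Γ = {(x, ᵗAξ) : (Ax, ξ) ∈ Γ}`. -/
def pullCone {d m : ℕ} (A : EuclideanSpace ℝ (Fin m) →ₗ[ℝ] EuclideanSpace ℝ (Fin d))
    (Γ : Set (EuclideanSpace ℝ (Fin d) × EuclideanSpace ℝ (Fin d))) :
    Set (EuclideanSpace ℝ (Fin m) × EuclideanSpace ℝ (Fin m)) :=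
  {q | ∃ x ξ, (A x, ξ) ∈ Γ ∧ q = (x, LinearMap.adjoint A ξ)}

/-- `(Ker A \ 0) × {0}`, which is empty if `A` is injective. -/
def kerCone {d m : ℕ} (A : EuclideanSpace ℝ (Fin m) →ₗ[ℝ] EuclideanSpace ℝ (Fin d)) :
    Set (EuclideanSpace ℝ (Fin m) × EuclideanSpace ℝ (Fin m)) :=
  {q | q.1 ≠ 0 ∧ A q.1 = 0 ∧ q.2 = 0}

/-- `F` extends the pull-back `f ↦ f ∘ A` of test functions: every `f ∈ S_θ(ℝ^d)`, regarded as an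
ultradistribution, belongs to `S'_{θ,Γ}(ℝ^d)`, and `F` maps it to the function `f ∘ A`. -/
def ExtendsPullback {θ : ℝ} {d m : ℕ} {hθ : 1 / 2 ≤ θ}
    {Γ : Set (EuclideanSpace ℝ (Fin d) × EuclideanSpace ℝ (Fin d))}
    {Δ : Set (EuclideanSpace ℝ (Fin m) × EuclideanSpace ℝ (Fin m))}
    (A : EuclideanSpace ℝ (Fin m) →ₗ[ℝ] EuclideanSpace ℝ (Fin d))
    (F : GSDualCone hθ Γ → GSDualCone hθ Δ) : Prop :=
  ∀ f : GS θ d, ∃ u : GSDualCone hθ Γ, IsFunction u.1 f.1 ∧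
    IsFunction (F u).1 (fun x => f.1 (A x))

end GelfandShilov

end

noncomputable section

open MeasureTheory
open scoped FourierTransform

namespace GelfandShilov

/-! ## Calculus of multi-index derivatives -/

section MultiIndex

variable {d : ℕ}

/-! For `p = (x, ξ)` let `g_p(y) = e^{-i⟨ξ,y⟩ - |y-x|²/2}` and `Vu(p) = ⟨u, g_p⟩`. Up to a constant,
`|Tu(χ(p))|` is `e^{Φ}` times `|Vu(p)|` (`fbi_chi`), so the wave front set is read off from the
decay of `Vu` in open cones of real phase space (`decaysAt_iff`). For every `ε` some Banach norm of
`g_p` is `O(e^{ε|p|^{1/θ}})` (`gsBound_wavePacket`), so `Vu` grows slower than any such exponential.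
The packets depend continuously on `p` in these norms, so Bochner integration under `u` gives the
inversion formula `u(f) = c ∫ Vu(p) ⟨conj g_p, f⟩ dp` for all ultradistributions (`inversion`).

This dictates the definition `⟨A^*u, h⟩ = c ∫ Vu(p) W_A h(p) dp` with `W_A h(p) = ∫ conj g_p(Ay)
h(y) dy` (`pullPacket`). Since `W_A h(p)` is the Fourier transform at `ᵗAξ` of `h` times a Gaussian
about `x` in the variable `Ay`, it is `O(e^{-ε(|x|^{1/θ} + |ᵗAξ|^{1/θ})})`. This bound gives nothing
in the directions `x = 0`, `ᵗAξ = 0`; those avoid `Γ`, so there `Vu` itself decays. Compactness of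
the unit sphere joins the two regimes (`exists_conicDecay_cover`, `exists_mul_pullPacket_bound`) and
the integral converges.

For the wave front set take `h = g_q` with `q = (y, η)`. Then `W_A g_q(p)` decays in `|x - Ay|` and
`|ᵗAξ - η|`, so the integrand is small in `p` and in `q`, for `q` in a cone about `q₀`, unless some
point of `Γ` is related to `q₀`, which means `q₀ ∈ A^*Γ`, or `Ay = 0` and `η = 0` at `q₀`, where the
estimate no longer sees the size of `q` (`exists_mul_pullPacket_wavePacket_bound`). The second
exception is the kernel part of `Δ`.

All estimates are proved for families with common constants. Banach–Steinhaus turns weak convergence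
into a common growth bound (`exists_uniform_bound`), and sequential continuity follows by dominated
convergence and the uniform conic estimates. That test functions are pulled back by composition is
the inversion formula for the ultradistribution `f ↦ ∫ f(Ay) h(y) dy` (`extendsPullback_pullback`).
For uniqueness, cutting `Vu` off to balls and resynthesising gives test functions that converge to
`u`; the error is a pairing of the same kind with `A = id` (`exists_test_convergesTo`). -/

lemma multiIndex_induction {P : (Fin d → ℕ) → Prop} (h0 : P 0)
    (hs : ∀ γ i, P γ → P (γ + Pi.single i 1)) (γ : Fin d → ℕ) : P γ := by
  suffices H : ∀ n, ∀ γ : Fin d → ℕ, ∑ i, γ i = n → P γ from H _ γ rfl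
  intro n
  induction n with
  | zero =>
    intro γ hγ
    have : γ = 0 := by
      funext i
      exact (Finset.sum_eq_zero_iff.1 hγ) i (Finset.mem_univ i)
    rwa [this]
  | succ n ih =>
    intro γ hγ
    obtain ⟨i, hi⟩ : ∃ i, γ i ≠ 0 := by
      by_contra! h
      simp [h] at hγ
    have hle : Pi.single i 1 ≤ γ := by
      intro j
      by_cases hj : j = i
      · subst hj; simpa using Nat.one_le_iff_ne_zero.2 hi
      · simp [Pi.single_eq_of_ne hj]
    have e : γ - Pi.single i 1 + Pi.single i 1 = γ := tsub_add_cancel_of_le hle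
    rw [← e]
    refine hs _ _ (ih _ ?_)
    have h2 : ∑ j, (γ - Pi.single i 1 + Pi.single i 1 : Fin d → ℕ) j = n + 1 := by rw [e, hγ]
    simp only [Pi.add_apply, Finset.sum_add_distrib, Finset.sum_pi_single', Finset.mem_univ,
      if_true] at h2
    exact Nat.succ_injective h2

lemma sum_add_single (γ : Fin d → ℕ) (i : Fin d) (k : ℕ) :
    ∑ j, (γ + Pi.single i k : Fin d → ℕ) j = ∑ j, γ j + k := by
  simp [Finset.sum_add_distrib]

lemma partialDeriv_comm {f : EuclideanSpace ℝ (Fin d) → ℂ} (hf : ContDiff ℝ ∞ f) (i j : Fin d) :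
    partialDeriv i (partialDeriv j f) = partialDeriv j (partialDeriv i f) := by
  funext x
  have hd : DifferentiableAt ℝ (fderiv ℝ f) x :=
    ((hf.fderiv_right (m := ∞) (by simp)).differentiable (by simp)) x
  have key : ∀ a b : Fin d, partialDeriv a (partialDeriv b f) x =
      fderiv ℝ (fderiv ℝ f) x (EuclideanSpace.single a 1) (EuclideanSpace.single b 1) := by
    intro a b
    unfold partialDeriv
    rw [fderiv_clm_apply hd (differentiableAt_const _)]
    simp
  rw [key, key]
  exact (hf.contDiffAt.isSymmSndFDerivAt (by
    rw [minSmoothness_of_isRCLikeNormedField]; exact WithTop.coe_le_coe.2 (le_top : (2 : ℕ∞) ≤ ⊤))) _ _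

lemma contDiff_iterate_partialDeriv (i : Fin d) (n : ℕ) {f : EuclideanSpace ℝ (Fin d) → ℂ}
    (hf : ContDiff ℝ ∞ f) : ContDiff ℝ ∞ ((partialDeriv i)^[n] f) :=
  (iterate_partialDeriv_lin i n hf hf 0 0).1

lemma iterate_partialDeriv_comm {f : EuclideanSpace ℝ (Fin d) → ℂ} (hf : ContDiff ℝ ∞ f)
    (i j : Fin d) (n : ℕ) :
    (partialDeriv j)^[n] (partialDeriv i f) = partialDeriv i ((partialDeriv j)^[n] f) := by
  induction n with
  | zero => rfl
  | succ n ih =>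
    rw [Function.iterate_succ_apply', ih, Function.iterate_succ_apply',
      partialDeriv_comm (contDiff_iterate_partialDeriv j n hf)]

lemma foldr_partialDeriv (β : Fin d → ℕ) {f : EuclideanSpace ℝ (Fin d) → ℂ}
    (hf : ContDiff ℝ ∞ f) (i : Fin d) (l : List (Fin d)) :
    ContDiff ℝ ∞ (l.foldr (fun i g => (partialDeriv i)^[β i] g) f) ∧
    l.foldr (fun i g => (partialDeriv i)^[β i] g) (partialDeriv i f) =
      partialDeriv i (l.foldr (fun i g => (partialDeriv i)^[β i] g) f) := by
  induction l with
  | nil => exact ⟨hf, rfl⟩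
  | cons j l ih =>
    simp only [List.foldr_cons]
    exact ⟨contDiff_iterate_partialDeriv _ _ ih.1, by
      rw [ih.2, iterate_partialDeriv_comm ih.1]⟩

lemma contDiff_multiDeriv (β : Fin d → ℕ) {f : EuclideanSpace ℝ (Fin d) → ℂ}
    (hf : ContDiff ℝ ∞ f) : ContDiff ℝ ∞ (multiDeriv β f) := by
  by_cases hd : Nonempty (Fin d)
  · exact (foldr_partialDeriv β hf hd.some _).1
  · have : d = 0 := by
      by_contra h
      exact hd ⟨⟨0, Nat.pos_of_ne_zero h⟩⟩
    subst this
    exact hf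

lemma multiDeriv_partialDeriv (β : Fin d → ℕ) {f : EuclideanSpace ℝ (Fin d) → ℂ}
    (hf : ContDiff ℝ ∞ f) (i : Fin d) :
    multiDeriv β (partialDeriv i f) = partialDeriv i (multiDeriv β f) :=
  (foldr_partialDeriv β hf i _).2

lemma multiDeriv_zero (f : EuclideanSpace ℝ (Fin d) → ℂ) : multiDeriv 0 f = f := by
  unfold multiDeriv
  generalize List.finRange d = l
  induction l with
  | nil => rfl
  | cons j l ih => simp

/-- The fold applies the directions in a fixed order, so the extra derivative appears in the middle;
symmetry of second derivatives carries it to the outside. Absence of repetitions in the list ensures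
that it is met only once. -/
lemma multiDeriv_add_single (β : Fin d → ℕ) {f : EuclideanSpace ℝ (Fin d) → ℂ}
    (hf : ContDiff ℝ ∞ f) (i : Fin d) :
    multiDeriv (β + Pi.single i 1) f = partialDeriv i (multiDeriv β f) := by
  unfold multiDeriv
  have key : ∀ l : List (Fin d), l.Nodup →
      l.foldr (fun j g => (partialDeriv j)^[(β + Pi.single i 1 : Fin d → ℕ) j] g) f =
        if i ∈ l then partialDeriv i (l.foldr (fun j g => (partialDeriv j)^[β j] g) f)
        else l.foldr (fun j g => (partialDeriv j)^[β j] g) f := by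
    intro l
    induction l with
    | nil => intro _; simp
    | cons j l ih =>
      intro hl
      obtain ⟨h1, h2⟩ := List.nodup_cons.1 hl
      simp only [List.foldr_cons]
      rw [ih h2]
      by_cases hj : i = j
      · subst hj
        simp [h1, Function.iterate_succ_apply']
      · by_cases hi : i ∈ l
        · simp [hi, hj,
            iterate_partialDeriv_comm (foldr_partialDeriv β hf i l).1]
        · simp [hi, hj]
  rw [key _ (List.nodup_finRange d)]
  simp

lemma multiDeriv_single {f : EuclideanSpace ℝ (Fin d) → ℂ} (hf : ContDiff ℝ ∞ f) (i : Fin d)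
    (n : ℕ) : multiDeriv (Pi.single i n) f = (partialDeriv i)^[n] f := by
  induction n with
  | zero => simp [multiDeriv_zero]
  | succ n ih =>
    rw [Function.iterate_succ_apply', ← ih, ← multiDeriv_add_single _ hf, ← Pi.single_add]

lemma hasFDerivAt_partialDeriv {f : EuclideanSpace ℝ (Fin d) → ℂ} (hf : ContDiff ℝ ∞ f)
    (x : EuclideanSpace ℝ (Fin d)) :
    HasFDerivAt f (∑ i, (EuclideanSpace.proj i : EuclideanSpace ℝ (Fin d) →L[ℝ] ℝ).smulRight
      (partialDeriv i f x)) x := by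
  have h : ∑ i, (EuclideanSpace.proj i : EuclideanSpace ℝ (Fin d) →L[ℝ] ℝ).smulRight
      (partialDeriv i f x) = fderiv ℝ f x := by
    refine ContinuousLinearMap.ext fun v => ?_
    have hv : v = ∑ i, v i • EuclideanSpace.single i (1 : ℝ) := by
      ext j
      simp [Pi.single_apply]
    conv_rhs => rw [hv]
    rw [map_sum, sum_apply]
    refine Finset.sum_congr rfl fun i _ => ?_
    rw [map_smul]
    rfl
  rw [h]
  exact ((hf.differentiable (by simp)) x).hasFDerivAt

lemma hasFDerivAt_multiDeriv {f : EuclideanSpace ℝ (Fin d) → ℂ} (hf : ContDiff ℝ ∞ f)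
    (β : Fin d → ℕ) (x : EuclideanSpace ℝ (Fin d)) :
    HasFDerivAt (multiDeriv β f)
      (∑ i, (EuclideanSpace.proj i : EuclideanSpace ℝ (Fin d) →L[ℝ] ℝ).smulRight
      (multiDeriv (β + Pi.single i 1) f x)) x := by
  simp only [multiDeriv_add_single β hf]
  exact hasFDerivAt_partialDeriv (contDiff_multiDeriv β hf) x

/-- A family of functions in which `F (β + eᵢ)` is the `i`-th partial derivative of `F β` consists
of the derivatives of `F 0`. -/
lemma contDiff_and_multiDeriv_of_family {F : (Fin d → ℕ) → EuclideanSpace ℝ (Fin d) → ℂ}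
    (hF : ∀ β x, HasFDerivAt (F β)
      (∑ i, (EuclideanSpace.proj i : EuclideanSpace ℝ (Fin d) →L[ℝ] ℝ).smulRight
      (F (β + Pi.single i 1) x)) x) :
    ContDiff ℝ ∞ (F 0) ∧ ∀ β, multiDeriv β (F 0) = F β := by
  -- The regularity has to be raised for all members at once, since the derivative of one member is
  -- built from others.
  have hc : ∀ n : ℕ, ∀ β, ContDiff ℝ n (F β) := by
    intro n
    induction n with
    | zero =>
      intro β
      exact contDiff_zero.2 (continuous_iff_continuousAt.2 fun x => (hF β x).continuousAt)
    | succ n ih =>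
      intro β
      refine contDiff_succ_iff_hasFDerivAt.2 ⟨_, ?_, hF β⟩
      refine ContDiff.sum fun i _ => ?_
      exact (ContinuousLinearMap.smulRightL ℝ (EuclideanSpace ℝ (Fin d)) ℂ
        (EuclideanSpace.proj i)).contDiff.comp (ih _)
  have h0 : ContDiff ℝ ∞ (F 0) := contDiff_infty.2 fun n => hc n 0
  refine ⟨h0, multiIndex_induction (multiDeriv_zero _) fun γ i ih => ?_⟩
  rw [multiDeriv_add_single γ h0, ih]
  funext x
  unfold partialDeriv
  rw [(hF γ x).fderiv]
  simp [sum_apply]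

/-! ### Multi-index factorials -/

lemma multiFactorial_pos (α : Fin d → ℕ) : 0 < multiFactorial α :=
  zero_lt_one.trans_le (multiFactorial_ge_one α)

lemma multiFactorial_single (i : Fin d) (n : ℕ) :
    multiFactorial (Pi.single i n) = (n.factorial : ℝ) := by
  unfold multiFactorial
  rw [Finset.prod_eq_single i]
  · simp
  · intro j _ hj
    simp [Pi.single_eq_of_ne hj]
  · simp

lemma multiFactorial_zero : multiFactorial (0 : Fin d → ℕ) = 1 := by
  simp [multiFactorial]

/-- `α! ≤ |α|! ≤ d^{|α|} α!`. -/
lemma multiFactorial_le (α : Fin d → ℕ) : multiFactorial α ≤ ((∑ i, α i).factorial : ℝ) := by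
  unfold multiFactorial
  rw [← Nat.cast_prod]
  exact_mod_cast Nat.le_of_dvd (Nat.factorial_pos _) (Nat.prod_factorial_dvd_factorial_sum _ _)

/-- The multinomial coefficient `|α|!/α!` is one of the terms in the expansion of `(1 + ⋯ +
1)^{|α|}` with `d` summands. -/
lemma factorial_sum_le (α : Fin d → ℕ) :
    ((∑ i, α i).factorial : ℝ) ≤ (d : ℝ) ^ (∑ i, α i) * multiFactorial α := by
  unfold multiFactorial
  have h1 := Nat.multinomial_spec Finset.univ α
  have h2 : Nat.multinomial Finset.univ α ≤ d ^ (∑ i, α i) := by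
    have := Finset.sum_pow_eq_sum_piAntidiag (R := ℕ) (Finset.univ : Finset (Fin d))
      (fun _ => 1) (∑ i, α i)
    simp only [Finset.sum_const, Finset.card_univ, Fintype.card_fin, smul_eq_mul, mul_one, one_pow,
      Finset.prod_const_one, Nat.cast_id] at this
    rw [this]
    refine Finset.single_le_sum (f := fun k => Nat.multinomial Finset.univ k)
      (fun _ _ => Nat.zero_le _) ?_
    simp [Finset.mem_piAntidiag]
  rw [← h1, ← Nat.cast_prod]
  push_cast
  rw [mul_comm]
  gcongr
  exact_mod_cast h2

end MultiIndex

/-! ## Composition with linear maps -/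

section Composition

variable {d m : ℕ}

/-- The largest coordinate dominates the norm up to a dimensional factor. The case `n = 0` is a
separate hypothesis because in dimension zero there is no coordinate to supply it. -/
lemma norm_pow_mul_le_of_coord {y : EuclideanSpace ℝ (Fin d)} {n : ℕ} {X B : ℝ} (hX : 0 ≤ X)
    (hB : 0 ≤ B) (h0 : n = 0 → X ≤ B) (h : ∀ i, |y i| ^ n * X ≤ B) :
    ‖y‖ ^ n * X ≤ ((d : ℝ) + 1) ^ n * B := by
  rcases Nat.eq_zero_or_pos n with hn | hn
  · subst hn; simpa using h0 rfl
  rcases Nat.eq_zero_or_pos d with hd | hd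
  · subst hd
    have : y = 0 := Subsingleton.elim _ _
    rw [this, norm_zero, zero_pow hn.ne', zero_mul]
    positivity
  · have : Nonempty (Fin d) := ⟨⟨0, hd⟩⟩
    obtain ⟨j, hj⟩ := Finite.exists_max fun i => |y i|
    have hy : ‖y‖ ≤ (d + 1) * |y j| := by
      have h1 : ‖y‖ ^ 2 ≤ ((d + 1) * |y j|) ^ 2 := by
        rw [EuclideanSpace.norm_sq_eq]
        calc ∑ i, ‖y i‖ ^ 2 ≤ ∑ _i : Fin d, |y j| ^ 2 := by
              refine Finset.sum_le_sum fun i _ => ?_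
              rw [Real.norm_eq_abs]
              exact pow_le_pow_left₀ (abs_nonneg _) (hj i) 2
          _ = d * |y j| ^ 2 := by simp
          _ ≤ _ := by
              rw [mul_pow]
              gcongr
              have : (0 : ℝ) ≤ d := Nat.cast_nonneg d
              nlinarith
      exact (sq_le_sq₀ (norm_nonneg _) (by positivity)).1 h1
    calc ‖y‖ ^ n * X ≤ ((d + 1) * |y j|) ^ n * X := by gcongr
      _ = (d + 1) ^ n * (|y j| ^ n * X) := by rw [mul_pow, mul_assoc]
      _ ≤ _ := by gcongr; exact h j

lemma GSBound.norm_pow_mul {θ C M : ℝ} {f : EuclideanSpace ℝ (Fin d) → ℂ} (h : GSBound θ C M f)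
    (hC : 0 < C) (hM : 0 ≤ M) (n : ℕ) (γ : Fin d → ℕ) (y : EuclideanSpace ℝ (Fin d)) :
    ‖y‖ ^ n * ‖multiDeriv γ f y‖ ≤
      ((d : ℝ) + 1) ^ n *
        (M * C ^ (n + ∑ i, γ i) * (n.factorial : ℝ) ^ θ * multiFactorial γ ^ θ) := by
  have hγ := multiFactorial_pos γ
  refine norm_pow_mul_le_of_coord (norm_nonneg _) (by positivity) ?_ ?_
  · rintro rfl
    have := h 0 γ y
    simpa [multiFactorial_zero] using this
  · intro i
    have := h (Pi.single i n) γ y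
    rw [multiFactorial_single, norm_mul, Finset.prod_eq_single i
      (fun j _ hj => by simp [Pi.single_eq_of_ne hj]) (by simp)] at this
    simpa using this

lemma contDiff_comp_linear (A : EuclideanSpace ℝ (Fin m) →ₗ[ℝ] EuclideanSpace ℝ (Fin d))
    {f : EuclideanSpace ℝ (Fin d) → ℂ} (hf : ContDiff ℝ ∞ f) :
    ContDiff ℝ ∞ (fun x => f (A x)) :=
  hf.comp (LinearMap.toContinuousLinearMap A).contDiff

lemma partialDeriv_comp_linear (A : EuclideanSpace ℝ (Fin m) →ₗ[ℝ] EuclideanSpace ℝ (Fin d))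
    {f : EuclideanSpace ℝ (Fin d) → ℂ} (hf : ContDiff ℝ ∞ f) (i : Fin m) :
    partialDeriv i (fun x => f (A x)) =
      ∑ j, ((A (EuclideanSpace.single i 1) j : ℝ) : ℂ) • fun x => partialDeriv j f (A x) := by
  funext x
  have h := (hasFDerivAt_partialDeriv hf (A x)).comp x
    (LinearMap.toContinuousLinearMap A).hasFDerivAt
  have h' : fderiv ℝ (fun x => f (A x)) x = _ := h.fderiv
  unfold partialDeriv
  rw [h']
  simp [sum_apply, Finset.sum_apply, partialDeriv]

lemma multiDeriv_sum {ι : Type*} (s : Finset ι) (c : ι → ℂ)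
    {f : ι → EuclideanSpace ℝ (Fin d) → ℂ} (hf : ∀ i, ContDiff ℝ ∞ (f i)) (β : Fin d → ℕ) :
    multiDeriv β (∑ i ∈ s, c i • f i) = ∑ i ∈ s, c i • multiDeriv β (f i) := by
  classical
  induction s using Finset.induction_on with
  | empty =>
    have h0 : ContDiff ℝ ∞ (0 : EuclideanSpace ℝ (Fin d) → ℂ) := contDiff_const
    have := multiDeriv_lin β h0 h0 0 0
    simpa using this
  | insert a s ha ih =>
    have h1 : ContDiff ℝ ∞ (∑ i ∈ s, c i • f i) := by
      have : (∑ i ∈ s, c i • f i) = fun x => ∑ i ∈ s, c i • f i x := by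
        funext x; simp [Finset.sum_apply]
      rw [this]
      exact ContDiff.sum fun i _ => (hf i).const_smul (c i)
    rw [Finset.sum_insert ha, Finset.sum_insert ha, ← ih]
    have := multiDeriv_lin β (hf a) h1 (c a) 1
    simpa using this

/-- Each derivative of `f ∘ A` is, by the chain rule, a combination of functions `(∂ⱼ f) ∘ A` with
coefficients of total size at most `a`; the induction on `β` therefore runs over all `f`. The factor
`s` makes room for a power of `‖A x‖`. -/
lemma mul_norm_multiDeriv_comp_le
    (A : EuclideanSpace ℝ (Fin m) →ₗ[ℝ] EuclideanSpace ℝ (Fin d)) {a : ℝ}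
    (ha : ∀ i, ∑ j, |A (EuclideanSpace.single i 1) j| ≤ a) (ha0 : 0 ≤ a) (β : Fin m → ℕ) :
    ∀ {f : EuclideanSpace ℝ (Fin d) → ℂ}, ContDiff ℝ ∞ f → ∀ (x : EuclideanSpace ℝ (Fin m))
      (s K : ℝ), 0 ≤ s → 0 ≤ K →
      (∀ γ : Fin d → ℕ, ∑ i, γ i = ∑ i, β i → s * ‖multiDeriv γ f (A x)‖ ≤ K) →
      s * ‖multiDeriv β (fun x => f (A x)) x‖ ≤ a ^ (∑ i, β i) * K := by
  induction β using multiIndex_induction with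
  | h0 =>
    intro f _ x s K _ _ h
    simpa [multiDeriv_zero] using h 0 (by simp)
  | hs β i ih =>
    intro f hf x s K hs hK h
    rw [multiDeriv_add_single β (contDiff_comp_linear A hf),
      ← multiDeriv_partialDeriv β (contDiff_comp_linear A hf), partialDeriv_comp_linear A hf,
      multiDeriv_sum _ _ (fun j => contDiff_comp_linear A (contDiff_partialDeriv j hf)),
      Finset.sum_apply, sum_add_single, pow_succ]
    have hj : ∀ j, s * ‖multiDeriv β (fun x => partialDeriv j f (A x)) x‖ ≤
        a ^ (∑ i, β i) * K := by
      intro j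
      refine ih (contDiff_partialDeriv j hf) x s K hs hK fun γ hγ => ?_
      rw [multiDeriv_partialDeriv γ hf, ← multiDeriv_add_single γ hf]
      exact h _ (by rw [sum_add_single, sum_add_single, hγ])
    calc s * ‖∑ j, (((A (EuclideanSpace.single i 1) j : ℝ) : ℂ) •
          multiDeriv β (fun x => partialDeriv j f (A x))) x‖
        ≤ s * ∑ j, |A (EuclideanSpace.single i 1) j| *
          ‖multiDeriv β (fun x => partialDeriv j f (A x)) x‖ := by
          gcongr
          refine (norm_sum_le _ _).trans (le_of_eq ?_)
          simp
      _ = ∑ j, |A (EuclideanSpace.single i 1) j| *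
          (s * ‖multiDeriv β (fun x => partialDeriv j f (A x)) x‖) := by
          rw [Finset.mul_sum]
          exact Finset.sum_congr rfl fun j _ => by ring
      _ ≤ ∑ j, |A (EuclideanSpace.single i 1) j| * (a ^ (∑ i, β i) * K) := by
          exact Finset.sum_le_sum fun j _ => mul_le_mul_of_nonneg_left (hj j) (abs_nonneg _)
      _ ≤ a * (a ^ (∑ i, β i) * K) := by
          rw [← Finset.sum_mul]
          gcongr
          exact ha i
      _ = _ := by ring

lemma factorial_sum_rpow_le {θ : ℝ} (hθ : 0 ≤ θ) (hθ' : θ ≤ 1) (α : Fin d → ℕ) :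
    ((∑ i, α i).factorial : ℝ) ^ θ ≤ ((d : ℝ) + 1) ^ (∑ i, α i) * multiFactorial α ^ θ := by
  have hα := multiFactorial_pos α
  calc ((∑ i, α i).factorial : ℝ) ^ θ ≤ (((d : ℝ) + 1) ^ (∑ i, α i) * multiFactorial α) ^ θ := by
        refine Real.rpow_le_rpow (by positivity) ((factorial_sum_le α).trans ?_) hθ
        gcongr
        linarith
    _ = (((d : ℝ) + 1) ^ (∑ i, α i)) ^ θ * multiFactorial α ^ θ :=
        Real.mul_rpow (by positivity) hα.le
    _ ≤ _ := by
        gcongr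
        refine (Real.rpow_le_rpow_of_exponent_le (one_le_pow₀ (by simp)) hθ').trans (le_of_eq ?_)
        exact Real.rpow_one _

/-- The pull-back of a Gelfand-Shilov function by an injective linear map. -/
lemma IsGS.comp_injective {θ : ℝ} (hθ : 0 ≤ θ) (hθ' : θ ≤ 1)
    {A : EuclideanSpace ℝ (Fin m) →ₗ[ℝ] EuclideanSpace ℝ (Fin d)} (hA : Function.Injective A)
    {f : EuclideanSpace ℝ (Fin d) → ℂ} (hf : IsGS θ f) : IsGS θ (fun x => f (A x)) := by
  obtain ⟨sf, C, hC, M', hM'⟩ := hf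
  have hM := hM'.mono hC le_rfl (le_max_left M' 0) (le_max_right _ _)
  set M := max M' 0
  have hM0 : 0 ≤ M := le_max_right _ _
  -- Injectivity enters only here: powers of `x` are dominated by powers of `A x`, in which `f` has
  -- moment bounds.
  obtain ⟨κ, hκ, hanti⟩ := LinearMap.exists_antilipschitzWith A (LinearMap.ker_eq_bot.2 hA)
  have hκ' : ∀ x, ‖x‖ ≤ κ * ‖A x‖ := fun x => by
    simpa using hanti.le_mul_dist x 0
  set a : ℝ := ∑ i, ∑ j, |A (EuclideanSpace.single i 1) j|
  have ha : ∀ i, ∑ j, |A (EuclideanSpace.single i 1) j| ≤ a := fun i =>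
    Finset.single_le_sum (f := fun i => ∑ j, |A (EuclideanSpace.single i 1) j|)
      (fun _ _ => by positivity) (Finset.mem_univ i)
  have ha0 : 0 ≤ a := by positivity
  set D : ℝ := (d : ℝ) + 1
  set m' : ℝ := (m : ℝ) + 1
  -- The first entry is the cost of one power of `x`, the second that of one derivative. The factor
  -- `m'` is the price for replacing `|α|!` and `|β|!` by `α!` and `β!`.
  set E : ℝ := max (κ * D * C * m') (a * C * m')
  have hE : 0 < E := lt_max_of_lt_left (by positivity)
  refine ⟨contDiff_comp_linear A sf, E, hE, M, fun α β x => ?_⟩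
  set N := ∑ i, α i
  set B := ∑ i, β i
  have hα := multiFactorial_pos α
  have hβ := multiFactorial_pos β
  have hx : ‖∏ i, ((x i : ℝ) : ℂ) ^ α i‖ ≤ ‖x‖ ^ N := by
    rw [norm_prod, ← Finset.prod_pow_eq_pow_sum]
    refine Finset.prod_le_prod (fun _ _ => norm_nonneg _) fun i _ => ?_
    rw [norm_pow, Complex.norm_real]
    gcongr
    exact PiLp.norm_apply_le x i
  have key := mul_norm_multiDeriv_comp_le A ha ha0 β sf x (‖A x‖ ^ N)
    (D ^ N * (M * C ^ (N + B) * (m' ^ N * multiFactorial α ^ θ) * (m' ^ B * multiFactorial β ^ θ)))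
    (by positivity) (by positivity) (fun γ hγ => by
      refine (hM.norm_pow_mul hC hM0 N γ (A x)).trans ?_
      have hγ' := multiFactorial_pos γ
      rw [hγ]
      gcongr
      · exact factorial_sum_rpow_le hθ hθ' α
      · refine le_trans ?_ (factorial_sum_rpow_le hθ hθ' β)
        have := multiFactorial_le γ
        rw [hγ] at this
        gcongr)
  rw [norm_mul]
  calc ‖∏ i, ((x i : ℝ) : ℂ) ^ α i‖ * ‖multiDeriv β (fun x => f (A x)) x‖
      ≤ (κ * ‖A x‖) ^ N * ‖multiDeriv β (fun x => f (A x)) x‖ := by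
        gcongr
        exact hx.trans (by gcongr; exact hκ' x)
    _ = κ ^ N * (‖A x‖ ^ N * ‖multiDeriv β (fun x => f (A x)) x‖) := by ring
    _ ≤ κ ^ N * (a ^ B * (D ^ N * (M * C ^ (N + B) * (m' ^ N * multiFactorial α ^ θ) *
          (m' ^ B * multiFactorial β ^ θ)))) := by gcongr
    _ = M * ((κ * D * C * m') ^ N * (a * C * m') ^ B) * multiFactorial α ^ θ *
          multiFactorial β ^ θ := by rw [pow_add]; simp only [mul_pow]; ring
    _ ≤ M * (E ^ N * E ^ B) * multiFactorial α ^ θ * multiFactorial β ^ θ := by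
        gcongr
        · exact le_max_left _ _
        · exact le_max_right _ _
    _ = _ := by rw [pow_add]

end Composition

/-! ## The Banach spaces of Gelfand-Shilov functions -/

section Banach

variable {d : ℕ}

/-- The weight of the seminorm with indices `α`, `β`. -/
def gsWeight (θ C : ℝ) (α β : Fin d → ℕ) : ℝ :=
  C ^ (∑ i, α i + ∑ i, β i) * multiFactorial α ^ θ * multiFactorial β ^ θ

lemma gsWeight_pos (θ : ℝ) {C : ℝ} (hC : 0 < C) (α β : Fin d → ℕ) : 0 < gsWeight θ C α β := by
  have hα := multiFactorial_pos α
  have hβ := multiFactorial_pos β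
  unfold gsWeight
  positivity

lemma gsWeight_zero (θ C : ℝ) : gsWeight θ C (0 : Fin d → ℕ) 0 = 1 := by
  simp [gsWeight, multiFactorial_zero]

/-- The index set of the weighted seminorms. -/
abbrev GSIndex (d : ℕ) : Type := (Fin d → ℕ) × (Fin d → ℕ) × EuclideanSpace ℝ (Fin d)

/-- The values `x^α ∂^β f(x)`, divided by the weights. -/
def gsCoord (θ C : ℝ) (f : EuclideanSpace ℝ (Fin d) → ℂ) (a : GSIndex d) : ℂ :=
  ((gsWeight θ C a.1 a.2.1)⁻¹ : ℝ) * ((∏ i, ((a.2.2 i : ℝ) : ℂ) ^ a.1 i) * multiDeriv a.2.1 f a.2.2)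

lemma gsBound_iff {θ C M : ℝ} (hC : 0 < C) {f : EuclideanSpace ℝ (Fin d) → ℂ} :
    GSBound θ C M f ↔ ∀ a, ‖gsCoord θ C f a‖ ≤ M := by
  have key : ∀ α β x, ‖gsCoord θ C f (α, β, x)‖ ≤ M ↔
      ‖(∏ i, ((x i : ℝ) : ℂ) ^ α i) * multiDeriv β f x‖ ≤
      M * C ^ (∑ i, α i + ∑ i, β i) * multiFactorial α ^ θ * multiFactorial β ^ θ := by
    intro α β x
    have hw := gsWeight_pos θ hC α β
    rw [gsCoord, norm_mul, Complex.norm_real, Real.norm_eq_abs, abs_of_pos (inv_pos.2 hw),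
      inv_mul_le_iff₀ hw, mul_comm (gsWeight θ C α β) M]
    unfold gsWeight
    rw [← mul_assoc, ← mul_assoc]
  exact ⟨fun h a => (key _ _ _).2 (h _ _ _), fun h α β x => (key _ _ _).1 (h _)⟩

/-- The Banach space of functions with finite norm `‖f‖_C`, as a space of bounded families. -/
def GSBanach (θ C : ℝ) (d : ℕ) : Submodule ℂ (lp (fun _ : GSIndex d => ℂ) ⊤) where
  carrier := {φ | ∃ f, ContDiff ℝ ∞ f ∧ ∀ a, φ a = gsCoord θ C f a}
  zero_mem' := by
    have h0 : ContDiff ℝ ∞ (0 : EuclideanSpace ℝ (Fin d) → ℂ) := contDiff_const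
    refine ⟨0, h0, fun a => ?_⟩
    have := multiDeriv_lin a.2.1 h0 h0 0 0
    simp only [zero_smul, add_zero] at this
    simp [gsCoord, this]
  add_mem' := by
    rintro φ ψ ⟨f, hf, hφ⟩ ⟨g, hg, hψ⟩
    refine ⟨f + g, hf.add hg, fun a => ?_⟩
    have := multiDeriv_lin a.2.1 hf hg 1 1
    simp only [one_smul] at this
    rw [lp.coeFn_add, Pi.add_apply, hφ, hψ]
    simp only [gsCoord, this, Pi.add_apply]
    ring
  smul_mem' := by
    rintro c φ ⟨f, hf, hφ⟩
    refine ⟨c • f, hf.const_smul c, fun a => ?_⟩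
    have := multiDeriv_lin a.2.1 hf hf c 0
    simp only [zero_smul, add_zero] at this
    rw [lp.coeFn_smul, Pi.smul_apply, hφ]
    simp only [gsCoord, this, Pi.smul_apply, smul_eq_mul]
    ring

/-- Convergence in the sup norm forces uniform convergence of every derivative, so the limits of the
coordinates with `α = 0` form a family of successive derivatives of one smooth function. The other
coordinates follow pointwise. The resulting completeness is what Banach–Steinhaus and Bochner
integration need. -/
lemma isClosed_gsBanach (θ : ℝ) {C : ℝ} (hC : 0 < C) :
    IsClosed (GSBanach θ C d : Set (lp (fun _ : GSIndex d => ℂ) ⊤)) := by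
  refine IsSeqClosed.isClosed fun φ ψ hφ hlim => ?_
  choose f hf hφ using hφ
  set c : (Fin d → ℕ) → ℝ := fun β => gsWeight θ C 0 β
  have hc : ∀ β, 0 < c β := fun β => gsWeight_pos θ hC 0 β
  have hfφ : ∀ n β x, multiDeriv β (f n) x = (c β : ℂ) * φ n (0, β, x) := by
    intro n β x
    have h0 : ((gsWeight θ C 0 β : ℝ) : ℂ) ≠ 0 := by exact_mod_cast (hc β).ne'
    rw [hφ, gsCoord]
    simp only [c, Pi.zero_apply, pow_zero, Finset.prod_const_one, one_mul, Complex.ofReal_inv]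
    field_simp
  set F : (Fin d → ℕ) → EuclideanSpace ℝ (Fin d) → ℂ := fun β x => (c β : ℂ) * ψ (0, β, x)
  have hdist : ∀ n β x, ‖F β x - multiDeriv β (f n) x‖ ≤ c β * ‖φ n - ψ‖ := by
    intro n β x
    rw [hfφ, ← mul_sub, norm_mul, Complex.norm_real, Real.norm_eq_abs, abs_of_pos (hc β)]
    refine mul_le_mul_of_nonneg_left ?_ (hc β).le
    have := lp.norm_apply_le_norm (by simp) (φ n - ψ) (0, β, x)
    rw [lp.coeFn_sub, Pi.sub_apply] at this
    rwa [norm_sub_rev]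
  have hlim0 : Filter.Tendsto (fun n => ‖φ n - ψ‖) Filter.atTop (nhds 0) :=
    (tendsto_iff_norm_sub_tendsto_zero).1 hlim
  have hpt : ∀ a, Filter.Tendsto (fun n => φ n a) Filter.atTop (nhds (ψ a)) := fun a =>
    ((lp.evalCLM ℂ (fun _ : GSIndex d => ℂ) ⊤ a).continuous.tendsto ψ).comp hlim
  have hF : ∀ β x, HasFDerivAt (F β)
      (∑ i, (EuclideanSpace.proj i : EuclideanSpace ℝ (Fin d) →L[ℝ] ℝ).smulRight
      (F (β + Pi.single i 1) x)) x := by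
    intro β
    refine hasFDerivAt_of_tendstoUniformly (l := Filter.atTop) (f := fun n => multiDeriv β (f n))
      (f' := fun n x => ∑ i, (EuclideanSpace.proj i : EuclideanSpace ℝ (Fin d) →L[ℝ] ℝ).smulRight
      (multiDeriv (β + Pi.single i 1) (f n) x)) ?_
      (fun n x => hasFDerivAt_multiDeriv (hf n) β x) (fun x => ?_)
    · rw [Metric.tendstoUniformly_iff]
      intro ε hε
      have h1 : Filter.Tendsto (fun n => ∑ i : Fin d,
          ‖(EuclideanSpace.proj i : EuclideanSpace ℝ (Fin d) →L[ℝ] ℝ)‖ *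
            (c (β + Pi.single i 1) * ‖φ n - ψ‖)) Filter.atTop (nhds 0) := by
        have := tendsto_finsetSum (Finset.univ : Finset (Fin d)) fun i _ =>
          (hlim0.const_mul (c (β + Pi.single i 1))).const_mul
            ‖(EuclideanSpace.proj i : EuclideanSpace ℝ (Fin d) →L[ℝ] ℝ)‖
        simpa using this
      filter_upwards [h1.eventually (gt_mem_nhds hε)] with n hn x
      refine lt_of_le_of_lt ?_ hn
      rw [dist_eq_norm, ← Finset.sum_sub_distrib]
      refine (norm_sum_le _ _).trans (Finset.sum_le_sum fun i _ => ?_)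
      rw [show ∀ (a : EuclideanSpace ℝ (Fin d) →L[ℝ] ℝ) (y z : ℂ),
        a.smulRight y - a.smulRight z = a.smulRight (y - z) from fun a y z =>
          ContinuousLinearMap.ext fun v => (smul_sub (a v) y z).symm,
        ContinuousLinearMap.norm_smulRight_apply]
      exact mul_le_mul_of_nonneg_left (hdist _ _ _) (norm_nonneg _)
    · simp only [hfφ]
      exact (hpt _).const_mul _
  obtain ⟨h1, h2⟩ := contDiff_and_multiDeriv_of_family hF
  refine ⟨F 0, h1, fun ⟨α, β, x⟩ => ?_⟩
  refine tendsto_nhds_unique (hpt (α, β, x)) ?_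
  have e : (fun n => φ n (α, β, x)) = fun n => (((gsWeight θ C α β)⁻¹ : ℝ) : ℂ) *
      ((∏ i, ((x i : ℝ) : ℂ) ^ α i) * ((c β : ℂ) * φ n (0, β, x))) := by
    funext n
    rw [hφ n (α, β, x), ← hfφ n β x]
    rfl
  rw [e, gsCoord, h2]
  exact ((hpt (0, β, x)).const_mul (c β : ℂ)).const_mul _ |>.const_mul _

lemma completeSpace_gsBanach (θ : ℝ) {C : ℝ} (hC : 0 < C) : CompleteSpace (GSBanach θ C d) :=
  (isClosed_gsBanach θ hC).completeSpace_coe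

/-- The function represented by an element of the Banach space. -/
def gsFun {θ C : ℝ} (φ : GSBanach θ C d) : EuclideanSpace ℝ (Fin d) → ℂ :=
  fun x => φ.1 (0, 0, x)

lemma gsCoord_zero_zero (θ C : ℝ) (f : EuclideanSpace ℝ (Fin d) → ℂ)
    (x : EuclideanSpace ℝ (Fin d)) : gsCoord θ C f (0, 0, x) = f x := by
  simp [gsCoord, gsWeight_zero, multiDeriv_zero]

lemma gsFun_spec {θ C : ℝ} (φ : GSBanach θ C d) :
    ContDiff ℝ ∞ (gsFun φ) ∧ ∀ a, φ.1 a = gsCoord θ C (gsFun φ) a := by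
  obtain ⟨f, hf, h⟩ := φ.2
  have : gsFun φ = f := by
    funext x
    rw [gsFun, h, gsCoord_zero_zero]
  rw [this]
  exact ⟨hf, h⟩

lemma gsBound_gsFun {θ C : ℝ} (hC : 0 < C) (φ : GSBanach θ C d) : GSBound θ C ‖φ‖ (gsFun φ) :=
  (gsBound_iff hC).2 fun a => by
    rw [← (gsFun_spec φ).2]
    exact lp.norm_apply_le_norm (by simp) φ.1 a

/-- The inclusion of the Banach space into the Gelfand-Shilov space. -/
def gsIncl (θ : ℝ) {C : ℝ} (hC : 0 < C) : GSBanach θ C d →ₗ[ℂ] GS θ d where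
  toFun φ := ⟨gsFun φ, (gsFun_spec φ).1, C, hC, ‖φ‖, gsBound_gsFun hC φ⟩
  map_add' _ _ := rfl
  map_smul' _ _ := rfl

/-- A function of finite norm, as an element of the Banach space. -/
def gsMk {θ C M : ℝ} (hC : 0 < C) {f : EuclideanSpace ℝ (Fin d) → ℂ} (hf : ContDiff ℝ ∞ f)
    (h : GSBound θ C M f) : GSBanach θ C d :=
  ⟨⟨gsCoord θ C f, memℓp_infty ⟨M, by
    rintro _ ⟨a, rfl⟩
    exact (gsBound_iff hC).1 h a⟩⟩, f, hf, fun _ => rfl⟩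

lemma gsFun_gsMk {θ C M : ℝ} (hC : 0 < C) {f : EuclideanSpace ℝ (Fin d) → ℂ}
    (hf : ContDiff ℝ ∞ f) (h : GSBound θ C M f) : gsFun (gsMk hC hf h) = f := by
  funext x
  exact gsCoord_zero_zero θ C f x

lemma norm_gsMk_le {θ C M : ℝ} (hC : 0 < C) {f : EuclideanSpace ℝ (Fin d) → ℂ}
    (hf : ContDiff ℝ ∞ f) (h : GSBound θ C M f) (hM : 0 ≤ M) : ‖gsMk hC hf h‖ ≤ M :=
  lp.norm_le_of_forall_le hM fun a => (gsBound_iff hC).1 h a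

lemma gsFun_injective {θ C : ℝ} {φ ψ : GSBanach θ C d} (h : gsFun φ = gsFun ψ) : φ = ψ := by
  refine Subtype.ext (lp.ext (funext fun a => ?_))
  rw [(gsFun_spec φ).2, (gsFun_spec ψ).2, h]

/-- Point evaluation. -/
def gsEval (θ C : ℝ) (x : EuclideanSpace ℝ (Fin d)) : GSBanach θ C d →L[ℂ] ℂ :=
  (lp.evalCLM ℂ (fun _ : GSIndex d => ℂ) ⊤ (0, 0, x)).comp (GSBanach θ C d).subtypeL

lemma gsEval_apply {θ C : ℝ} (x : EuclideanSpace ℝ (Fin d)) (φ : GSBanach θ C d) :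
    gsEval θ C x φ = gsFun φ x := rfl

/-- The restriction of an ultradistribution to the Banach space. -/
def dualCLM {θ C : ℝ} (hC : 0 < C) (u : GSDual θ d) : GSBanach θ C d →L[ℂ] ℂ :=
  (u.1 ∘ₗ gsIncl θ hC).mkContinuousOfExistsBound (by
    obtain ⟨K, hK⟩ := u.2 C hC
    exact ⟨K, fun φ => hK _ _ (norm_nonneg _) (gsBound_gsFun hC φ)⟩)

lemma dualCLM_apply {θ C : ℝ} (hC : 0 < C) (u : GSDual θ d) (φ : GSBanach θ C d) :
    dualCLM hC u φ = u.1 (gsIncl θ hC φ) := rfl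

/-- A pointwise bounded sequence of ultradistributions is bounded on each Banach space. -/
lemma exists_uniform_bound {θ C : ℝ} (hC : 0 < C) (u : ℕ → GSDual θ d)
    (hu : ∀ f : GS θ d, ∃ K, ∀ n, ‖(u n).1 f‖ ≤ K) :
    ∃ K, ∀ (n : ℕ) (f : GS θ d) (M : ℝ), 0 ≤ M → GSBound θ C M f.1 → ‖(u n).1 f‖ ≤ K * M := by
  have := completeSpace_gsBanach (d := d) θ hC
  obtain ⟨K, hK⟩ := banach_steinhaus (g := fun n => dualCLM hC (u n)) fun φ => hu (gsIncl θ hC φ)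
  refine ⟨K, fun n f M hM hf => ?_⟩
  have h1 : f = gsIncl θ hC (gsMk hC f.2.1 hf) := Subtype.ext (gsFun_gsMk hC f.2.1 hf).symm
  rw [h1, ← dualCLM_apply]
  have hK0 : 0 ≤ K := (norm_nonneg (dualCLM hC (u n))).trans (hK n)
  calc _ ≤ ‖dualCLM hC (u n)‖ * ‖gsMk hC f.2.1 hf‖ := ContinuousLinearMap.le_opNorm _ _
    _ ≤ K * M := by gcongr; exacts [hK n, norm_gsMk_le hC _ hf hM]

end Banach

/-! ## Elementary estimates -/

section Elementary

/-- Bounds on all moments give decay of the type `exp (-ε a ^ (1 / θ))`. -/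
lemma le_exp_of_forall_pow_mul_le {θ C a X B : ℝ} (hθ : 0 < θ) (hθ' : θ ≤ 1) (hC : 0 < C)
    (ha : 0 ≤ a) (hX : 0 ≤ X) (hB : 0 ≤ B)
    (h : ∀ k : ℕ, a ^ k * X ≤ B * C ^ k * (k.factorial : ℝ) ^ θ) :
    X ≤ 2 * B * Real.exp (-(θ / (2 * C ^ (1 / θ))) * a ^ (1 / θ)) := by
  have hr : 0 < 1 / θ := by positivity
  -- Raised to the power `1/θ`, the moment bounds become bounds for the terms of the series of
  -- `e^y`; the factor `2` in the denominator makes them geometric, so they can be summed.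
  set y := a ^ (1 / θ) / (2 * C ^ (1 / θ)) with hy
  have hCr : 0 < C ^ (1 / θ) := Real.rpow_pos_of_pos hC _
  have har : 0 ≤ a ^ (1 / θ) := Real.rpow_nonneg ha _
  have hterm : ∀ k : ℕ, y ^ k / k.factorial * X ^ (1 / θ) ≤ B ^ (1 / θ) * (1 / 2) ^ k := by
    intro k
    have h1 := Real.rpow_le_rpow (by positivity) (h k) hr.le
    rw [Real.mul_rpow (by positivity) hX, Real.mul_rpow (by positivity) (by positivity),
      Real.mul_rpow hB (by positivity), ← Real.rpow_mul (by positivity) θ,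
      mul_one_div_cancel hθ.ne', Real.rpow_one, ← Real.rpow_natCast, ← Real.rpow_natCast,
      ← Real.rpow_mul ha, ← Real.rpow_mul hC.le, mul_comm (k : ℝ), Real.rpow_mul ha,
      Real.rpow_mul hC.le, Real.rpow_natCast, Real.rpow_natCast] at h1
    have hk : (0 : ℝ) < k.factorial := by positivity
    rw [hy, div_pow, mul_pow, div_div, div_mul_eq_mul_div, div_le_iff₀ (by positivity), div_pow,
      one_pow]
    refine h1.trans (le_of_eq ?_)
    field_simp
  have hsum : Real.exp y * X ^ (1 / θ) ≤ B ^ (1 / θ) * 2 := by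
    have e1 : HasSum (fun k : ℕ => y ^ k / k.factorial * X ^ (1 / θ))
        (Real.exp y * X ^ (1 / θ)) := by
      rw [Real.exp_eq_exp_ℝ]
      exact (NormedSpace.expSeries_div_hasSum_exp y).mul_right _
    have e2 : HasSum (fun k : ℕ => B ^ (1 / θ) * (1 / 2 : ℝ) ^ k) (B ^ (1 / θ) * 2) :=
      hasSum_geometric_two.mul_left _
    exact hasSum_le hterm e1 e2
  have h2 : X ^ (1 / θ) ≤ 2 * B ^ (1 / θ) * Real.exp (-y) := by
    rw [Real.exp_neg, ← div_eq_mul_inv, le_div_iff₀ (Real.exp_pos _)]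
    linarith
  have h3 := Real.rpow_le_rpow (by positivity) h2 hθ.le
  rw [← Real.rpow_mul hX, one_div_mul_cancel hθ.ne', Real.rpow_one,
    Real.mul_rpow (by positivity) (Real.exp_pos _).le, Real.mul_rpow (by norm_num) (by positivity),
    ← Real.rpow_mul hB, one_div_mul_cancel hθ.ne', Real.rpow_one, ← Real.exp_mul] at h3
  refine h3.trans ?_
  have h4 : (2 : ℝ) ^ θ ≤ 2 := by
    conv_rhs => rw [← Real.rpow_one 2]
    exact Real.rpow_le_rpow_of_exponent_le (by norm_num) hθ'
  have h5 : -y * θ = -(θ / (2 * C ^ (1 / θ))) * a ^ (1 / θ) := by rw [hy]; ring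
  rw [h5]
  gcongr

/-- This is `t^k / k! ≤ e^t` at `t = c a^{1/θ}`, raised to the power `θ`. -/
lemma pow_le_exp_rpow {θ a c : ℝ} (hθ : 0 < θ) (ha : 0 ≤ a) (hc : 0 < c) (k : ℕ) :
    a ^ k ≤ (c ^ (-θ)) ^ k * (k.factorial : ℝ) ^ θ * Real.exp (θ * c * a ^ (1 / θ)) := by
  have har : 0 ≤ a ^ (1 / θ) := Real.rpow_nonneg ha _
  have h1 := Real.pow_div_factorial_le_exp (c * a ^ (1 / θ)) (by positivity) k
  rw [div_le_iff₀ (by positivity)] at h1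
  have h2 := Real.rpow_le_rpow (by positivity) h1 hθ.le
  have e1 : ((c * a ^ (1 / θ)) ^ k) ^ θ = (c ^ θ) ^ k * a ^ k := by
    rw [← Real.rpow_pow_comm (by positivity), Real.mul_rpow hc.le har, ← Real.rpow_mul ha, one_div_mul_cancel hθ.ne',
      Real.rpow_one, mul_pow]
  rw [e1, Real.mul_rpow (Real.exp_pos _).le (by positivity), ← Real.exp_mul] at h2
  have hcθ : 0 < c ^ θ := Real.rpow_pos_of_pos hc _
  rw [Real.rpow_neg hc.le, inv_pow, mul_assoc, ← div_eq_inv_mul, le_div_iff₀ (by positivity)]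
  calc a ^ k * (c ^ θ) ^ k = (c ^ θ) ^ k * a ^ k := mul_comm _ _
    _ ≤ _ := h2
    _ = _ := by rw [mul_comm (Real.exp _)]; congr 2; ring

lemma one_le_one_div {θ : ℝ} (hθ : 1 / 2 ≤ θ) (hθ' : θ ≤ 1) : 1 ≤ 1 / θ := by
  rw [le_div_iff₀ (by linarith)]; linarith

lemma one_div_le_two {θ : ℝ} (hθ : 1 / 2 ≤ θ) : 1 / θ ≤ 2 := by
  rw [div_le_iff₀ (by linarith)]; linarith

/-- The sum is at most twice the larger term, and `2^{1/θ} ≤ 4` because `1/θ ≤ 2`. -/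
lemma add_rpow_le_mul {θ a b : ℝ} (hθ : 1 / 2 ≤ θ) (ha : 0 ≤ a) (hb : 0 ≤ b) :
    (a + b) ^ (1 / θ) ≤ 4 * (a ^ (1 / θ) + b ^ (1 / θ)) := by
  have hr : 0 ≤ 1 / θ := by positivity
  wlog hab : a ≤ b generalizing a b
  · have := this hb ha (le_of_not_ge hab)
    rwa [add_comm b a, add_comm (b ^ (1 / θ))] at this
  have ha' : 0 ≤ a ^ (1 / θ) := Real.rpow_nonneg ha _
  have hb' : 0 ≤ b ^ (1 / θ) := Real.rpow_nonneg hb _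
  calc (a + b) ^ (1 / θ) ≤ (2 * b) ^ (1 / θ) := by
        refine Real.rpow_le_rpow (by positivity) (by linarith) hr
    _ = 2 ^ (1 / θ) * b ^ (1 / θ) := Real.mul_rpow (by norm_num) hb
    _ ≤ 2 ^ (2 : ℝ) * b ^ (1 / θ) := by
        gcongr
        · norm_num
        · exact one_div_le_two hθ
    _ ≤ _ := by
        rw [show (2 : ℝ) ^ (2 : ℝ) = 4 by norm_num]
        linarith

lemma rpow_le_one_add_sq {θ a : ℝ} (hθ : 1 / 2 ≤ θ) (ha : 0 ≤ a) : a ^ (1 / θ) ≤ 1 + a ^ 2 := by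
  rcases le_total a 1 with h | h
  · have : a ^ (1 / θ) ≤ 1 := Real.rpow_le_one ha h (by positivity)
    nlinarith [sq_nonneg a]
  · have := Real.rpow_le_rpow_of_exponent_le h (one_div_le_two hθ)
    rw [Real.rpow_two] at this
    linarith

lemma le_one_add_rpow {θ a : ℝ} (hθ : 1 / 2 ≤ θ) (hθ' : θ ≤ 1) (ha : 0 ≤ a) :
    a ≤ 1 + a ^ (1 / θ) := by
  have h0 : 0 ≤ a ^ (1 / θ) := Real.rpow_nonneg ha _
  rcases le_total a 1 with h | h
  · linarith
  · have := Real.rpow_le_rpow_of_exponent_le h (one_le_one_div hθ hθ')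
    rw [Real.rpow_one] at this
    linarith

/-- As `1/θ ≥ 1`, the function is dominated by a multiple of `e^{-ε‖x‖}`, hence by a multiple of `(1
+ ‖x‖)^{-n}` with `n` larger than the dimension. -/
lemma integrable_exp_neg_norm_rpow {E : Type*} [NormedAddCommGroup E] [NormedSpace ℝ E]
    [FiniteDimensional ℝ E] [MeasurableSpace E] [BorelSpace E] (μ : MeasureTheory.Measure E)
    [μ.IsAddHaarMeasure] {θ ε : ℝ} (hθ : 1 / 2 ≤ θ) (hθ' : θ ≤ 1) (hε : 0 < ε) :
    MeasureTheory.Integrable (fun x : E => Real.exp (-ε * ‖x‖ ^ (1 / θ))) μ := by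
  set n := Module.finrank ℝ E + 1
  have h1 : MeasureTheory.Integrable (fun x : E => (1 + ‖x‖) ^ (-(n : ℝ))) μ :=
    integrable_one_add_norm (by simp [n])
  refine (h1.const_mul (Real.exp (2 * ε) * (n.factorial / ε ^ n))).mono' ?_ ?_
  · refine Continuous.aestronglyMeasurable ?_
    refine Real.continuous_exp.comp (continuous_const.mul (continuous_norm.rpow_const fun _ => ?_))
    exact Or.inr (by positivity)
  · refine Filter.Eventually.of_forall fun x => ?_
    have hx := norm_nonneg x
    rw [Real.norm_eq_abs, abs_of_pos (Real.exp_pos _), Real.rpow_neg (by positivity),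
      Real.rpow_natCast]
    have h2 := Real.pow_div_factorial_le_exp (ε * (1 + ‖x‖)) (by positivity) n
    have h3 := le_one_add_rpow hθ hθ' hx
    have h4 : Real.exp (-ε * ‖x‖ ^ (1 / θ)) ≤ Real.exp (2 * ε) * (Real.exp (ε * (1 + ‖x‖)))⁻¹ := by
      rw [← Real.exp_neg, ← Real.exp_add]
      apply Real.exp_le_exp.2
      nlinarith
    refine h4.trans ?_
    rw [mul_assoc]
    gcongr
    rw [mul_pow] at h2
    have hf : (0 : ℝ) < n.factorial := by positivity
    have h5 : (n.factorial / ε ^ n * ((1 + ‖x‖) ^ n)⁻¹ : ℝ) =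
        (ε ^ n * (1 + ‖x‖) ^ n / n.factorial)⁻¹ := by
      field_simp
    rw [h5]
    gcongr

/-- This selects the radius in the Cauchy estimates: on circles of radius `R = n^{1-θ}` the factor
`n!/R^n` is at most `(n!)^θ`. -/
lemma inv_rpow_pow_le {θ : ℝ} (n : ℕ) (hθ' : θ ≤ 1) :
    (n.factorial : ℝ) ≤ (n.factorial : ℝ) ^ θ * ((n : ℝ) ^ (1 - θ)) ^ n := by
  have hf : (0 : ℝ) < n.factorial := by positivity
  have h1 : (n.factorial : ℝ) = (n.factorial : ℝ) ^ θ * (n.factorial : ℝ) ^ (1 - θ) := by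
    rw [← Real.rpow_add hf]; simp
  have h2 : (n.factorial : ℝ) ^ (1 - θ) ≤ ((n : ℝ) ^ (1 - θ)) ^ n := by
    rw [Real.rpow_pow_comm (by positivity)]
    exact Real.rpow_le_rpow hf.le (by exact_mod_cast Nat.factorial_le_pow n) (by linarith)
  conv_lhs => rw [h1]
  gcongr

end Elementary

/-! ## Gaussian wave packets -/

section WavePacket

variable {d : ℕ}

/-- Off the real axis the oscillation grows at most by `e^{|ξ|R}`. Half the rate of the Gaussian is
given up to replace `Re s` by the centre `t`. -/
lemma norm_kernelOne_chi_le (ξ x t R : ℝ) (s : ℂ) (hs : ‖s - t‖ ≤ R) :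
    Real.exp (-x ^ 2 / 2) * ‖kernelOne (-(ξ : ℂ) - Complex.I * x) s‖ ≤
      Real.exp (|ξ| * R + R ^ 2 / 2 - (t - x) ^ 2 / 4) := by
  unfold kernelOne
  rw [Complex.norm_exp, ← Real.exp_add]
  apply Real.exp_le_exp.2
  have hR : 0 ≤ R := (norm_nonneg _).trans hs
  obtain ⟨a, b⟩ := s
  have h1 : (a - t) ^ 2 + b ^ 2 ≤ R ^ 2 := by
    have : ‖(⟨a, b⟩ : ℂ) - t‖ ^ 2 ≤ R ^ 2 := by gcongr
    rw [Complex.sq_norm, Complex.normSq_apply] at this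
    simp at this
    nlinarith
  have h2 : |b| ≤ R := abs_le_of_sq_le_sq (by nlinarith [sq_nonneg (a - t)]) hR
  have h3 : ξ * b ≤ |ξ| * R := by
    calc ξ * b ≤ |ξ * b| := le_abs_self _
      _ = |ξ| * |b| := abs_mul _ _
      _ ≤ _ := by gcongr
  have h4 : (Complex.I * ((-(ξ : ℂ) - Complex.I * x) *
      (⟨a, b⟩ : ℂ) + Complex.I / 2 * (⟨a, b⟩ : ℂ) ^ 2)).re =
      ξ * b + x * a - (a ^ 2 - b ^ 2) / 2 := by
    simp [sq]
    ring
  rw [h4]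
  nlinarith [sq_nonneg (2 * (a - t) + (t - x))]

/-- Cauchy's estimate on a circle of radius `n^{1-θ}` costs `e^{|ξ| n^{1-θ}}`. Young's inequality
with the exponents `1/θ` and `1/(1-θ)` splits this into `e^{ε|ξ|^{1/θ}}` with arbitrarily small `ε`
and a geometric factor `e^{Kn}`. -/
lemma norm_iteratedDeriv_kernelOne_chi_le {θ : ℝ} (hθ : 1 / 2 ≤ θ) (hθ' : θ < 1) {ε : ℝ}
    (hε : 0 < ε) : ∃ C > 0, ∀ (ξ x t : ℝ) (n : ℕ),
    Real.exp (-x ^ 2 / 2) *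
      ‖iteratedDeriv n (fun s : ℝ => kernelOne (-(ξ : ℂ) - Complex.I * x) s) t‖ ≤
      C ^ n * (n.factorial : ℝ) ^ θ *
        Real.exp (ε * |ξ| ^ (1 / θ)) * Real.exp (-(t - x) ^ 2 / 4) := by
  have hθ0 : 0 < θ := by linarith
  set q := 1 / (1 - θ) with hq
  have hpq : (1 / θ).HolderConjugate q :=
    by
    rw [Real.holderConjugate_iff, hq]
    refine ⟨?_, by simp⟩
    rw [lt_div_iff₀ hθ0]; linarith
  -- With this scaling `(lam |ξ|)^{1/θ}` is exactly `ε |ξ|^{1/θ}`.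
  set lam := ε ^ θ with hlam
  have hlam0 : 0 < lam := Real.rpow_pos_of_pos hε _
  set K := (1 / lam) ^ q with hK
  have hK0 : 0 < K := Real.rpow_pos_of_pos (by positivity) _
  refine ⟨Real.exp (K + 1), Real.exp_pos _, fun ξ x t n => ?_⟩
  rw [iteratedDeriv_real_kernelOne]
  rcases Nat.eq_zero_or_pos n with rfl | hpos
  · have := norm_kernelOne_chi_le ξ x t 0 t (by simp)
    simp only [iteratedDeriv_zero, pow_zero, Nat.factorial_zero, Nat.cast_one, Real.one_rpow,
      one_mul]
    refine this.trans ?_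
    rw [← Real.exp_add]
    apply Real.exp_le_exp.2
    have : 0 ≤ ε * |ξ| ^ (1 / θ) := by positivity
    linarith
  have hn : (1 : ℝ) ≤ n := by exact_mod_cast hpos
  set R := (n : ℝ) ^ (1 - θ) with hR
  have hR0 : 0 < R := Real.rpow_pos_of_pos (by linarith) _
  have hRq : R ^ q = n := by
    rw [hR, ← Real.rpow_mul (by linarith), hq, mul_one_div_cancel (by linarith), Real.rpow_one]
  -- Here `θ ≥ 1/2` is used: `2(1-θ) ≤ 1`, so the Gaussian growth `e^{R²/2}` is geometric in `n`.
  have hR2 : R ^ 2 ≤ n := by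
    rw [hR, ← Real.rpow_natCast, ← Real.rpow_mul (by linarith)]
    conv_rhs => rw [← Real.rpow_one (n : ℝ)]
    exact Real.rpow_le_rpow_of_exponent_le hn (by push_cast; linarith)
  have hyoung : |ξ| * R ≤ ε * |ξ| ^ (1 / θ) + K * n := by
    have h := Real.young_inequality (lam * |ξ|) (1 / lam * R) hpq
    rw [abs_of_nonneg (show 0 ≤ lam * |ξ| by positivity),
      abs_of_nonneg (show 0 ≤ 1 / lam * R by positivity), Real.mul_rpow hlam0.le (abs_nonneg _), Real.mul_rpow (by positivity) hR0.le, hRq, ← hK,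
      hlam, ← Real.rpow_mul hε.le, mul_one_div_cancel hθ0.ne', Real.rpow_one, ← hlam] at h
    have e : lam * |ξ| * (1 / lam * R) = |ξ| * R := by field_simp
    rw [e] at h
    have h1 : ε * |ξ| ^ (1 / θ) / (1 / θ) ≤ ε * |ξ| ^ (1 / θ) :=
      div_le_self (by positivity) (one_le_one_div hθ hθ'.le)
    have h2 : K * n / q ≤ K * n :=
      div_le_self (by positivity) hpq.symm.lt.le
    linarith
  have hc := Complex.norm_iteratedDeriv_le_of_forall_mem_sphere_norm_le (c := (t : ℂ))
    (f := fun s => (Real.exp (-x ^ 2 / 2) : ℂ) * kernelOne (-(ξ : ℂ) - Complex.I * x) s)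
    (C := Real.exp (|ξ| * R + R ^ 2 / 2 - (t - x) ^ 2 / 4)) n hR0
    ((differentiable_kernelOne _).const_mul _).diffContOnCl
    (fun s hs => by
      rw [norm_mul, Complex.norm_real, Real.norm_eq_abs, abs_of_pos (Real.exp_pos _)]
      exact norm_kernelOne_chi_le ξ x t R s (by rw [mem_sphere_iff_norm] at hs; exact hs.le))
  rw [iteratedDeriv_const_mul_field, norm_mul, Complex.norm_real, Real.norm_eq_abs,
    abs_of_pos (Real.exp_pos _)] at hc
  refine hc.trans ?_
  rw [div_le_iff₀ (by positivity)]
  have h1 := inv_rpow_pow_le n hθ'.le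
  have h2 : Real.exp (|ξ| * R + R ^ 2 / 2 - (t - x) ^ 2 / 4) ≤
      Real.exp (K + 1) ^ n * Real.exp (ε * |ξ| ^ (1 / θ)) * Real.exp (-(t - x) ^ 2 / 4) := by
    rw [← Real.exp_nat_mul, ← Real.exp_add, ← Real.exp_add]
    apply Real.exp_le_exp.2
    nlinarith
  calc _ ≤ ((n.factorial : ℝ) ^ θ * R ^ n) * (Real.exp (K + 1) ^ n *
        Real.exp (ε * |ξ| ^ (1 / θ)) * Real.exp (-(t - x) ^ 2 / 4)) := by gcongr
    _ = _ := by ring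

lemma factorial_rpow_mono {θ θ' : ℝ} (h : θ ≤ θ') (k : ℕ) :
    (k.factorial : ℝ) ^ θ ≤ (k.factorial : ℝ) ^ θ' :=
  Real.rpow_le_rpow_of_exponent_le (by exact_mod_cast Nat.factorial_pos k) h

/-- Split `t = x + (t - x)`. Powers of `x` are paid for by `e^{ε|x|^{1/θ}}`, powers of `t - x` by
the Gaussian, at the cost `√(k!) ≤ (k!)^θ`. -/
lemma pow_mul_exp_neg_sq_le {θ : ℝ} (hθ : 1 / 2 ≤ θ) {ε : ℝ} (hε : 0 < ε) :
    ∃ C > 0, ∀ (x t : ℝ) (k : ℕ), |t| ^ k * Real.exp (-(t - x) ^ 2 / 4) ≤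
      2 * C ^ k * (k.factorial : ℝ) ^ θ * Real.exp (ε * |x| ^ (1 / θ)) := by
  have hθ0 : 0 < θ := by linarith
  set c₁ := (ε / θ) ^ (-θ)
  set c₂ := (1 / 2 : ℝ) ^ (-(1 / 2) : ℝ)
  have hc₁ : 0 < c₁ := Real.rpow_pos_of_pos (by positivity) _
  have hc₂ : 0 < c₂ := Real.rpow_pos_of_pos (by positivity) _
  refine ⟨2 * (c₁ + c₂), by positivity, fun x t k => ?_⟩
  have h1 : |x| ^ k ≤ c₁ ^ k * (k.factorial : ℝ) ^ θ * Real.exp (ε * |x| ^ (1 / θ)) := by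
    have := pow_le_exp_rpow hθ0 (abs_nonneg x) (show 0 < ε / θ by positivity) k
    rwa [mul_div_cancel₀ _ hθ0.ne'] at this
  have h2 : |t - x| ^ k ≤ c₂ ^ k * (k.factorial : ℝ) ^ θ * Real.exp ((t - x) ^ 2 / 4) := by
    have := pow_le_exp_rpow (θ := 1 / 2) (by norm_num) (abs_nonneg (t - x))
      (show (0 : ℝ) < 1 / 2 by norm_num) k
    have e : (1 / 2 : ℝ) * (1 / 2) * |t - x| ^ (1 / (1 / 2) : ℝ) = (t - x) ^ 2 / 4 := by
      rw [one_div_one_div, Real.rpow_two, sq_abs]; ring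
    rw [e] at this
    refine this.trans ?_
    have := factorial_rpow_mono hθ k
    gcongr ?_ * ?_ * _
  have h3 : |t| ^ k ≤ 2 ^ k * (|x| ^ k + |t - x| ^ k) := by
    have e1 : |t| ≤ |x| + |t - x| := by
      have := abs_add_le x (t - x)
      simpa using this
    calc |t| ^ k ≤ (|x| + |t - x|) ^ k := by gcongr
      _ ≤ 2 ^ (k - 1) * (|x| ^ k + |t - x| ^ k) := add_pow_le (abs_nonneg _) (abs_nonneg _) k
      _ ≤ _ := by gcongr <;> norm_num
  have hE1 : Real.exp (-(t - x) ^ 2 / 4) ≤ 1 := Real.exp_le_one_iff.2 (by nlinarith [sq_nonneg (t - x)])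
  have hE2 : Real.exp ((t - x) ^ 2 / 4) * Real.exp (-(t - x) ^ 2 / 4) = 1 := by
    rw [← Real.exp_add]; simp [neg_div]
  have hE3 : 1 ≤ Real.exp (ε * |x| ^ (1 / θ)) := Real.one_le_exp (by positivity)
  set e := Real.exp (-(t - x) ^ 2 / 4)
  have he : 0 < e := Real.exp_pos _
  have f1 : |x| ^ k * e ≤ (c₁ + c₂) ^ k * (k.factorial : ℝ) ^ θ * Real.exp (ε * |x| ^ (1 / θ)) := by
    calc |x| ^ k * e ≤ |x| ^ k := mul_le_of_le_one_right (by positivity) hE1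
      _ ≤ _ := h1
      _ ≤ _ := by gcongr; linarith
  have f2 : |t - x| ^ k * e ≤
      (c₁ + c₂) ^ k * (k.factorial : ℝ) ^ θ * Real.exp (ε * |x| ^ (1 / θ)) := by
    calc |t - x| ^ k * e ≤ c₂ ^ k * (k.factorial : ℝ) ^ θ * Real.exp ((t - x) ^ 2 / 4) * e := by
          gcongr
      _ = c₂ ^ k * (k.factorial : ℝ) ^ θ * 1 := by rw [mul_assoc, hE2]
      _ ≤ _ := by gcongr; linarith
  calc |t| ^ k * e ≤ 2 ^ k * (|x| ^ k + |t - x| ^ k) * e := by gcongr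
    _ = 2 ^ k * (|x| ^ k * e + |t - x| ^ k * e) := by ring
    _ ≤ 2 ^ k * ((c₁ + c₂) ^ k * (k.factorial : ℝ) ^ θ * Real.exp (ε * |x| ^ (1 / θ)) +
          (c₁ + c₂) ^ k * (k.factorial : ℝ) ^ θ * Real.exp (ε * |x| ^ (1 / θ))) := by gcongr
    _ = _ := by rw [mul_pow]; ring

/-- The one-dimensional wave packets, with their norms in the spaces of Gelfand-Shilov functions. -/
lemma wavePacketOne_bound {θ : ℝ} (hθ : 1 / 2 ≤ θ) (hθ' : θ < 1) {ε : ℝ} (hε : 0 < ε) :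
    ∃ C > 0, ∀ (ξ x t : ℝ) (k n : ℕ),
    Real.exp (-x ^ 2 / 2) * (|t| ^ k *
      ‖iteratedDeriv n (fun s : ℝ => kernelOne (-(ξ : ℂ) - Complex.I * x) s) t‖) ≤
      2 * Real.exp (ε * (|x| ^ (1 / θ) + |ξ| ^ (1 / θ))) * C ^ (k + n) *
        (k.factorial : ℝ) ^ θ * (n.factorial : ℝ) ^ θ := by
  obtain ⟨C₁, hC₁, h₁⟩ := norm_iteratedDeriv_kernelOne_chi_le hθ hθ' hε
  obtain ⟨C₂, hC₂, h₂⟩ := pow_mul_exp_neg_sq_le hθ hε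
  refine ⟨max C₁ C₂, lt_max_of_lt_left hC₁, fun ξ x t k n => ?_⟩
  calc Real.exp (-x ^ 2 / 2) * (|t| ^ k *
      ‖iteratedDeriv n (fun s : ℝ => kernelOne (-(ξ : ℂ) - Complex.I * x) s) t‖)
      = |t| ^ k * (Real.exp (-x ^ 2 / 2) *
      ‖iteratedDeriv n (fun s : ℝ => kernelOne (-(ξ : ℂ) - Complex.I * x) s) t‖) := by ring
    _ ≤ |t| ^ k * (C₁ ^ n * (n.factorial : ℝ) ^ θ *
        Real.exp (ε * |ξ| ^ (1 / θ)) * Real.exp (-(t - x) ^ 2 / 4)) := 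
        mul_le_mul_of_nonneg_left (h₁ _ _ _ _) (by positivity)
    _ = (|t| ^ k * Real.exp (-(t - x) ^ 2 / 4)) * (C₁ ^ n * (n.factorial : ℝ) ^ θ *
        Real.exp (ε * |ξ| ^ (1 / θ))) := by ring
    _ ≤ (2 * C₂ ^ k * (k.factorial : ℝ) ^ θ * Real.exp (ε * |x| ^ (1 / θ))) *
        (C₁ ^ n * (n.factorial : ℝ) ^ θ * Real.exp (ε * |ξ| ^ (1 / θ))) := 
        mul_le_mul_of_nonneg_right (h₂ _ _ _) (by positivity)
    _ ≤ (2 * max C₁ C₂ ^ k * (k.factorial : ℝ) ^ θ * Real.exp (ε * |x| ^ (1 / θ))) *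
        (max C₁ C₂ ^ n * (n.factorial : ℝ) ^ θ * Real.exp (ε * |ξ| ^ (1 / θ))) := by
        gcongr
        · exact le_max_right _ _
        · exact le_max_left _ _
    _ = _ := by rw [mul_add, Real.exp_add, pow_add]; ring

/-- The normalised wave packet `y ↦ e^{-i⟨ξ,y⟩ - |y-x|²/2}`. -/
def wavePacket (p : EuclideanSpace ℝ (Fin d) × EuclideanSpace ℝ (Fin d)) :
    EuclideanSpace ℝ (Fin d) → ℂ :=
  ((Real.exp (-‖p.1‖ ^ 2 / 2) : ℝ) : ℂ) • fbiKernel (chi p)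

lemma wavePacket_apply (p : EuclideanSpace ℝ (Fin d) × EuclideanSpace ℝ (Fin d))
    (y : EuclideanSpace ℝ (Fin d)) :
    wavePacket p y =
      Complex.exp (-Complex.I * (inner ℝ p.2 y : ℝ)) * (Real.exp (-‖y - p.1‖ ^ 2 / 2) : ℝ) := by
  simp only [wavePacket, Pi.smul_apply, smul_eq_mul, fbiKernel, phase, chi]
  rw [Complex.ofReal_exp, Complex.ofReal_exp, ← Complex.exp_add, ← Complex.exp_add]
  congr 1
  have h1 : ∑ j, (-((p.2 j : ℝ) : ℂ) - Complex.I * ((p.1 j : ℝ) : ℂ)) * ((y j : ℝ) : ℂ) =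
      -((inner ℝ p.2 y : ℝ) : ℂ) - Complex.I * ((inner ℝ p.1 y : ℝ) : ℂ) := by
    simp only [PiLp.inner_apply, RCLike.inner_apply, conj_trivial]
    push_cast
    rw [Finset.mul_sum, ← Finset.sum_neg_distrib, ← Finset.sum_sub_distrib]
    exact Finset.sum_congr rfl fun j _ => by ring
  have h2 : ‖y - p.1‖ ^ 2 = ‖y‖ ^ 2 - 2 * inner ℝ p.1 y + ‖p.1‖ ^ 2 := by
    rw [norm_sub_sq_real, real_inner_comm]
  rw [h1, h2]
  push_cast
  have := Complex.I_sq
  linear_combination (((‖y‖ : ℝ) : ℂ) ^ 2 / 2 - ((inner ℝ p.1 y : ℝ) : ℂ)) * this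

lemma isGS_wavePacket {θ : ℝ} (hθ : 1 / 2 ≤ θ)
    (p : EuclideanSpace ℝ (Fin d) × EuclideanSpace ℝ (Fin d)) : IsGS θ (wavePacket p) :=
  (GS θ d).smul_mem _ (isGS_fbiKernel hθ (chi p))

lemma norm_wavePacket (p : EuclideanSpace ℝ (Fin d) × EuclideanSpace ℝ (Fin d))
    (y : EuclideanSpace ℝ (Fin d)) : ‖wavePacket p y‖ = Real.exp (-‖y - p.1‖ ^ 2 / 2) := by
  rw [wavePacket_apply, norm_mul, Complex.norm_real, Real.norm_eq_abs, abs_of_pos (Real.exp_pos _),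
    Complex.norm_exp]
  simp

lemma continuous_wavePacket_uncurry :
    Continuous fun q : (EuclideanSpace ℝ (Fin d) × EuclideanSpace ℝ (Fin d)) ×
      EuclideanSpace ℝ (Fin d) => wavePacket q.1 q.2 := by
  simp only [wavePacket_apply]
  fun_prop

lemma contDiff_wavePacket (p : EuclideanSpace ℝ (Fin d) × EuclideanSpace ℝ (Fin d)) :
    ContDiff ℝ ∞ (wavePacket p) :=
  (isGS_wavePacket (θ := 1 / 2) le_rfl p).1

lemma multiDeriv_wavePacket (p : EuclideanSpace ℝ (Fin d) × EuclideanSpace ℝ (Fin d))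
    (β : Fin d → ℕ) : multiDeriv β (wavePacket p) =
      ((Real.exp (-‖p.1‖ ^ 2 / 2) : ℝ) : ℂ) • kernelProd (chi p) β := by
  have hs := (isGS_fbiKernel (θ := 1 / 2) le_rfl (chi p)).1
  have := multiDeriv_lin β hs hs ((Real.exp (-‖p.1‖ ^ 2 / 2) : ℝ) : ℂ) 0
  rw [multiDeriv_fbiKernel] at this
  simpa [wavePacket] using this

/-- The norms of the wave packets. -/
lemma gsBound_wavePacket {θ : ℝ} (hθ : 1 / 2 ≤ θ) (hθ' : θ < 1) {ε : ℝ} (hε : 0 < ε) :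
    ∃ C > 0, ∃ M > 0, ∀ p : EuclideanSpace ℝ (Fin d) × EuclideanSpace ℝ (Fin d),
      GSBound θ C (M * Real.exp (ε * ‖p‖ ^ (1 / θ))) (wavePacket p) := by
  have hd : (0 : ℝ) < 2 * d + 1 := by positivity
  -- Each of the `d` coordinates contributes at most `2 ‖p‖^{1/θ}` to the exponent; the `+ 1` covers
  -- dimension zero.
  obtain ⟨C, hC, h⟩ := wavePacketOne_bound hθ hθ' (show 0 < ε / (2 * d + 1) by positivity)
  refine ⟨C, hC, 2 ^ d, by positivity, fun p α β y => ?_⟩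
  have hα := multiFactorial_pos α
  have hβ := multiFactorial_pos β
  rw [multiDeriv_wavePacket]
  have e1 : Real.exp (-‖p.1‖ ^ 2 / 2) = ∏ j, Real.exp (-(p.1 j) ^ 2 / 2) := by
    rw [← Real.exp_sum, EuclideanSpace.norm_sq_eq]
    congr 1
    rw [neg_div, Finset.sum_div, ← Finset.sum_neg_distrib]
    refine Finset.sum_congr rfl fun j _ => ?_
    rw [Real.norm_eq_abs, sq_abs, neg_div]
  have e2 : ‖(∏ i, ((y i : ℝ) : ℂ) ^ α i) *
      (((Real.exp (-‖p.1‖ ^ 2 / 2) : ℝ) : ℂ) • kernelProd (chi p) β) y‖ =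
      ∏ j, (Real.exp (-(p.1 j) ^ 2 / 2) * (|y j| ^ α j *
        ‖iteratedDeriv (β j) (fun s : ℝ => kernelOne (-(p.2 j : ℂ) - Complex.I * p.1 j) s) (y j)‖)) := by
    rw [Pi.smul_apply, smul_eq_mul, norm_mul, norm_mul, Complex.norm_real, Real.norm_eq_abs,
      abs_of_pos (Real.exp_pos _), e1, kernelProd, norm_prod, norm_prod, mul_left_comm,
      ← Finset.prod_mul_distrib, ← Finset.prod_mul_distrib]
    refine Finset.prod_congr rfl fun j _ => ?_
    rw [norm_pow, Complex.norm_real, Real.norm_eq_abs]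
    rfl
  rw [e2]
  calc _ ≤ ∏ j, (2 * Real.exp (ε / (2 * d + 1) * (|p.1 j| ^ (1 / θ) + |p.2 j| ^ (1 / θ))) *
        C ^ (α j + β j) * ((α j).factorial : ℝ) ^ θ * ((β j).factorial : ℝ) ^ θ) := by
        refine Finset.prod_le_prod (fun _ _ => by positivity) fun j _ => ?_
        exact h _ _ _ _ _
    _ = 2 ^ d * Real.exp (∑ j, ε / (2 * d + 1) * (|p.1 j| ^ (1 / θ) + |p.2 j| ^ (1 / θ))) *
          C ^ (∑ i, α i + ∑ i, β i) * multiFactorial α ^ θ * multiFactorial β ^ θ := by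
        simp only [Finset.prod_mul_distrib]
        rw [Finset.prod_pow_eq_pow_sum, Finset.sum_add_distrib, Real.exp_sum, multiFactorial,
          multiFactorial, Real.finsetProd_rpow _ _ (fun i _ => by positivity),
          Real.finsetProd_rpow _ _ (fun i _ => by positivity)]
        simp
    _ ≤ _ := by
        gcongr
        have hp : 0 ≤ ‖p‖ ^ (1 / θ) := by positivity
        have hj : ∀ j, |p.1 j| ^ (1 / θ) + |p.2 j| ^ (1 / θ) ≤ 2 * ‖p‖ ^ (1 / θ) := by
          intro j
          have h1 : |p.1 j| ^ (1 / θ) ≤ ‖p‖ ^ (1 / θ) := by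
            refine Real.rpow_le_rpow (abs_nonneg _) ?_ (by positivity)
            exact (PiLp.norm_apply_le p.1 j).trans (norm_fst_le p)
          have h2 : |p.2 j| ^ (1 / θ) ≤ ‖p‖ ^ (1 / θ) := by
            refine Real.rpow_le_rpow (abs_nonneg _) ?_ (by positivity)
            exact (PiLp.norm_apply_le p.2 j).trans (norm_snd_le p)
          linarith
        calc _ ≤ ∑ _j : Fin d, ε / (2 * d + 1) * (2 * ‖p‖ ^ (1 / θ)) := by
              gcongr with j _
              exact hj j
          _ = ε * ‖p‖ ^ (1 / θ) * (2 * d / (2 * d + 1)) := by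
              simp; ring
          _ ≤ _ := by
              refine mul_le_of_le_one_right (by positivity) ?_
              rw [div_le_one hd]; linarith

end WavePacket

/-! ## The transform `u ↦ ⟨u, wave packet⟩` -/

section Transform

variable {d : ℕ}

/-- The inverse of `chi`. -/
def chiInv (z : EuclideanSpace ℂ (Fin d)) :
    EuclideanSpace ℝ (Fin d) × EuclideanSpace ℝ (Fin d) :=
  (WithLp.toLp 2 fun j => -(z j).im, WithLp.toLp 2 fun j => -(z j).re)

lemma chi_chiInv (z : EuclideanSpace ℂ (Fin d)) : chi (chiInv z) = z := by
  ext j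
  simp only [chi, chiInv]
  push_cast
  rw [neg_neg, mul_neg, sub_neg_eq_add, mul_comm, Complex.re_add_im]

lemma chiInv_chi (p : EuclideanSpace ℝ (Fin d) × EuclideanSpace ℝ (Fin d)) :
    chiInv (chi p) = p := by
  refine Prod.ext ?_ ?_ <;> ext j <;> simp [chi, chiInv]

lemma continuous_chi : Continuous (chi (d := d)) := by
  unfold chi
  fun_prop

lemma continuous_chiInv : Continuous (chiInv (d := d)) := by
  unfold chiInv
  have h : ∀ j : Fin d, Continuous fun z : EuclideanSpace ℂ (Fin d) => z j := fun j => by fun_prop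
  refine Continuous.prodMk ?_ ?_
  · exact (PiLp.continuous_toLp 2 _).comp
      (continuous_pi fun j => (Complex.continuous_im.comp (h j)).neg)
  · exact (PiLp.continuous_toLp 2 _).comp
      (continuous_pi fun j => (Complex.continuous_re.comp (h j)).neg)

lemma chi_smul (t : ℝ) (p : EuclideanSpace ℝ (Fin d) × EuclideanSpace ℝ (Fin d)) :
    chi (t • p) = t • chi p := by
  ext j
  simp [chi]
  ring

lemma norm_chi_sq (p : EuclideanSpace ℝ (Fin d) × EuclideanSpace ℝ (Fin d)) :
    ‖chi p‖ ^ 2 = ‖p.1‖ ^ 2 + ‖p.2‖ ^ 2 := by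
  rw [EuclideanSpace.norm_sq_eq, EuclideanSpace.norm_sq_eq, EuclideanSpace.norm_sq_eq,
    ← Finset.sum_add_distrib]
  refine Finset.sum_congr rfl fun j _ => ?_
  rw [Complex.sq_norm, Complex.normSq_apply, Real.norm_eq_abs, Real.norm_eq_abs, sq_abs, sq_abs]
  simp [chi]
  ring

lemma norm_le_norm_chi (p : EuclideanSpace ℝ (Fin d) × EuclideanSpace ℝ (Fin d)) :
    ‖p‖ ≤ ‖chi p‖ := by
  have h := norm_chi_sq p
  rw [Prod.norm_def]
  refine max_le ?_ ?_
  · exact (sq_le_sq₀ (norm_nonneg _) (norm_nonneg _)).1 (by nlinarith [sq_nonneg ‖p.2‖])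
  · exact (sq_le_sq₀ (norm_nonneg _) (norm_nonneg _)).1 (by nlinarith [sq_nonneg ‖p.1‖])

lemma norm_chi_le (p : EuclideanSpace ℝ (Fin d) × EuclideanSpace ℝ (Fin d)) :
    ‖chi p‖ ≤ 2 * ‖p‖ := by
  have h := norm_chi_sq p
  refine (sq_le_sq₀ (norm_nonneg _) (by positivity)).1 ?_
  have h1 : ‖p.1‖ ^ 2 ≤ ‖p‖ ^ 2 := pow_le_pow_left₀ (norm_nonneg _) (norm_fst_le p) 2
  have h2 : ‖p.2‖ ^ 2 ≤ ‖p‖ ^ 2 := pow_le_pow_left₀ (norm_nonneg _) (norm_snd_le p) 2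
  nlinarith [sq_nonneg ‖p‖]

lemma weight_chi (p : EuclideanSpace ℝ (Fin d) × EuclideanSpace ℝ (Fin d)) :
    weight (chi p) = ‖p.1‖ ^ 2 / 2 := by
  unfold weight
  rw [EuclideanSpace.norm_sq_eq]
  congr 1
  refine Finset.sum_congr rfl fun j _ => ?_
  rw [Real.norm_eq_abs, sq_abs]
  simp [chi]

lemma fbiKernel_eq_smul_wavePacket (p : EuclideanSpace ℝ (Fin d) × EuclideanSpace ℝ (Fin d)) :
    fbiKernel (chi p) = ((Real.exp (‖p.1‖ ^ 2 / 2) : ℝ) : ℂ) • wavePacket p := by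
  rw [wavePacket, smul_smul, ← Complex.ofReal_mul, ← Real.exp_add]
  simp [neg_div]

/-- The derivatives in `s` are partial derivatives of a function that is jointly smooth over `ℂ` in
`(w, s)`; joint smoothness gives holomorphy in the parameter `w`. -/
lemma exists_contDiff_iteratedDeriv_kernelOne (n : ℕ) :
    ∃ F : ℂ × ℂ → ℂ, ContDiff ℂ ∞ F ∧ ∀ w s, F (w, s) = iteratedDeriv n (kernelOne w) s := by
  induction n with
  | zero =>
    refine ⟨fun q => kernelOne q.1 q.2, ?_, fun w s => by simp⟩
    unfold kernelOne
    fun_prop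
  | succ n ih =>
    obtain ⟨F, hF, h⟩ := ih
    refine ⟨fun q => fderiv ℂ F q (0, 1),
      (hF.fderiv_right (m := ∞) (by simp)).clm_apply contDiff_const, fun w s => ?_⟩
    rw [iteratedDeriv_succ, show iteratedDeriv n (kernelOne w) = fun s => F (w, s) from
      funext fun s => (h w s).symm]
    have h1 : HasDerivAt (fun s : ℂ => (w, s)) ((0 : ℂ), (1 : ℂ)) s :=
      (hasDerivAt_const s w).prodMk (hasDerivAt_id s)
    exact (((hF.differentiable (by simp)) (w, s)).hasFDerivAt.comp_hasDerivAt s h1).deriv.symm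

lemma differentiable_iteratedDeriv_kernelOne (n : ℕ) (t : ℝ) :
    Differentiable ℂ fun w => iteratedDeriv n (fun s : ℝ => kernelOne w s) t := by
  obtain ⟨F, hF, h⟩ := exists_contDiff_iteratedDeriv_kernelOne n
  simp only [iteratedDeriv_real_kernelOne, ← h]
  exact (hF.differentiable (by simp)).comp (differentiable_id.prodMk (differentiable_const _))

/-- Holomorphy in `z` of each coordinate, together with bounds common to all coordinates, yields
continuity in the sup norm by the Schwarz lemma. -/
lemma differentiable_gsCoord_fbiKernel (θ C : ℝ) (a : GSIndex d) :
    Differentiable ℂ fun z : EuclideanSpace ℂ (Fin d) => gsCoord θ C (fbiKernel z) a := by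
  simp only [gsCoord, multiDeriv_fbiKernel, kernelProd]
  refine (Differentiable.const_mul (fun z => (HasFDerivAt.finsetProd fun j _ =>
    DifferentiableAt.hasFDerivAt (Differentiable.differentiableAt ?_)).differentiableAt) _).const_mul _
  exact (differentiable_iteratedDeriv_kernelOne (a.2.1 j) (a.2.2 j)).comp
    (EuclideanSpace.proj j : EuclideanSpace ℂ (Fin d) →L[ℂ] ℂ).differentiable

/-- The wave packets depend continuously on the parameters, in the norm of the Banach space. -/
lemma continuous_gsMk_wavePacket {θ C : ℝ} (hC : 0 < C)
    {B : EuclideanSpace ℝ (Fin d) × EuclideanSpace ℝ (Fin d) → ℝ} (hB : Continuous B)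
    (h : ∀ p, GSBound θ C (B p) (wavePacket p)) :
    Continuous fun p => gsMk hC (contDiff_wavePacket p) (h p) := by
  have hs : ∀ z : EuclideanSpace ℂ (Fin d), ContDiff ℝ ∞ (fbiKernel z) := fun z =>
    (isGS_fbiKernel (θ := 1 / 2) le_rfl z).1
  -- The normalising factor `e^{-|x|²/2}` is not holomorphic in `z`, so continuity is proved for the
  -- unnormalised kernels and the factor is restored at the end.
  set B' : EuclideanSpace ℂ (Fin d) → ℝ := fun z =>
    Real.exp (‖(chiInv z).1‖ ^ 2 / 2) * B (chiInv z) with hB'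
  have hB'c : Continuous B' := by
    have := continuous_chiInv (d := d)
    fun_prop
  have hbd : ∀ z, GSBound θ C (B' z) (fbiKernel z) := by
    intro z
    have e : fbiKernel z = ((Real.exp (‖(chiInv z).1‖ ^ 2 / 2) : ℝ) : ℂ) • wavePacket (chiInv z) +
        (0 : ℂ) • wavePacket (chiInv z) := by
      rw [zero_smul, add_zero, ← fbiKernel_eq_smul_wavePacket, chi_chiInv]
    have := GSBound.lin (contDiff_wavePacket _) (contDiff_wavePacket _) (h (chiInv z))
      (h (chiInv z)) ((Real.exp (‖(chiInv z).1‖ ^ 2 / 2) : ℝ) : ℂ) 0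
    rw [← e, Complex.norm_real, Real.norm_eq_abs, abs_of_pos (Real.exp_pos _), norm_zero, zero_mul,
      add_zero] at this
    exact this
  set Φ : EuclideanSpace ℂ (Fin d) → GSBanach θ C d := fun z => gsMk hC (hs z) (hbd z)
  have hΦ : Continuous Φ := by
    refine continuous_iff_continuousAt.2 fun z₀ => ?_
    obtain ⟨R, hR⟩ := (isCompact_closedBall z₀ 1).exists_bound_of_continuousOn hB'c.continuousOn
    have hR0 : 0 ≤ R := (norm_nonneg _).trans (hR z₀ (by simp))
    -- The Schwarz lemma on the unit ball, applied coordinatewise; the Lipschitz constant `2R` does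
    -- not depend on the coordinate.
    have hlip : ∀ z ∈ Metric.ball z₀ 1, dist (Φ z) (Φ z₀) ≤ 2 * R * dist z z₀ := by
      intro z hz
      rw [dist_eq_norm]
      refine lp.norm_le_of_forall_le (f := (Φ z).1 - (Φ z₀).1) (by positivity) fun a => ?_
      have hcoord : ∀ w ∈ Metric.closedBall z₀ 1, ‖gsCoord θ C (fbiKernel w) a‖ ≤ R := fun w hw =>
        ((gsBound_iff hC).1 (hbd w) a).trans ((le_abs_self _).trans (hR w hw))
      have := Complex.dist_le_div_mul_dist_of_mapsTo_ball (c := z₀) (R₁ := 1) (R₂ := 2 * R)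
        (differentiable_gsCoord_fbiKernel θ C a).differentiableOn (fun w hw => by
          rw [Metric.mem_closedBall, dist_eq_norm]
          refine (norm_sub_le _ _).trans ?_
          have h1 := hcoord w (Metric.ball_subset_closedBall hw)
          have h2 := hcoord z₀ (by simp)
          linarith) hz
      rw [div_one, dist_eq_norm] at this
      exact this
    rw [ContinuousAt, tendsto_iff_dist_tendsto_zero]
    refine squeeze_zero' (Filter.Eventually.of_forall fun _ => dist_nonneg)
      (Filter.eventually_of_mem (Metric.ball_mem_nhds z₀ one_pos) hlip) ?_
    have : Filter.Tendsto (fun z => 2 * R * dist z z₀) (nhds z₀) (nhds (2 * R * dist z₀ z₀)) :=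
      (Continuous.tendsto (by fun_prop) z₀)
    simpa using this
  have e : (fun p => gsMk hC (contDiff_wavePacket p) (h p)) =
      fun p => ((Real.exp (-‖p.1‖ ^ 2 / 2) : ℝ) : ℂ) • Φ (chi p) := by
    funext p
    refine gsFun_injective ?_
    rw [gsFun_gsMk]
    have : gsFun (((Real.exp (-‖p.1‖ ^ 2 / 2) : ℝ) : ℂ) • Φ (chi p)) =
      ((Real.exp (-‖p.1‖ ^ 2 / 2) : ℝ) : ℂ) • gsFun (Φ (chi p)) := rfl
    rw [this, gsFun_gsMk]
    rfl
  rw [e]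
  have : Continuous fun p => Φ (chi p) := hΦ.comp continuous_chi
  refine Continuous.fun_smul ?_ this
  fun_prop

/-- The transform `V u(p) = ⟨u, g_p⟩`, where `g_p` is the wave packet at `p`. -/
def stft {θ : ℝ} (hθ : 1 / 2 ≤ θ) (u : GSDual θ d)
    (p : EuclideanSpace ℝ (Fin d) × EuclideanSpace ℝ (Fin d)) : ℂ :=
  u.1 ⟨wavePacket p, isGS_wavePacket hθ p⟩

/-- The normalisation of the wave packet is exactly `e^{-Φ}`, so passing from `T` to the packet
transform removes the weight from every estimate. -/
lemma fbi_chi {θ : ℝ} (hθ : 1 / 2 ≤ θ) (u : GSDual θ d)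
    (p : EuclideanSpace ℝ (Fin d) × EuclideanSpace ℝ (Fin d)) :
    ‖fbi hθ u (chi p)‖ = (2 : ℝ) ^ (-(d : ℝ) / 2) * Real.pi ^ (-(3 * (d : ℝ)) / 4) *
      Real.exp (weight (chi p)) * ‖stft hθ u p‖ := by
  have e : (⟨fbiKernel (chi p), isGS_fbiKernel hθ (chi p)⟩ : GS θ d) =
      ((Real.exp (‖p.1‖ ^ 2 / 2) : ℝ) : ℂ) • ⟨wavePacket p, isGS_wavePacket hθ p⟩ :=
    Subtype.ext (fbiKernel_eq_smul_wavePacket p)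
  rw [fbi, e, map_smul, smul_eq_mul, norm_mul, norm_mul, Complex.norm_real, Complex.norm_real,
    Real.norm_eq_abs, Real.norm_eq_abs, abs_of_pos (Real.exp_pos _), abs_of_nonneg (by positivity),
    weight_chi, ← mul_assoc]
  rfl

lemma continuous_stft {θ : ℝ} (hθ : 1 / 2 ≤ θ) (hθ' : θ < 1) (u : GSDual θ d) :
    Continuous (stft hθ u) := by
  obtain ⟨C, hC, M, hM, h⟩ := gsBound_wavePacket (d := d) hθ hθ' one_pos
  have hB : Continuous fun p : EuclideanSpace ℝ (Fin d) × EuclideanSpace ℝ (Fin d) =>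
      M * Real.exp (1 * ‖p‖ ^ (1 / θ)) :=
    continuous_const.mul (Real.continuous_exp.comp (continuous_const.mul
      (continuous_norm.rpow_const fun _ => Or.inr (by positivity))))
  have h1 := (dualCLM hC u).continuous.comp (continuous_gsMk_wavePacket hC hB h)
  convert h1 using 1
  funext p
  rw [Function.comp_apply, dualCLM_apply, stft]
  congr 1
  exact Subtype.ext (gsFun_gsMk hC (contDiff_wavePacket p) (h p)).symm

/-- The growth condition on the transforms of a bounded family of ultradistributions. -/
def SubexpGrowth (θ : ℝ) {I : Type}
    (b : I → EuclideanSpace ℝ (Fin d) × EuclideanSpace ℝ (Fin d) → ℂ) : Prop :=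
  ∀ ε > 0, ∃ K > 0, ∀ i p, ‖b i p‖ ≤ K * Real.exp (ε * ‖p‖ ^ (1 / θ))

/-- Uniform decay of a family of functions in a conic neighbourhood of `p`. -/
def ConicDecay (θ : ℝ) {I : Type}
    (b : I → EuclideanSpace ℝ (Fin d) × EuclideanSpace ℝ (Fin d) → ℂ)
    (U : Set (EuclideanSpace ℝ (Fin d) × EuclideanSpace ℝ (Fin d))) : Prop :=
  IsOpen U ∧ (∀ t : ℝ, 0 < t → ∀ q ∈ U, t • q ∈ U) ∧ ∃ K > 0, ∃ ε > 0, ∀ i, ∀ q ∈ U,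
    ‖b i q‖ ≤ K * Real.exp (-ε * ‖q‖ ^ (1 / θ))

/-- The map `χ` is a linear homeomorphism over `ℝ`, distorts norms by a bounded factor and carries
cones to cones. After this point only real phase space and the packet transform occur. -/
lemma decaysAt_iff {θ : ℝ} (hθ : 1 / 2 ≤ θ) {I : Type} (u : I → GSDual θ d)
    (p : EuclideanSpace ℝ (Fin d) × EuclideanSpace ℝ (Fin d)) :
    DecaysAt hθ u p ↔ ∃ U, p ∈ U ∧ ConicDecay θ (fun i => stft hθ (u i)) U := by
  have hθ0 : 0 < θ := by linarith
  have hr : 0 ≤ 1 / θ := by positivity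
  set c : ℝ := (2 : ℝ) ^ (-(d : ℝ) / 2) * Real.pi ^ (-(3 * (d : ℝ)) / 4) with hc
  have hc0 : 0 < c := by positivity
  constructor
  · rintro ⟨L, ⟨hL1, hL2, hL3⟩, K, hK, ε, hε, h⟩
    refine ⟨chi ⁻¹' L, hL2, hL1.preimage continuous_chi, fun t ht q hq => ?_, c⁻¹ * K,
      by positivity, ε, hε, fun i q hq => ?_⟩
    · rw [Set.mem_preimage, chi_smul]
      exact hL3 t ht _ hq
    · have h1 := h i (chi q) hq
      rw [fbi_chi, ← hc, Real.exp_add] at h1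
      have h2 : Real.exp (-ε * ‖chi q‖ ^ (1 / θ)) ≤ Real.exp (-ε * ‖q‖ ^ (1 / θ)) := by
        apply Real.exp_le_exp.2
        have := Real.rpow_le_rpow (norm_nonneg _) (norm_le_norm_chi q) hr
        nlinarith
      have hw := Real.exp_pos (weight (chi q))
      have h3 : c * ‖stft hθ (u i) q‖ ≤ K * Real.exp (-ε * ‖chi q‖ ^ (1 / θ)) := by
        refine le_of_mul_le_mul_right ?_ hw
        linarith
      rw [mul_assoc, inv_mul_eq_div, le_div_iff₀ hc0, mul_comm]
      exact h3.trans (by gcongr)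
  · rintro ⟨U, hp, hU1, hU2, K, hK, ε, hε, h⟩
    -- The rate `ε / 4` comes from `‖χ(q)‖ ≤ 2‖q‖` and `2^{1/θ} ≤ 4`.
    refine ⟨chiInv ⁻¹' U, ⟨hU1.preimage continuous_chiInv, ?_, fun t ht w hw => ?_⟩, c * K,
      by positivity, ε / 4, by positivity, fun i z hz => ?_⟩
    · rwa [Set.mem_preimage, chiInv_chi]
    · have : chiInv (t • w) = t • chiInv w := by
        conv_lhs => rw [← chi_chiInv w, ← chi_smul, chiInv_chi]
      rw [Set.mem_preimage, this]
      exact hU2 t ht _ hw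
    · obtain ⟨q, rfl⟩ : ∃ q, chi q = z := ⟨chiInv z, chi_chiInv z⟩
      rw [Set.mem_preimage, chiInv_chi] at hz
      rw [fbi_chi, ← hc, Real.exp_add]
      have h1 := h i q hz
      have h2 : Real.exp (-ε * ‖q‖ ^ (1 / θ)) ≤ Real.exp (-(ε / 4) * ‖chi q‖ ^ (1 / θ)) := by
        apply Real.exp_le_exp.2
        have h3 : ‖chi q‖ ^ (1 / θ) ≤ 4 * ‖q‖ ^ (1 / θ) := by
          calc ‖chi q‖ ^ (1 / θ) ≤ (2 * ‖q‖) ^ (1 / θ) :=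
                Real.rpow_le_rpow (norm_nonneg _) (norm_chi_le q) hr
            _ = 2 ^ (1 / θ) * ‖q‖ ^ (1 / θ) := Real.mul_rpow (by norm_num) (norm_nonneg _)
            _ ≤ _ := by
                gcongr
                calc (2 : ℝ) ^ (1 / θ) ≤ 2 ^ (2 : ℝ) :=
                      Real.rpow_le_rpow_of_exponent_le (by norm_num) (one_div_le_two hθ)
                  _ = 4 := by norm_num
        nlinarith
      calc c * Real.exp (weight (chi q)) * ‖stft hθ (u i) q‖
          ≤ c * Real.exp (weight (chi q)) * (K * Real.exp (-(ε / 4) * ‖chi q‖ ^ (1 / θ))) := by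
            gcongr
            exact h1.trans (by gcongr)
        _ = _ := by ring

/-- A family of ultradistributions that is bounded on each Banach space has transforms of
subexponential growth. -/
lemma subexpGrowth_stft {θ : ℝ} (hθ : 1 / 2 ≤ θ) (hθ' : θ < 1) {I : Type} (u : I → GSDual θ d)
    (hu : ∀ C > 0, ∃ K, ∀ (i : I) (f : GS θ d) (M : ℝ), 0 ≤ M → GSBound θ C M f.1 →
      ‖(u i).1 f‖ ≤ K * M) : SubexpGrowth θ fun i => stft hθ (u i) := by
  intro ε hε
  obtain ⟨C, hC, M, hM, h⟩ := gsBound_wavePacket (d := d) hθ hθ' hε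
  obtain ⟨K, hK⟩ := hu C hC
  refine ⟨max K 1 * M, by positivity, fun i p => ?_⟩
  refine (hK i ⟨wavePacket p, isGS_wavePacket hθ p⟩ _ (by positivity) (h p)).trans ?_
  rw [mul_assoc]
  gcongr
  exact le_max_left _ _

lemma subexpGrowth_stft_single {θ : ℝ} (hθ : 1 / 2 ≤ θ) (hθ' : θ < 1) (u : GSDual θ d) :
    SubexpGrowth θ fun _ : Unit => stft hθ u :=
  subexpGrowth_stft hθ hθ' _ fun C hC => by
    obtain ⟨K, hK⟩ := u.2 C hC
    exact ⟨K, fun _ => hK⟩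

end Transform

/-! ## Fourier transforms of Gelfand-Shilov functions multiplied by Gaussians -/

section GaussFourier

variable {d m : ℕ}

lemma iteratedDeriv_comp_ofReal {F : ℂ → ℂ} (hF : Differentiable ℂ F) (n : ℕ) (t : ℝ) :
    iteratedDeriv n (fun s : ℝ => F s) t = iteratedDeriv n F (t : ℂ) := by
  induction n generalizing t with
  | zero => simp
  | succ n ih =>
    rw [iteratedDeriv_succ, iteratedDeriv_succ, show iteratedDeriv n (fun s : ℝ => F s) =
      fun s : ℝ => iteratedDeriv n F (s : ℂ) from funext ih]
    have hd : DifferentiableAt ℂ (iteratedDeriv n F) (t : ℂ) :=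
      ((hF.contDiff (n := ∞)).differentiable_iteratedDeriv n
        (by exact_mod_cast WithTop.coe_lt_top _)) _
    exact hd.hasDerivAt.comp_ofReal.deriv

/-- Along a line the Gaussian extends to an entire function, to which Cauchy's estimate with radius
`n^{1-θ}` applies as for the wave packets. -/
lemma norm_iteratedDeriv_gauss_line_le {θ : ℝ} (hθ : 1 / 2 ≤ θ) (hθ' : θ ≤ 1)
    (b v : EuclideanSpace ℝ (Fin d)) (n : ℕ) :
    ‖iteratedDeriv n (fun s : ℝ => ((Real.exp (-‖b + s • v‖ ^ 2 / 2) : ℝ) : ℂ)) 0‖ ≤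
      Real.exp (‖v‖ ^ 2 / 2) ^ n * (n.factorial : ℝ) ^ θ * Real.exp (-‖b‖ ^ 2 / 4) := by
  set F : ℂ → ℂ := fun s => Complex.exp (-(((‖b‖ ^ 2 : ℝ) : ℂ) + 2 * s * ((inner ℝ b v : ℝ) : ℂ) +
    s ^ 2 * ((‖v‖ ^ 2 : ℝ) : ℂ)) / 2) with hFdef
  have hF : Differentiable ℂ F := by
    rw [hFdef]; fun_prop
  have e : (fun s : ℝ => ((Real.exp (-‖b + s • v‖ ^ 2 / 2) : ℝ) : ℂ)) = fun s : ℝ => F s := by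
    funext s
    rw [hFdef, norm_add_sq_real, inner_smul_right, norm_smul, mul_pow, Real.norm_eq_abs, sq_abs,
      Complex.ofReal_exp]
    congr 1
    push_cast
    ring
  rw [e, iteratedDeriv_comp_ofReal hF]
  have hbound : ∀ (R : ℝ) (s : ℂ), 0 ≤ R → ‖s‖ ≤ R →
      ‖F s‖ ≤ Real.exp (-‖b‖ ^ 2 / 4 + R ^ 2 * ‖v‖ ^ 2 / 2) := by
    rintro R ⟨σ, τ⟩ hR hs
    have h1 : σ ^ 2 + τ ^ 2 ≤ R ^ 2 := by
      have : ‖(⟨σ, τ⟩ : ℂ)‖ ^ 2 ≤ R ^ 2 := by gcongr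
      rw [Complex.sq_norm, Complex.normSq_apply] at this
      nlinarith
    -- This is `‖b + 2σv‖² ≥ 0`. It sacrifices half of the Gaussian in `b` and leaves only the error
    -- `(σ² + τ²)‖v‖²/2`.
    have h2 : 0 ≤ ‖b‖ ^ 2 + 4 * σ * inner ℝ b v + 4 * σ ^ 2 * ‖v‖ ^ 2 := by
      have := norm_add_sq_real b ((2 * σ) • v)
      rw [inner_smul_right, norm_smul, mul_pow, Real.norm_eq_abs, sq_abs] at this
      nlinarith [sq_nonneg ‖b + (2 * σ) • v‖]
    rw [hFdef, Complex.norm_exp]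
    apply Real.exp_le_exp.2
    have h3 : (-(((‖b‖ ^ 2 : ℝ) : ℂ) + 2 * (⟨σ, τ⟩ : ℂ) * ((inner ℝ b v : ℝ) : ℂ) +
        (⟨σ, τ⟩ : ℂ) ^ 2 * ((‖v‖ ^ 2 : ℝ) : ℂ)) / 2).re =
        -(‖b‖ ^ 2 + 2 * σ * inner ℝ b v + (σ ^ 2 - τ ^ 2) * ‖v‖ ^ 2) / 2 := by
      have : ∀ w : ℂ, (w / 2).re = w.re / 2 := fun w => by simp
      rw [this]
      congr 1
      rw [Complex.neg_re, Complex.add_re, Complex.add_re, Complex.re_mul_ofReal,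
        Complex.re_mul_ofReal, Complex.ofReal_re, sq (⟨σ, τ⟩ : ℂ), Complex.mul_re, Complex.mul_re,
        Complex.re_ofNat, Complex.im_ofNat]
      ring
    rw [h3]
    nlinarith [mul_le_mul_of_nonneg_right h1 (sq_nonneg ‖v‖)]
  rcases Nat.eq_zero_or_pos n with rfl | hpos
  · have := hbound 0 0 le_rfl (by simp)
    simpa using this
  have hn : (1 : ℝ) ≤ n := by exact_mod_cast hpos
  set R := (n : ℝ) ^ (1 - θ) with hR
  have hR0 : 0 < R := Real.rpow_pos_of_pos (by linarith) _
  have hR2 : R ^ 2 ≤ n := by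
    rw [hR, ← Real.rpow_natCast, ← Real.rpow_mul (by linarith)]
    conv_rhs => rw [← Real.rpow_one (n : ℝ)]
    exact Real.rpow_le_rpow_of_exponent_le hn (by push_cast; linarith)
  have hc := Complex.norm_iteratedDeriv_le_of_forall_mem_sphere_norm_le (c := ((0 : ℝ) : ℂ))
    (f := F) (C := Real.exp (-‖b‖ ^ 2 / 4 + R ^ 2 * ‖v‖ ^ 2 / 2)) n hR0 hF.diffContOnCl
    (fun s hs => hbound R s hR0.le (by simpa using (mem_sphere_iff_norm.1 hs).le))
  refine hc.trans ?_
  rw [div_le_iff₀ (by positivity)]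
  have h1 := inv_rpow_pow_le n hθ'
  have h2 : Real.exp (-‖b‖ ^ 2 / 4 + R ^ 2 * ‖v‖ ^ 2 / 2) ≤
      Real.exp (‖v‖ ^ 2 / 2) ^ n * Real.exp (-‖b‖ ^ 2 / 4) := by
    rw [← Real.exp_nat_mul, ← Real.exp_add]
    apply Real.exp_le_exp.2
    nlinarith [mul_le_mul_of_nonneg_right hR2 (sq_nonneg ‖v‖)]
  calc _ ≤ ((n.factorial : ℝ) ^ θ * R ^ n) *
        (Real.exp (‖v‖ ^ 2 / 2) ^ n * Real.exp (-‖b‖ ^ 2 / 4)) := by gcongr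
    _ = _ := by ring

lemma iteratedDeriv_line {k : EuclideanSpace ℝ (Fin m) → ℂ} (hk : ContDiff ℝ ∞ k) (i : Fin m)
    (n : ℕ) (y : EuclideanSpace ℝ (Fin m)) (s : ℝ) :
    iteratedDeriv n (fun s : ℝ => k (y + s • EuclideanSpace.single i 1)) s =
      (partialDeriv i)^[n] k (y + s • EuclideanSpace.single i 1) := by
  induction n generalizing s with
  | zero => simp
  | succ n ih =>
    rw [iteratedDeriv_succ, funext ih, Function.iterate_succ_apply']
    have h1 : HasDerivAt (fun s : ℝ => y + s • EuclideanSpace.single i (1 : ℝ))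
        (EuclideanSpace.single i (1 : ℝ)) s := by
      have := ((hasDerivAt_id s).smul_const (EuclideanSpace.single i (1 : ℝ))).const_add y
      simpa using this
    have h2 := (((contDiff_iterate_partialDeriv i n hk).differentiable (by simp))
      (y + s • EuclideanSpace.single i (1 : ℝ))).hasFDerivAt
    exact (h2.comp_hasDerivAt s h1).deriv

/-- Restriction to the line through `y` in the `i`-th direction reduces this to the Leibniz estimate
in one variable. -/
lemma norm_iterate_partialDeriv_mul_le {f g : EuclideanSpace ℝ (Fin m) → ℂ}
    (hf : ContDiff ℝ ∞ f) (hg : ContDiff ℝ ∞ g) (i : Fin m) (n : ℕ)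
    (y : EuclideanSpace ℝ (Fin m)) :
    ‖(partialDeriv i)^[n] (fun y => f y * g y) y‖ ≤ ∑ k ∈ Finset.range (n + 1),
      (n.choose k : ℝ) * ‖(partialDeriv i)^[k] f y‖ * ‖(partialDeriv i)^[n - k] g y‖ := by
  have hl : ContDiff ℝ ∞ fun s : ℝ => y + s • EuclideanSpace.single i (1 : ℝ) := by fun_prop
  have h := norm_iteratedFDeriv_mul_le (𝕜 := ℝ) (hf.comp hl) (hg.comp hl) 0 (n := n)
    (by exact_mod_cast le_top)
  simp only [norm_iteratedFDeriv_eq_norm_iteratedDeriv] at h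
  have e1 := fun n => iteratedDeriv_line hf i n y 0
  have e2 := fun n => iteratedDeriv_line hg i n y 0
  have e3 := iteratedDeriv_line (hf.mul hg) i n y 0
  simp only [zero_smul, add_zero] at e1 e2 e3
  rw [← e3]
  simp only [← e1, ← e2]
  exact h

/-- The moments of a derivative grow as those of `h` itself, so `n` affects the prefactor but not
the rate of decay. This gives one integrable majorant for all `n`. -/
lemma norm_iterate_partialDeriv_le {θ C M : ℝ} (hθ : 0 < θ) (hθ' : θ ≤ 1) (hC : 0 < C)
    (hM : 0 ≤ M) {h : EuclideanSpace ℝ (Fin m) → ℂ} (hs : ContDiff ℝ ∞ h) (hb : GSBound θ C M h)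
    (i : Fin m) (n : ℕ) (y : EuclideanSpace ℝ (Fin m)) :
    ‖(partialDeriv i)^[n] h y‖ ≤ 2 * (M * C ^ n * (n.factorial : ℝ) ^ θ) *
      Real.exp (-(θ / (2 * (((m : ℝ) + 1) * C) ^ (1 / θ))) * ‖y‖ ^ (1 / θ)) := by
  refine le_exp_of_forall_pow_mul_le hθ hθ' (by positivity) (norm_nonneg _) (norm_nonneg _)
    (by positivity) fun k => ?_
  have := hb.norm_pow_mul hC hM k (Pi.single i n) y
  rw [multiDeriv_single hs, multiFactorial_single] at this
  refine this.trans (le_of_eq ?_)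
  rw [pow_add, mul_pow]
  simp only [Finset.sum_pi_single', Finset.mem_univ, if_true]
  ring

lemma norm_le_of_gsBound {θ C M : ℝ} (hθ : 0 < θ) (hθ' : θ ≤ 1) (hC : 0 < C)
    (hM : 0 ≤ M) {h : EuclideanSpace ℝ (Fin m) → ℂ} (hb : GSBound θ C M h)
    (y : EuclideanSpace ℝ (Fin m)) :
    ‖h y‖ ≤ 2 * M * Real.exp (-(θ / (2 * (((m : ℝ) + 1) * C) ^ (1 / θ))) * ‖y‖ ^ (1 / θ)) := by
  refine le_exp_of_forall_pow_mul_le hθ hθ' (by positivity) (norm_nonneg _) (norm_nonneg _)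
    hM fun k => ?_
  have := hb.norm_pow_mul hC hM k 0 y
  rw [multiDeriv_zero, multiFactorial_zero] at this
  refine this.trans (le_of_eq ?_)
  rw [pow_add, mul_pow]
  simp only [Pi.zero_apply, Finset.sum_const_zero, pow_zero, Real.one_rpow]
  ring

lemma factorial_rpow_mul_le {θ : ℝ} (hθ : 0 ≤ θ) {n k : ℕ} (hk : k ≤ n) :
    (k.factorial : ℝ) ^ θ * ((n - k).factorial : ℝ) ^ θ ≤ (n.factorial : ℝ) ^ θ := by
  rw [← Real.mul_rpow (by positivity) (by positivity)]
  refine Real.rpow_le_rpow (by positivity) ?_ hθ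
  exact_mod_cast Nat.le_of_dvd (Nat.factorial_pos n) (Nat.factorial_mul_factorial_dvd_factorial hk)

lemma contDiff_gauss_comp (A : EuclideanSpace ℝ (Fin m) →ₗ[ℝ] EuclideanSpace ℝ (Fin d))
    (x : EuclideanSpace ℝ (Fin d)) :
    ContDiff ℝ ∞ fun y => ((Real.exp (-‖A y - x‖ ^ 2 / 2) : ℝ) : ℂ) := by
  have hA : ContDiff ℝ ∞ A := (LinearMap.toContinuousLinearMap A).contDiff
  have h1 : ContDiff ℝ ∞ fun y => ‖A y - x‖ ^ 2 := (hA.sub contDiff_const).norm_sq ℝ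
  exact Complex.ofRealCLM.contDiff.comp (Real.contDiff_exp.comp (h1.neg.div_const 2))

lemma norm_iterate_partialDeriv_gauss_le {θ : ℝ} (hθ : 1 / 2 ≤ θ) (hθ' : θ ≤ 1)
    (A : EuclideanSpace ℝ (Fin m) →ₗ[ℝ] EuclideanSpace ℝ (Fin d)) (x : EuclideanSpace ℝ (Fin d))
    (i : Fin m) (n : ℕ) (y : EuclideanSpace ℝ (Fin m)) :
    ‖(partialDeriv i)^[n] (fun y => ((Real.exp (-‖A y - x‖ ^ 2 / 2) : ℝ) : ℂ)) y‖ ≤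
      Real.exp (‖A (EuclideanSpace.single i 1)‖ ^ 2 / 2) ^ n * (n.factorial : ℝ) ^ θ *
        Real.exp (-‖A y - x‖ ^ 2 / 4) := by
  have h := norm_iteratedDeriv_gauss_line_le hθ hθ' (A y - x) (A (EuclideanSpace.single i 1)) n
  have e := iteratedDeriv_line (contDiff_gauss_comp A x) i n y 0
  simp only [zero_smul, add_zero] at e
  rw [← e]
  convert h using 5 with s
  rw [map_add, map_smul, add_sub_right_comm]

/-- Integration by parts against an exponential. -/
lemma integral_exp_mul_iterate_partialDeriv {k : EuclideanSpace ℝ (Fin m) → ℂ}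
    (hk : ContDiff ℝ ∞ k) (i : Fin m) (η : EuclideanSpace ℝ (Fin m))
    (h_int : ∀ n, MeasureTheory.Integrable ((partialDeriv i)^[n] k)) (n : ℕ) :
    ∫ y, Complex.exp (Complex.I * (inner ℝ η y : ℝ)) * (partialDeriv i)^[n] k y =
      (-(Complex.I * η i)) ^ n * ∫ y, Complex.exp (Complex.I * (inner ℝ η y : ℝ)) * k y := by
  set e : EuclideanSpace ℝ (Fin m) → ℂ := fun y => Complex.exp (Complex.I * (inner ℝ η y : ℝ))
  have hnorm : ∀ y, ‖e y‖ = 1 := fun y => by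
    simp only [e, Complex.norm_exp]
    simp
  have hde : ∀ y, HasFDerivAt e ((e y * Complex.I) •
      (Complex.ofRealCLM.comp (innerSL ℝ η))) y := by
    intro y
    have h1 : HasFDerivAt (fun y => ((inner ℝ η y : ℝ) : ℂ))
        (Complex.ofRealCLM.comp (innerSL ℝ η)) y :=
      (Complex.ofRealCLM.comp (innerSL ℝ η)).hasFDerivAt
    have := (h1.const_mul Complex.I).cexp
    rwa [smul_smul] at this
  have hdi : ∀ y, fderiv ℝ e y (EuclideanSpace.single i 1) = Complex.I * η i * e y := by
    intro y
    have hin : inner ℝ η (EuclideanSpace.single i (1 : ℝ)) = η i := by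
      rw [EuclideanSpace.inner_single_right]; simp
    rw [(hde y).fderiv]
    simp [hin]
    ring
  have hcont : Continuous e := continuous_iff_continuousAt.2 fun y => (hde y).continuousAt
  have hI : ∀ n, MeasureTheory.Integrable fun y => e y * (partialDeriv i)^[n] k y := fun n =>
    (h_int n).bdd_mul hcont.aestronglyMeasurable
      (Filter.Eventually.of_forall fun y => (hnorm y).le)
  induction n with
  | zero => simp
  | succ n ih =>
    have hk' := contDiff_iterate_partialDeriv i n hk
    have h := integral_mul_fderiv_eq_neg_fderiv_mul_of_integrable (μ := MeasureTheory.volume)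
      (f := e) (g := (partialDeriv i)^[n] k) (v := EuclideanSpace.single i (1 : ℝ)) (by
        simp only [hdi, mul_assoc]
        exact ((hI n).const_mul _).const_mul _) (by
        have := hI (n + 1)
        rw [Function.iterate_succ_apply'] at this
        exact this) (hI n) (fun y _ => (hde y).differentiableAt)
        (fun y _ => (hk'.differentiable (by simp)) y)
    rw [Function.iterate_succ_apply']
    refine h.trans ?_
    simp only [hdi, mul_assoc (Complex.I * (η i : ℂ))]
    rw [MeasureTheory.integral_const_mul, ih, pow_succ]
    ring

/-- The Fourier transform of a Gelfand-Shilov function, localised by a Gaussian in the image of a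
linear map. -/
lemma exists_gaussFourier_bound {θ : ℝ} (hθ : 1 / 2 ≤ θ) (hθ' : θ < 1)
    (A : EuclideanSpace ℝ (Fin m) →ₗ[ℝ] EuclideanSpace ℝ (Fin d)) {C : ℝ} (hC : 0 < C) :
    ∃ K > 0, ∃ ε > 0, ∀ (h : EuclideanSpace ℝ (Fin m) → ℂ) (M : ℝ), 0 ≤ M → ContDiff ℝ ∞ h →
      GSBound θ C M h → ∀ (x : EuclideanSpace ℝ (Fin d)) (η : EuclideanSpace ℝ (Fin m)),
      ‖∫ y, Complex.exp (Complex.I * (inner ℝ η y : ℝ)) *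
        (((Real.exp (-‖A y - x‖ ^ 2 / 2) : ℝ) : ℂ) * h y)‖ ≤
        K * M * Real.exp (-ε * (‖x‖ ^ (1 / θ) + ‖η‖ ^ (1 / θ))) := by
  have hθ0 : 0 < θ := by linarith
  set ε₀ : ℝ := θ / (2 * (((m : ℝ) + 1) * C) ^ (1 / θ)) with hε₀
  have hε₀p : 0 < ε₀ := by positivity
  set J : ℝ := ∫ y : EuclideanSpace ℝ (Fin m), Real.exp (-(ε₀ / 2) * ‖y‖ ^ (1 / θ)) with hJ
  have hJi := integrable_exp_neg_norm_rpow (E := EuclideanSpace ℝ (Fin m)) MeasureTheory.volume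
    hθ hθ'.le (half_pos hε₀p)
  have hJ0 : 0 ≤ J := MeasureTheory.integral_nonneg fun _ => (Real.exp_pos _).le
  obtain ⟨a, ha0, ha⟩ := (LinearMap.toContinuousLinearMap A).isBoundedLinearMap.bound
  -- Decay in `x` is bought from `‖x‖ ≤ ‖A y - x‖ + a‖y‖`. By `add_rpow_le_mul` the first entry lets
  -- the Gaussian `e^{-‖Ay-x‖²/4}` pay for the first term, up to `e^{1/4}`; the second spends half
  -- of the decay `ε₀` of `h`, leaving `ε₀/2` for integrability in `y`.
  set ε₁ : ℝ := min (1 / 16) (ε₀ / (8 * a ^ (1 / θ))) with hε₁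
  have har : 0 < a ^ (1 / θ) := Real.rpow_pos_of_pos ha0 _
  have hε₁p : 0 < ε₁ := lt_min (by norm_num) (by positivity)
  set C₀ : ℝ := ∑ i, Real.exp (‖A (EuclideanSpace.single i 1)‖ ^ 2 / 2) + 1 with hC₀
  have hC₀p : 0 < C₀ := by positivity
  have hC₀i : ∀ i, Real.exp (‖A (EuclideanSpace.single i 1)‖ ^ 2 / 2) ≤ C₀ := fun i => by
    have := Finset.single_le_sum
      (f := fun i => Real.exp (‖A (EuclideanSpace.single i 1)‖ ^ 2 / 2))
      (fun _ _ => (Real.exp_pos _).le) (Finset.mem_univ i)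
    linarith
  set C₁ : ℝ := ((m : ℝ) + 1) * (C₀ + C) with hC₁
  have hC₁p : 0 < C₁ := by positivity
  set ε₂ : ℝ := θ / (2 * C₁ ^ (1 / θ)) with hε₂
  have hε₂p : 0 < ε₂ := by positivity
  refine ⟨2 * (2 * Real.exp (1 / 4) * J) + 1, by positivity, min ε₁ ε₂, lt_min hε₁p hε₂p,
    fun h M hM hs hb x η => ?_⟩
  set B : ℝ := 2 * M * Real.exp (1 / 4) * J * Real.exp (-ε₁ * ‖x‖ ^ (1 / θ)) with hB
  have hB0 : 0 ≤ B := by positivity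
  set k : EuclideanSpace ℝ (Fin m) → ℂ := fun y =>
    ((Real.exp (-‖A y - x‖ ^ 2 / 2) : ℝ) : ℂ) * h y with hk
  have hks : ContDiff ℝ ∞ k := (contDiff_gauss_comp A x).mul hs
  have hexp : ∀ y, Real.exp (-‖A y - x‖ ^ 2 / 4) * Real.exp (-ε₀ * ‖y‖ ^ (1 / θ)) ≤
      Real.exp (1 / 4) * Real.exp (-ε₁ * ‖x‖ ^ (1 / θ)) *
        Real.exp (-(ε₀ / 2) * ‖y‖ ^ (1 / θ)) := by
    intro y
    rw [← Real.exp_add, ← Real.exp_add, ← Real.exp_add]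
    apply Real.exp_le_exp.2
    have hy0 : 0 ≤ ‖y‖ ^ (1 / θ) := by positivity
    have hx1 : ‖x‖ ≤ ‖A y - x‖ + a * ‖y‖ := by
      have h1 : ‖x‖ ≤ ‖A y - x‖ + ‖A y‖ := by
        have := norm_sub_le (A y) (A y - x)
        rw [sub_sub_cancel] at this
        linarith
      have h2 : ‖A y‖ ≤ a * ‖y‖ := ha y
      linarith
    have hx2 : ‖x‖ ^ (1 / θ) ≤ 4 * ((1 + ‖A y - x‖ ^ 2) + a ^ (1 / θ) * ‖y‖ ^ (1 / θ)) := by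
      calc ‖x‖ ^ (1 / θ) ≤ (‖A y - x‖ + a * ‖y‖) ^ (1 / θ) :=
            Real.rpow_le_rpow (norm_nonneg _) hx1 (by positivity)
        _ ≤ 4 * (‖A y - x‖ ^ (1 / θ) + (a * ‖y‖) ^ (1 / θ)) :=
            add_rpow_le_mul hθ (norm_nonneg _) (by positivity)
        _ ≤ _ := by
            rw [Real.mul_rpow ha0.le (norm_nonneg _)]
            gcongr
            exact rpow_le_one_add_sq hθ (norm_nonneg _)
    have f1 : ε₁ ≤ 1 / 16 := min_le_left _ _
    have f2 : ε₁ * (8 * a ^ (1 / θ)) ≤ ε₀ := by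
      rw [← le_div_iff₀ (by positivity)]
      exact min_le_right _ _
    have f3 := mul_le_mul_of_nonneg_left hx2 hε₁p.le
    have f4 := mul_le_mul_of_nonneg_right f1 (show 0 ≤ 1 + ‖A y - x‖ ^ 2 by positivity)
    have f5 := mul_le_mul_of_nonneg_right f2 hy0
    nlinarith
  have hk0 : ∀ y, ‖k y‖ ≤ 2 * M * Real.exp (1 / 4) * Real.exp (-ε₁ * ‖x‖ ^ (1 / θ)) *
      Real.exp (-(ε₀ / 2) * ‖y‖ ^ (1 / θ)) := by
    intro y
    rw [hk, norm_mul, Complex.norm_real, Real.norm_eq_abs, abs_of_pos (Real.exp_pos _)]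
    have h1 := norm_le_of_gsBound hθ0 hθ'.le hC hM hb y
    have h2 : Real.exp (-‖A y - x‖ ^ 2 / 2) ≤ Real.exp (-‖A y - x‖ ^ 2 / 4) :=
      Real.exp_le_exp.2 (by nlinarith [sq_nonneg ‖A y - x‖])
    calc _ ≤ Real.exp (-‖A y - x‖ ^ 2 / 4) * (2 * M * Real.exp (-ε₀ * ‖y‖ ^ (1 / θ))) := by
          gcongr
      _ = 2 * M * (Real.exp (-‖A y - x‖ ^ 2 / 4) * Real.exp (-ε₀ * ‖y‖ ^ (1 / θ))) := by ring
      _ ≤ 2 * M * _ := mul_le_mul_of_nonneg_left (hexp y) (by positivity)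
      _ = _ := by ring
  have hkn : ∀ i n y, ‖(partialDeriv i)^[n] k y‖ ≤
      2 * M * Real.exp (1 / 4) * Real.exp (-ε₁ * ‖x‖ ^ (1 / θ)) * (C₀ + C) ^ n *
        (n.factorial : ℝ) ^ θ * Real.exp (-(ε₀ / 2) * ‖y‖ ^ (1 / θ)) := by
    intro i n y
    refine (norm_iterate_partialDeriv_mul_le (contDiff_gauss_comp A x) hs i n y).trans ?_
    calc _ ≤ ∑ l ∈ Finset.range (n + 1), (n.choose l : ℝ) *
          (C₀ ^ l * (l.factorial : ℝ) ^ θ * Real.exp (-‖A y - x‖ ^ 2 / 4)) *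
          (2 * (M * C ^ (n - l) * ((n - l).factorial : ℝ) ^ θ) *
            Real.exp (-ε₀ * ‖y‖ ^ (1 / θ))) := by
          refine Finset.sum_le_sum fun l _ => ?_
          have h1 := norm_iterate_partialDeriv_gauss_le hθ hθ'.le A x i l y
          have h2 := norm_iterate_partialDeriv_le hθ0 hθ'.le hC hM hs hb i (n - l) y
          have h3 : Real.exp (‖A (EuclideanSpace.single i 1)‖ ^ 2 / 2) ^ l ≤ C₀ ^ l :=
            pow_le_pow_left₀ (Real.exp_pos _).le (hC₀i i) l
          have h4 := h1.trans (mul_le_mul_of_nonneg_right (mul_le_mul_of_nonneg_right h3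
            (show 0 ≤ (l.factorial : ℝ) ^ θ by positivity)) (Real.exp_pos _).le)
          gcongr
      _ = ∑ l ∈ Finset.range (n + 1), (C₀ ^ l * C ^ (n - l) * (n.choose l : ℝ)) *
          ((l.factorial : ℝ) ^ θ * ((n - l).factorial : ℝ) ^ θ) *
          (2 * M * (Real.exp (-‖A y - x‖ ^ 2 / 4) * Real.exp (-ε₀ * ‖y‖ ^ (1 / θ)))) := by
          refine Finset.sum_congr rfl fun l _ => ?_
          ring
      _ ≤ ∑ l ∈ Finset.range (n + 1), (C₀ ^ l * C ^ (n - l) * (n.choose l : ℝ)) *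
          (n.factorial : ℝ) ^ θ * (2 * M * (Real.exp (1 / 4) * Real.exp (-ε₁ * ‖x‖ ^ (1 / θ)) *
        Real.exp (-(ε₀ / 2) * ‖y‖ ^ (1 / θ)))) := by
          refine Finset.sum_le_sum fun l hl => ?_
          have h1 := factorial_rpow_mul_le hθ0.le (Nat.lt_succ_iff.1 (Finset.mem_range.1 hl))
          have h2 := mul_le_mul_of_nonneg_left (hexp y) (show 0 ≤ 2 * M by positivity)
          gcongr
      _ = _ := by
          rw [← Finset.sum_mul, ← Finset.sum_mul, add_pow]
          ring
  have hkI : ∀ i n, MeasureTheory.Integrable ((partialDeriv i)^[n] k) := fun i n =>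
    (hJi.const_mul _).mono'
      (contDiff_iterate_partialDeriv i n hks).continuous.aestronglyMeasurable
      (Filter.Eventually.of_forall (hkn i n))
  have hnorm : ∀ y, ‖Complex.exp (Complex.I * (inner ℝ η y : ℝ))‖ = 1 := fun y => by
    rw [Complex.norm_exp]; simp
  set X := ‖∫ y, Complex.exp (Complex.I * (inner ℝ η y : ℝ)) * k y‖
  have hX : X ≤ B := by
    refine (MeasureTheory.norm_integral_le_of_norm_le (hJi.const_mul (2 * M * Real.exp (1 / 4) *
      Real.exp (-ε₁ * ‖x‖ ^ (1 / θ))))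
      (Filter.Eventually.of_forall fun y => ?_)).trans (le_of_eq ?_)
    · rw [norm_mul, hnorm, one_mul]
      exact hk0 y
    · rw [MeasureTheory.integral_const_mul, hB, hJ]
      ring
  -- Moments in `η` come from `n` integrations by parts. The decay in `x` is already contained in
  -- `B`, so both kinds of decay hold together.
  have hXn : ∀ n i, |η i| ^ n * X ≤ B * (C₀ + C) ^ n * (n.factorial : ℝ) ^ θ := by
    intro n i
    have e := integral_exp_mul_iterate_partialDeriv hks i η (hkI i) n
    have e' : |η i| ^ n * X =
        ‖∫ y, Complex.exp (Complex.I * (inner ℝ η y : ℝ)) * (partialDeriv i)^[n] k y‖ := by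
      rw [e, norm_mul, norm_pow, norm_neg, norm_mul, Complex.norm_I, one_mul, Complex.norm_real,
        Real.norm_eq_abs]
    rw [e']
    refine (MeasureTheory.norm_integral_le_of_norm_le (hJi.const_mul (2 * M * Real.exp (1 / 4) *
      Real.exp (-ε₁ * ‖x‖ ^ (1 / θ)) * (C₀ + C) ^ n * (n.factorial : ℝ) ^ θ))
      (Filter.Eventually.of_forall fun y => ?_)).trans (le_of_eq ?_)
    · rw [norm_mul, hnorm, one_mul]
      exact hkn i n y
    · rw [MeasureTheory.integral_const_mul, hB, hJ]
      ring
  have hfin : X ≤ 2 * B * Real.exp (-ε₂ * ‖η‖ ^ (1 / θ)) := by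
    refine le_exp_of_forall_pow_mul_le hθ0 hθ'.le hC₁p (norm_nonneg _) (norm_nonneg _) hB0
      fun n => ?_
    refine (norm_pow_mul_le_of_coord (norm_nonneg _) (by positivity) ?_ (hXn n)).trans
      (le_of_eq ?_)
    · rintro rfl
      simpa using hX
    · rw [hC₁, mul_pow]
      ring
  refine hfin.trans ?_
  have g1 : Real.exp (-ε₁ * ‖x‖ ^ (1 / θ)) * Real.exp (-ε₂ * ‖η‖ ^ (1 / θ)) ≤
      Real.exp (-(min ε₁ ε₂) * (‖x‖ ^ (1 / θ) + ‖η‖ ^ (1 / θ))) := by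
    rw [← Real.exp_add]
    apply Real.exp_le_exp.2
    have i1 := mul_le_mul_of_nonneg_right (min_le_left ε₁ ε₂)
      (show 0 ≤ ‖x‖ ^ (1 / θ) by positivity)
    have i2 := mul_le_mul_of_nonneg_right (min_le_right ε₁ ε₂)
      (show 0 ≤ ‖η‖ ^ (1 / θ) by positivity)
    linarith
  calc 2 * B * Real.exp (-ε₂ * ‖η‖ ^ (1 / θ))
      = 2 * (2 * Real.exp (1 / 4) * J) * M *
        (Real.exp (-ε₁ * ‖x‖ ^ (1 / θ)) * Real.exp (-ε₂ * ‖η‖ ^ (1 / θ))) := by rw [hB]; ring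
    _ ≤ _ := by
        gcongr
        linarith

end GaussFourier

/-! ## The pull-back of wave packets and the inversion formula -/

section Inversion

variable {d m : ℕ}

lemma integrable_exp_neg_norm_rpow_phase {θ ε : ℝ} (hθ : 1 / 2 ≤ θ) (hθ' : θ ≤ 1) (hε : 0 < ε) :
    Integrable fun p : EuclideanSpace ℝ (Fin d) × EuclideanSpace ℝ (Fin d) =>
      Real.exp (-ε * ‖p‖ ^ (1 / θ)) :=
  integrable_exp_neg_norm_rpow (Measure.prod volume volume) hθ hθ' hε

/-- The reflection `(x, ξ) ↦ (x, -ξ)`. -/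
def flipFreq (p : EuclideanSpace ℝ (Fin d) × EuclideanSpace ℝ (Fin d)) :
    EuclideanSpace ℝ (Fin d) × EuclideanSpace ℝ (Fin d) := (p.1, -p.2)

lemma flipFreq_flipFreq (p : EuclideanSpace ℝ (Fin d) × EuclideanSpace ℝ (Fin d)) :
    flipFreq (flipFreq p) = p := by
  simp [flipFreq]

lemma norm_flipFreq (p : EuclideanSpace ℝ (Fin d) × EuclideanSpace ℝ (Fin d)) :
    ‖flipFreq p‖ = ‖p‖ := by
  simp [flipFreq, Prod.norm_def]

lemma continuous_flipFreq : Continuous (flipFreq (d := d)) := by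
  unfold flipFreq; fun_prop

lemma integral_comp_flipFreq (F : EuclideanSpace ℝ (Fin d) × EuclideanSpace ℝ (Fin d) → ℂ) :
    ∫ p, F (flipFreq p) = ∫ p, F p := by
  have h : MeasurePreserving (flipFreq (d := d)) volume volume :=
    (MeasurePreserving.id volume).prod (Measure.measurePreserving_neg volume)
  exact h.integral_comp (Homeomorph.measurableEmbedding
    ⟨⟨flipFreq, flipFreq, flipFreq_flipFreq, flipFreq_flipFreq⟩,
      continuous_flipFreq, continuous_flipFreq⟩) F

/-- The pairing of `h` with the pulled-back conjugate wave packet. -/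
def pullPacket (A : EuclideanSpace ℝ (Fin m) →ₗ[ℝ] EuclideanSpace ℝ (Fin d))
    (h : EuclideanSpace ℝ (Fin m) → ℂ)
    (p : EuclideanSpace ℝ (Fin d) × EuclideanSpace ℝ (Fin d)) : ℂ :=
  ∫ y, wavePacket (flipFreq p) (A y) * h y

/-- By `⟨ξ, Ay⟩ = ⟨ᵗAξ, y⟩` the pairing is a Gaussian-localised Fourier transform at frequency
`ᵗAξ`; the sign is reversed because the reflected packet is the complex conjugate. -/
lemma pullPacket_eq (A : EuclideanSpace ℝ (Fin m) →ₗ[ℝ] EuclideanSpace ℝ (Fin d))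
    (h : EuclideanSpace ℝ (Fin m) → ℂ)
    (p : EuclideanSpace ℝ (Fin d) × EuclideanSpace ℝ (Fin d)) :
    pullPacket A h p = ∫ y, Complex.exp (Complex.I * (inner ℝ (LinearMap.adjoint A p.2) y : ℝ)) *
        (((Real.exp (-‖A y - p.1‖ ^ 2 / 2) : ℝ) : ℂ) * h y) := by
  unfold pullPacket
  congr 1
  funext y
  rw [wavePacket_apply, LinearMap.adjoint_inner_left, mul_assoc]
  simp [flipFreq]

lemma exists_pullPacket_bound {θ : ℝ} (hθ : 1 / 2 ≤ θ) (hθ' : θ < 1)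
    (A : EuclideanSpace ℝ (Fin m) →ₗ[ℝ] EuclideanSpace ℝ (Fin d)) {C : ℝ} (hC : 0 < C) :
    ∃ K > 0, ∃ ε > 0, ∀ (h : EuclideanSpace ℝ (Fin m) → ℂ) (M : ℝ), 0 ≤ M → ContDiff ℝ ∞ h →
      GSBound θ C M h → ∀ p, ‖pullPacket A h p‖ ≤
        K * M * Real.exp (-ε * (‖p.1‖ ^ (1 / θ) + ‖LinearMap.adjoint A p.2‖ ^ (1 / θ))) := by
  obtain ⟨K, hK, ε, hε, H⟩ := exists_gaussFourier_bound hθ hθ' A hC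
  refine ⟨K, hK, ε, hε, fun h M hM hs hb p => ?_⟩
  rw [pullPacket_eq]
  exact H h M hM hs hb _ _

/-- Translating `y` by the centre of the packet and absorbing its modulation into the frequency
moves the packet to the origin, up to a factor of modulus one. -/
lemma pullPacket_wavePacket (A : EuclideanSpace ℝ (Fin m) →ₗ[ℝ] EuclideanSpace ℝ (Fin d))
    (p : EuclideanSpace ℝ (Fin d) × EuclideanSpace ℝ (Fin d))
    (q : EuclideanSpace ℝ (Fin m) × EuclideanSpace ℝ (Fin m)) :
    ‖pullPacket A (wavePacket q) p‖ =
      ‖∫ y, Complex.exp (Complex.I * (inner ℝ (LinearMap.adjoint A p.2 - q.2) y : ℝ)) *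
        (((Real.exp (-‖A y - (p.1 - A q.1)‖ ^ 2 / 2) : ℝ) : ℂ) * wavePacket 0 y)‖ := by
  rw [pullPacket_eq, ← integral_add_right_eq_self _ q.1]
  have e : ∀ y, Complex.exp (Complex.I * (inner ℝ (LinearMap.adjoint A p.2) (y + q.1) : ℝ)) *
        (((Real.exp (-‖A (y + q.1) - p.1‖ ^ 2 / 2) : ℝ) : ℂ) * wavePacket q (y + q.1)) =
      Complex.exp (Complex.I * (inner ℝ (LinearMap.adjoint A p.2 - q.2) q.1 : ℝ)) *
      (Complex.exp (Complex.I * (inner ℝ (LinearMap.adjoint A p.2 - q.2) y : ℝ)) *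
        (((Real.exp (-‖A y - (p.1 - A q.1)‖ ^ 2 / 2) : ℝ) : ℂ) * wavePacket 0 y)) := by
    intro y
    rw [wavePacket_apply, wavePacket_apply, map_add,
      show A y + A q.1 - p.1 = A y - (p.1 - A q.1) by abel, add_sub_cancel_right]
    simp only [Prod.fst_zero, Prod.snd_zero, inner_zero_left, sub_zero, inner_add_right,
      inner_sub_left, Complex.ofReal_zero, mul_zero, Complex.exp_zero, one_mul]
    have h1 : Complex.exp (Complex.I * ((inner ℝ (LinearMap.adjoint A p.2) y +
        inner ℝ (LinearMap.adjoint A p.2) q.1 : ℝ) : ℂ)) *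
        Complex.exp (-Complex.I * ((inner ℝ q.2 y + inner ℝ q.2 q.1 : ℝ) : ℂ)) =
        Complex.exp (Complex.I * ((inner ℝ (LinearMap.adjoint A p.2) q.1 -
          inner ℝ q.2 q.1 : ℝ) : ℂ)) *
        Complex.exp (Complex.I * ((inner ℝ (LinearMap.adjoint A p.2) y -
          inner ℝ q.2 y : ℝ) : ℂ)) := by
      rw [← Complex.exp_add, ← Complex.exp_add]
      congr 1
      push_cast
      ring
    linear_combination ((Real.exp (-‖A y - (p.1 - A q.1)‖ ^ 2 / 2) : ℝ) : ℂ) *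
      ((Real.exp (-‖y‖ ^ 2 / 2) : ℝ) : ℂ) * h1
  simp only [e]
  rw [integral_const_mul, norm_mul, Complex.norm_exp]
  simp

/-- Only the norm of the packet at the origin enters, so the constants do not depend on `q`. The
general bound would involve the growing norm of the packet at `q` and would not show the
localisation near related points. -/
lemma exists_pullPacket_wavePacket_bound {θ : ℝ} (hθ : 1 / 2 ≤ θ) (hθ' : θ < 1)
    (A : EuclideanSpace ℝ (Fin m) →ₗ[ℝ] EuclideanSpace ℝ (Fin d)) :
    ∃ K > 0, ∃ ε > 0, ∀ (p : EuclideanSpace ℝ (Fin d) × EuclideanSpace ℝ (Fin d))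
      (q : EuclideanSpace ℝ (Fin m) × EuclideanSpace ℝ (Fin m)),
      ‖pullPacket A (wavePacket q) p‖ ≤
        K * Real.exp (-ε * (‖p.1 - A q.1‖ ^ (1 / θ) +
          ‖LinearMap.adjoint A p.2 - q.2‖ ^ (1 / θ))) := by
  obtain ⟨C, hC, M, hM, h⟩ := gsBound_wavePacket (d := m) hθ hθ' one_pos
  obtain ⟨K, hK, ε, hε, H⟩ := exists_gaussFourier_bound hθ hθ' A hC
  have h0 := h 0
  refine ⟨K * (M * Real.exp (1 * ‖(0 : EuclideanSpace ℝ (Fin m) ×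
    EuclideanSpace ℝ (Fin m))‖ ^ (1 / θ))), by positivity, ε, hε, fun p q => ?_⟩
  rw [pullPacket_wavePacket]
  exact H (wavePacket 0) _ (by positivity) (contDiff_wavePacket 0) h0 _ _

lemma stronglyMeasurable_pullPacket
    (A : EuclideanSpace ℝ (Fin m) →ₗ[ℝ] EuclideanSpace ℝ (Fin d))
    {h : EuclideanSpace ℝ (Fin m) → ℂ} (hh : Continuous h) :
    StronglyMeasurable (pullPacket A h) := by
  unfold pullPacket
  refine StronglyMeasurable.integral_prod_right ?_
  refine Continuous.stronglyMeasurable ?_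
  have hA : Continuous A := (LinearMap.toContinuousLinearMap A).continuous
  have h1 : Continuous fun q : (EuclideanSpace ℝ (Fin d) × EuclideanSpace ℝ (Fin d)) ×
      EuclideanSpace ℝ (Fin m) => (flipFreq q.1, A q.2) :=
    (continuous_flipFreq.comp continuous_fst).prodMk (hA.comp continuous_snd)
  exact (continuous_wavePacket_uncurry.comp h1).mul (hh.comp continuous_snd)

lemma GSBound.norm_le {θ C M : ℝ} {f : EuclideanSpace ℝ (Fin d) → ℂ} (h : GSBound θ C M f)
    (x : EuclideanSpace ℝ (Fin d)) : ‖f x‖ ≤ M := by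
  have := h 0 0 x
  simpa [multiDeriv_zero, multiFactorial_zero] using this

lemma IsGS.exists_bound {θ : ℝ} {f : EuclideanSpace ℝ (Fin d) → ℂ} (hf : IsGS θ f) :
    ∃ C > 0, ∃ M, 0 ≤ M ∧ GSBound θ C M f := by
  obtain ⟨_, C, hC, M, hM⟩ := hf
  exact ⟨C, hC, max M 0, le_max_right _ _, hM.mono hC le_rfl (le_max_left _ _) (le_max_right _ _)⟩

lemma IsGS.integrable {θ : ℝ} (hθ : 1 / 2 ≤ θ) (hθ' : θ < 1)
    {f : EuclideanSpace ℝ (Fin d) → ℂ} (hf : IsGS θ f) : Integrable f := by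
  obtain ⟨C, hC, M, hM, hb⟩ := hf.exists_bound
  have hθ0 : 0 < θ := by linarith
  refine Integrable.mono' ((integrable_exp_neg_norm_rpow volume hθ hθ'.le
    (ε := θ / (2 * (((d : ℝ) + 1) * C) ^ (1 / θ))) (by positivity)).const_mul (2 * M))
    hf.1.continuous.aestronglyMeasurable (Filter.Eventually.of_forall fun x => ?_)
  exact norm_le_of_gsBound hθ0 hθ'.le hC hM hb x

lemma IsGS.integrable_comp_mul {θ : ℝ} (hθ : 1 / 2 ≤ θ) (hθ' : θ < 1)
    (A : EuclideanSpace ℝ (Fin m) →ₗ[ℝ] EuclideanSpace ℝ (Fin d))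
    {f : EuclideanSpace ℝ (Fin d) → ℂ} {h : EuclideanSpace ℝ (Fin m) → ℂ} (hf : IsGS θ f)
    (hh : IsGS θ h) : Integrable fun y => f (A y) * h y := by
  obtain ⟨C, hC, M, hM, hb⟩ := hf.exists_bound
  exact (hh.integrable hθ hθ').bdd_mul (c := M)
    (contDiff_comp_linear A hf.1).continuous.aestronglyMeasurable
    (Filter.Eventually.of_forall fun y => hb.norm_le _)

/-- The ultradistribution `f ↦ ∫ f(Ay) h(y) dy`. -/
def pairPull {θ : ℝ} (hθ : 1 / 2 ≤ θ) (hθ' : θ < 1)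
    (A : EuclideanSpace ℝ (Fin m) →ₗ[ℝ] EuclideanSpace ℝ (Fin d)) (h : GS θ m) : GSDual θ d :=
  ⟨{ toFun := fun f => ∫ y, f.1 (A y) * h.1 y
     map_add' := fun f g => by
      rw [← integral_add (f.2.integrable_comp_mul hθ hθ' A h.2)
        (g.2.integrable_comp_mul hθ hθ' A h.2)]
      congr 1
      funext y
      exact add_mul _ _ _
     map_smul' := fun c f => by
      rw [RingHom.id_apply, smul_eq_mul, ← integral_const_mul]
      congr 1
      funext y
      exact mul_assoc _ _ _ }, by
    intro ε _
    refine ⟨∫ y, ‖h.1 y‖, fun f M hM hf => ?_⟩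
    have hI := (h.2.integrable hθ hθ').norm
    refine (norm_integral_le_of_norm_le (hI.const_mul M)
      (Filter.Eventually.of_forall fun y => ?_)).trans (le_of_eq ?_)
    · rw [norm_mul]
      exact mul_le_mul_of_nonneg_right (hf.norm_le _) (norm_nonneg _)
    · rw [integral_const_mul, mul_comm]⟩

lemma pairPull_apply {θ : ℝ} (hθ : 1 / 2 ≤ θ) (hθ' : θ < 1)
    (A : EuclideanSpace ℝ (Fin m) →ₗ[ℝ] EuclideanSpace ℝ (Fin d)) (h : GS θ m) (f : GS θ d) :
    (pairPull hθ hθ' A h).1 f = ∫ y, f.1 (A y) * h.1 y := rfl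

/-- Through this identity the inversion formula for test functions integrated against `h` becomes a
formula for pull-backs. -/
lemma stft_pairPull {θ : ℝ} (hθ : 1 / 2 ≤ θ) (hθ' : θ < 1)
    (A : EuclideanSpace ℝ (Fin m) →ₗ[ℝ] EuclideanSpace ℝ (Fin d)) (h : GS θ m)
    (p : EuclideanSpace ℝ (Fin d) × EuclideanSpace ℝ (Fin d)) :
    stft hθ (pairPull hθ hθ' A h) p = pullPacket A h.1 (flipFreq p) := by
  rw [pullPacket, flipFreq_flipFreq]
  rfl

lemma adjoint_id : LinearMap.adjoint (LinearMap.id : EuclideanSpace ℝ (Fin d) →ₗ[ℝ]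
    EuclideanSpace ℝ (Fin d)) = LinearMap.id := by
  refine LinearMap.ext fun x => ext_inner_right ℝ fun y => ?_
  rw [LinearMap.adjoint_inner_left]
  rfl

lemma norm_rpow_le_add (θ : ℝ)
    (p : EuclideanSpace ℝ (Fin d) × EuclideanSpace ℝ (Fin d)) :
    ‖p‖ ^ (1 / θ) ≤ ‖p.1‖ ^ (1 / θ) + ‖p.2‖ ^ (1 / θ) := by
  have h1 : 0 ≤ ‖p.1‖ ^ (1 / θ) := by positivity
  have h2 : 0 ≤ ‖p.2‖ ^ (1 / θ) := by positivity
  rw [Prod.norm_def]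
  rcases max_choice ‖p.1‖ ‖p.2‖ with h | h <;> rw [h] <;> linarith

/-- The transform of a Gelfand-Shilov function decays. -/
lemma exists_pullPacket_id_bound {θ : ℝ} (hθ : 1 / 2 ≤ θ) (hθ' : θ < 1)
    {f : EuclideanSpace ℝ (Fin d) → ℂ} (hf : IsGS θ f) :
    ∃ K > 0, ∃ ε > 0, ∀ p, ‖pullPacket LinearMap.id f p‖ ≤ K * Real.exp (-ε * ‖p‖ ^ (1 / θ)) := by
  obtain ⟨C, hC, M, hM, hb⟩ := hf.exists_bound
  obtain ⟨K, hK, ε, hε, H⟩ := exists_pullPacket_bound hθ hθ' (LinearMap.id :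
    EuclideanSpace ℝ (Fin d) →ₗ[ℝ] EuclideanSpace ℝ (Fin d)) hC
  refine ⟨K * (M + 1), by positivity, ε, hε, fun p => ?_⟩
  refine (H f M hM hf.1 hb p).trans ?_
  rw [adjoint_id]
  have := norm_rpow_le_add θ p
  have h2 : Real.exp (-ε * (‖p.1‖ ^ (1 / θ) + ‖p.2‖ ^ (1 / θ))) ≤
      Real.exp (-ε * ‖p‖ ^ (1 / θ)) := Real.exp_le_exp.2 (by nlinarith)
  refine mul_le_mul ?_ h2 (Real.exp_pos _).le (by positivity)
  gcongr
  linarith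

/-! ### Reconstruction from the packet transform -/

/-- The constant `((2π)^d π^{d/2})⁻¹` of the inversion formula. -/
def invConst (d : ℕ) : ℝ := ((2 * Real.pi) ^ d * Real.pi ^ ((d : ℝ) / 2))⁻¹

lemma invConst_pos (d : ℕ) : 0 < invConst d := by
  unfold invConst
  positivity

/-- Fourier inversion after the substitution `ξ = -2πw`, whose Jacobian is `(2π)^d`. -/
lemma integral_exp_mul_fourier {k : EuclideanSpace ℝ (Fin d) → ℂ} (hk : Continuous k)
    (hkI : Integrable k)
    (hN : Integrable fun η => ∫ t, Complex.exp (Complex.I * (inner ℝ η t : ℝ)) * k t)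
    (y : EuclideanSpace ℝ (Fin d)) :
    ∫ ξ, Complex.exp (-Complex.I * (inner ℝ ξ y : ℝ)) *
      (∫ t, Complex.exp (Complex.I * (inner ℝ ξ t : ℝ)) * k t) =
      ((2 * Real.pi) ^ d : ℝ) * k y := by
  set N : EuclideanSpace ℝ (Fin d) → ℂ := fun η =>
    ∫ t, Complex.exp (Complex.I * (inner ℝ η t : ℝ)) * k t
  have hF : 𝓕 k = fun w => N ((-(2 * Real.pi)) • w) := by
    funext w
    rw [Real.fourier_eq']
    simp only [N]
    congr 1
    funext t
    rw [smul_eq_mul, real_inner_smul_left, real_inner_comm]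
    congr 2
    push_cast
    ring
  have hpi : -(2 * Real.pi) ≠ 0 := by
    have := Real.pi_pos
    linarith
  have hFI : Integrable (𝓕 k) := by
    rw [hF]
    exact hN.comp_smul hpi
  have h1 := congrFun (hk.fourierInv_fourier_eq hkI hFI) y
  rw [Real.fourierInv_eq'] at h1
  have h2 := Measure.integral_comp_smul (volume : Measure (EuclideanSpace ℝ (Fin d)))
    (fun ξ => Complex.exp (-Complex.I * (inner ℝ ξ y : ℝ)) * N ξ) (-(2 * Real.pi))
  have h3 : ∫ w, Complex.exp (-Complex.I * (inner ℝ ((-(2 * Real.pi)) • w) y : ℝ)) *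
      N ((-(2 * Real.pi)) • w) = k y := by
    rw [← h1]
    congr 1
    funext w
    rw [hF, smul_eq_mul, real_inner_smul_left]
    congr 2
    push_cast
    ring
  rw [h3] at h2
  rw [h2, finrank_euclideanSpace_fin, abs_inv, abs_pow, abs_neg, abs_of_pos (by positivity),
    Complex.real_smul, ← mul_assoc, ← Complex.ofReal_mul, mul_inv_cancel₀ (by positivity)]
  simp [N]

lemma integral_exp_neg_norm_sub_sq (y : EuclideanSpace ℝ (Fin d)) :
    ∫ x, Real.exp (-‖y - x‖ ^ 2) = Real.pi ^ ((d : ℝ) / 2) := by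
  have h1 := integral_sub_left_eq_self
    (fun x : EuclideanSpace ℝ (Fin d) => Real.exp (-‖x‖ ^ 2)) volume y
  have h2 := GaussianFourier.integral_rexp_neg_mul_sq_norm (V := EuclideanSpace ℝ (Fin d)) one_pos
  simp only [neg_mul, one_mul, div_one, finrank_euclideanSpace_fin] at h2
  rw [h1, h2]

/-- For fixed `x` the integral over `ξ` is Fourier inversion of `f` times a Gaussian about `x`;
multiplied by the Gaussian of the packet it gives `(2π)^d e^{-|y-x|²} f(y)`. The integral over `x`
then contributes `π^{d/2}`. -/
lemma integral_pullPacket_mul_wavePacket {θ : ℝ} (hθ : 1 / 2 ≤ θ) (hθ' : θ < 1)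
    {f : EuclideanSpace ℝ (Fin d) → ℂ} (hf : IsGS θ f) (y : EuclideanSpace ℝ (Fin d)) :
    (invConst d : ℂ) * ∫ p, pullPacket LinearMap.id f p * wavePacket p y = f y := by
  obtain ⟨K, hK, ε, hε, H⟩ := exists_pullPacket_id_bound hθ hθ' hf
  have h_int : Integrable (fun p => pullPacket LinearMap.id f p * wavePacket p y)
      ((volume : Measure (EuclideanSpace ℝ (Fin d))).prod volume) := by
    refine Integrable.mono' ((integrable_exp_neg_norm_rpow_phase (d := d)
      hθ hθ'.le hε).const_mul K) ?_ (Filter.Eventually.of_forall fun p => ?_)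
    · refine (stronglyMeasurable_pullPacket _ hf.1.continuous).aestronglyMeasurable.mul ?_
      exact (continuous_wavePacket_uncurry.comp
        (continuous_id.prodMk continuous_const)).aestronglyMeasurable
    · rw [norm_mul, norm_wavePacket]
      refine mul_le_of_le_one_right ?_ ?_ |>.trans (H p)
      · positivity
      · exact Real.exp_le_one_iff.2 (by nlinarith [sq_nonneg ‖y - p.1‖])
  rw [Measure.volume_eq_prod, integral_prod _ h_int]
  have hinner : ∀ x, ∫ ξ, pullPacket LinearMap.id f (x, ξ) * wavePacket (x, ξ) y =
      ((2 * Real.pi) ^ d * Real.exp (-‖y - x‖ ^ 2) : ℝ) * f y := by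
    intro x
    set k : EuclideanSpace ℝ (Fin d) → ℂ := fun t =>
      ((Real.exp (-‖t - x‖ ^ 2 / 2) : ℝ) : ℂ) * f t with hk
    have hkc : Continuous k := by
      have := hf.1.continuous
      fun_prop
    have hkI : Integrable k := (hf.integrable hθ hθ').bdd_mul (c := 1)
      (Continuous.aestronglyMeasurable (by fun_prop)) (Filter.Eventually.of_forall fun t => by
        rw [Complex.norm_real, Real.norm_eq_abs, abs_of_pos (Real.exp_pos _)]
        exact Real.exp_le_one_iff.2 (by nlinarith [sq_nonneg ‖t - x‖]))
    have hPN : ∀ ξ, pullPacket LinearMap.id f (x, ξ) =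
        ∫ t, Complex.exp (Complex.I * (inner ℝ ξ t : ℝ)) * k t := by
      intro ξ
      rw [pullPacket_eq, adjoint_id]
      rfl
    have hNI : Integrable fun ξ => ∫ t, Complex.exp (Complex.I * (inner ℝ ξ t : ℝ)) * k t := by
      simp only [← hPN]
      refine Integrable.mono' ((integrable_exp_neg_norm_rpow
        (volume : Measure (EuclideanSpace ℝ (Fin d))) hθ hθ'.le hε).const_mul K) ?_
        (Filter.Eventually.of_forall fun ξ => ?_)
      · exact ((stronglyMeasurable_pullPacket _ hf.1.continuous).comp_measurable
          measurable_prodMk_left).aestronglyMeasurable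
      · refine (H (x, ξ)).trans ?_
        have : ‖ξ‖ ^ (1 / θ) ≤ ‖(x, ξ)‖ ^ (1 / θ) :=
          Real.rpow_le_rpow (norm_nonneg _) (norm_snd_le (x, ξ)) (by positivity)
        exact mul_le_mul_of_nonneg_left (Real.exp_le_exp.2 (by nlinarith)) hK.le
    have h1 := integral_exp_mul_fourier hkc hkI hNI y
    have h2 : ∀ ξ, pullPacket LinearMap.id f (x, ξ) * wavePacket (x, ξ) y =
        ((Real.exp (-‖y - x‖ ^ 2 / 2) : ℝ) : ℂ) *
        (Complex.exp (-Complex.I * (inner ℝ ξ y : ℝ)) *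
      (∫ t, Complex.exp (Complex.I * (inner ℝ ξ t : ℝ)) * k t)) := by
      intro ξ
      rw [← hPN, wavePacket_apply]
      ring
    simp only [h2]
    rw [integral_const_mul, h1, hk]
    have h3 : Real.exp (-‖y - x‖ ^ 2) =
        Real.exp (-‖y - x‖ ^ 2 / 2) * Real.exp (-‖y - x‖ ^ 2 / 2) := by
      rw [← Real.exp_add]; congr 1; ring
    rw [h3]
    push_cast
    ring
  simp only [hinner]
  rw [integral_mul_const, integral_complex_ofReal, integral_const_mul, integral_exp_neg_norm_sub_sq,
    ← mul_assoc, ← Complex.ofReal_mul, invConst, inv_mul_cancel₀ (by positivity)]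
  simp

/-- Superpositions of wave packets with rapidly decreasing coefficients. -/
lemma exists_synthesis {θ : ℝ} (hθ : 1 / 2 ≤ θ) (hθ' : θ < 1)
    {b : EuclideanSpace ℝ (Fin d) × EuclideanSpace ℝ (Fin d) → ℂ} (hb : AEStronglyMeasurable b)
    {δ : ℝ} (hδ : 0 < δ) (h_int : Integrable fun p => ‖b p‖ * Real.exp (δ * ‖p‖ ^ (1 / θ))) :
    ∃ f : GS θ d, (∀ y, f.1 y = ∫ p, b p * wavePacket p y) ∧
      ∀ u : GSDual θ d, u.1 f = ∫ p, b p * stft hθ u p := by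
  obtain ⟨C, hC, M, hM, h⟩ := gsBound_wavePacket (d := d) hθ hθ' hδ
  have := completeSpace_gsBanach (d := d) θ hC
  have hB : Continuous fun p : EuclideanSpace ℝ (Fin d) × EuclideanSpace ℝ (Fin d) =>
      M * Real.exp (δ * ‖p‖ ^ (1 / θ)) :=
    continuous_const.mul (Real.continuous_exp.comp (continuous_const.mul
      (continuous_norm.rpow_const fun _ => Or.inr (by positivity))))
  set G : EuclideanSpace ℝ (Fin d) × EuclideanSpace ℝ (Fin d) → GSBanach θ C d :=
    fun p => gsMk hC (contDiff_wavePacket p) (h p)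
  have hG : Continuous G := continuous_gsMk_wavePacket hC hB h
  -- Strong measurability of the packet map is obtained from second countability of the parameter
  -- space, so no separability of the Banach space is needed.
  have : SecondCountableTopologyEither (EuclideanSpace ℝ (Fin d) × EuclideanSpace ℝ (Fin d))
    (GSBanach θ C d) := ⟨Or.inl inferInstance⟩
  have hGI : Integrable fun p => b p • G p := by
    refine Integrable.mono' (h_int.const_mul M) (hb.smul hG.aestronglyMeasurable)
      (Filter.Eventually.of_forall fun p => ?_)
    rw [norm_smul]
    calc ‖b p‖ * ‖G p‖ ≤ ‖b p‖ * (M * Real.exp (δ * ‖p‖ ^ (1 / θ))) := by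
          gcongr
          exact norm_gsMk_le hC _ (h p) (by positivity)
      _ = _ := by ring
  refine ⟨gsIncl θ hC (∫ p, b p • G p), fun y => ?_, fun u => ?_⟩
  · change gsEval θ C y (∫ p, b p • G p) = _
    rw [← ContinuousLinearMap.integral_comp_comm _ hGI]
    congr 1
    funext p
    rw [map_smul, gsEval_apply, gsFun_gsMk, smul_eq_mul]
  · rw [← dualCLM_apply, ← ContinuousLinearMap.integral_comp_comm _ hGI]
    congr 1
    funext p
    rw [map_smul, dualCLM_apply, smul_eq_mul, stft]
    congr 2
    exact Subtype.ext (gsFun_gsMk hC (contDiff_wavePacket p) (h p))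

/-- The inversion formula. -/
lemma inversion {θ : ℝ} (hθ : 1 / 2 ≤ θ) (hθ' : θ < 1) (u : GSDual θ d) (f : GS θ d) :
    u.1 f = (invConst d : ℂ) * ∫ p, stft hθ u p * pullPacket LinearMap.id f.1 p := by
  obtain ⟨K, hK, ε, hε, H⟩ := exists_pullPacket_id_bound hθ hθ' f.2
  have hm := (stronglyMeasurable_pullPacket (LinearMap.id : EuclideanSpace ℝ (Fin d) →ₗ[ℝ]
    EuclideanSpace ℝ (Fin d)) f.2.1.continuous).aestronglyMeasurable (μ := volume)
  -- Half of the decay of the coefficients pays for the norms of the packets, the other half for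
  -- integrability. The function is rebuilt as a Bochner integral so that `u` passes under it.
  obtain ⟨g, hg1, hg2⟩ := exists_synthesis hθ hθ' hm (half_pos hε) (by
    refine Integrable.mono' ((integrable_exp_neg_norm_rpow_phase (d := d)
      hθ hθ'.le (half_pos hε)).const_mul K) ?_ (Filter.Eventually.of_forall fun p => ?_)
    · refine hm.norm.mul (Continuous.aestronglyMeasurable ?_)
      exact Real.continuous_exp.comp (continuous_const.mul
        (continuous_norm.rpow_const fun _ => Or.inr (by positivity)))
    · rw [Real.norm_eq_abs, abs_of_nonneg (by positivity)]
      calc _ ≤ K * Real.exp (-ε * ‖p‖ ^ (1 / θ)) * Real.exp (ε / 2 * ‖p‖ ^ (1 / θ)) := by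
            gcongr; exact H p
        _ = _ := by
            rw [mul_assoc, ← Real.exp_add]
            congr 2
            ring)
  have e : f = (invConst d : ℂ) • g := by
    refine Subtype.ext (funext fun y => ?_)
    rw [Submodule.coe_smul, Pi.smul_apply, smul_eq_mul, hg1,
      integral_pullPacket_mul_wavePacket hθ hθ' f.2]
  conv_lhs => rw [e, map_smul, smul_eq_mul, hg2]
  congr 2
  funext p
  exact mul_comm _ _

end Inversion

/-! ## Conic estimates -/

section Cones

/-- A homogeneous function that is positive on a closed cone is bounded below by the norm. -/
lemma exists_mul_norm_le_of_cone {E : Type*} [NormedAddCommGroup E] [NormedSpace ℝ E]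
    [FiniteDimensional ℝ E] {S : Set E} (hS : IsClosed S)
    (hcone : ∀ t : ℝ, 0 < t → ∀ v ∈ S, t • v ∈ S) {l : E → ℝ} (hl : Continuous l)
    (hhom : ∀ t : ℝ, 0 < t → ∀ v, l (t • v) = t * l v) (hnn : ∀ v, 0 ≤ l v)
    (hpos : ∀ v ∈ S, v ≠ 0 → l v ≠ 0) : ∃ δ > 0, ∀ v ∈ S, δ * ‖v‖ ≤ l v := by
  have : ProperSpace E := FiniteDimensional.proper ℝ E
  have hK : IsCompact (S ∩ Metric.sphere (0 : E) 1) := (isCompact_sphere 0 1).inter_left hS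
  have hnorm : ∀ v ∈ S, v ≠ 0 → ‖v‖⁻¹ • v ∈ S ∩ Metric.sphere (0 : E) 1 := fun v hv h0 =>
    ⟨hcone _ (inv_pos.2 (norm_pos_iff.2 h0)) v hv, by
      rw [mem_sphere_zero_iff_norm, norm_smul, norm_inv, norm_norm,
        inv_mul_cancel₀ (norm_ne_zero_iff.2 h0)]⟩
  rcases (S ∩ Metric.sphere (0 : E) 1).eq_empty_or_nonempty with he | hne
  · refine ⟨1, one_pos, fun v hv => ?_⟩
    by_cases h0 : v = 0
    · simpa [h0] using hnn 0
    · have := hnorm v hv h0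
      rw [he] at this
      exact absurd this (Set.notMem_empty _)
  · obtain ⟨v₀, hv₀, hmin⟩ := hK.exists_isMinOn hne hl.continuousOn
    have hv₀0 : v₀ ≠ 0 := by
      rintro rfl
      simpa using hv₀.2
    refine ⟨l v₀, lt_of_le_of_ne (hnn _) (Ne.symm (hpos v₀ hv₀.1 hv₀0)), fun v hv => ?_⟩
    by_cases h0 : v = 0
    · simpa [h0] using hnn 0
    · have h1 : l v₀ ≤ l (‖v‖⁻¹ • v) := hmin (hnorm v hv h0)
      have hv0 : 0 < ‖v‖ := norm_pos_iff.2 h0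
      rw [hhom _ (inv_pos.2 hv0)] at h1
      rwa [inv_mul_eq_div, le_div_iff₀ hv0] at h1

variable {d m : ℕ} {θ : ℝ} {I : Type}
  {b : I → EuclideanSpace ℝ (Fin d) × EuclideanSpace ℝ (Fin d) → ℂ}

lemma ConicDecay.union {U V : Set (EuclideanSpace ℝ (Fin d) × EuclideanSpace ℝ (Fin d))}
    (hU : ConicDecay θ b U) (hV : ConicDecay θ b V) : ConicDecay θ b (U ∪ V) := by
  obtain ⟨hU1, hU2, K, hK, ε, hε, h⟩ := hU
  obtain ⟨hV1, hV2, K', hK', ε', hε', h'⟩ := hV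
  have hexp : ∀ {K₁ ε₁ : ℝ} (q : EuclideanSpace ℝ (Fin d) × EuclideanSpace ℝ (Fin d)), 0 < K₁ →
      K₁ ≤ K + K' → min ε ε' ≤ ε₁ → K₁ * Real.exp (-ε₁ * ‖q‖ ^ (1 / θ)) ≤
        (K + K') * Real.exp (-(min ε ε') * ‖q‖ ^ (1 / θ)) := by
    intro K₁ ε₁ q hK₁ h1 h2
    have hq : 0 ≤ ‖q‖ ^ (1 / θ) := by positivity
    have : Real.exp (-ε₁ * ‖q‖ ^ (1 / θ)) ≤ Real.exp (-(min ε ε') * ‖q‖ ^ (1 / θ)) :=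
      Real.exp_le_exp.2 (by nlinarith)
    gcongr
  refine ⟨hU1.union hV1, ?_, K + K', by positivity, min ε ε', lt_min hε hε', ?_⟩
  · rintro t ht q (hq | hq)
    · exact Or.inl (hU2 t ht q hq)
    · exact Or.inr (hV2 t ht q hq)
  · rintro i q (hq | hq)
    · exact (h i q hq).trans (hexp q hK (by linarith) (min_le_left _ _))
    · exact (h' i q hq).trans (hexp q hK' (by linarith) (min_le_right _ _))

/-- Regions of decay are stable under finite unions, at the price of a larger constant and a smaller
rate. -/
lemma exists_conicDecay_of_isCompact
    {K : Set (EuclideanSpace ℝ (Fin d) × EuclideanSpace ℝ (Fin d))} (hK : IsCompact K)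
    (h : ∀ p ∈ K, ∃ U, p ∈ U ∧ ConicDecay θ b U) : ∃ U, K ⊆ U ∧ ConicDecay θ b U := by
  refine hK.induction_on (p := fun K => ∃ U, K ⊆ U ∧ ConicDecay θ b U) ?_ ?_ ?_ ?_
  · exact ⟨∅, subset_rfl, isOpen_empty, by simp, 1, one_pos, 1, one_pos, by simp⟩
  · rintro s t hst ⟨U, hU, hD⟩
    exact ⟨U, hst.trans hU, hD⟩
  · rintro s t ⟨U, hU, hD⟩ ⟨V, hV, hD'⟩
    exact ⟨U ∪ V, Set.union_subset_union hU hV, hD.union hD'⟩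
  · intro p hp
    obtain ⟨U, hpU, hD⟩ := h p hp
    exact ⟨U, mem_nhdsWithin_of_mem_nhds (hD.1.mem_nhds hpU), U, subset_rfl, hD⟩

/-- Decay at the images of all zeros of a homogeneous function `l` on a closed cone gives a decay
region such that `l` is bounded below outside. -/
lemma exists_conicDecay_cover {E : Type*} [NormedAddCommGroup E] [NormedSpace ℝ E]
    [FiniteDimensional ℝ E] {S : Set E} (hS : IsClosed S)
    (hcone : ∀ t : ℝ, 0 < t → ∀ v ∈ S, t • v ∈ S) {l : E → ℝ} (hl : Continuous l)
    (hhom : ∀ t : ℝ, 0 < t → ∀ v, l (t • v) = t * l v) (hnn : ∀ v, 0 ≤ l v)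
    {π : E → EuclideanSpace ℝ (Fin d) × EuclideanSpace ℝ (Fin d)} (hπ : Continuous π)
    (hπhom : ∀ (t : ℝ) v, π (t • v) = t • π v)
    (h : ∀ v ∈ S, v ≠ 0 → l v = 0 → ∃ U, π v ∈ U ∧ ConicDecay θ b U) :
    ∃ U, ConicDecay θ b U ∧ ∃ δ > 0, ∀ v ∈ S, π v ∉ U → δ * ‖v‖ ≤ l v := by
  have : ProperSpace E := FiniteDimensional.proper ℝ E
  -- By homogeneity it suffices to cover the zeros of norm one, which form a compact set. Off the
  -- resulting region `l` has no nonzero zero on a closed cone.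
  set Z : Set E := (S ∩ {v | l v = 0}) ∩ Metric.sphere (0 : E) 1
  have hZ : IsCompact Z :=
    (isCompact_sphere 0 1).inter_left (hS.inter (isClosed_eq hl continuous_const))
  obtain ⟨U, hU, hD⟩ := exists_conicDecay_of_isCompact (θ := θ) (b := b) (hZ.image hπ) (by
    rintro _ ⟨v, ⟨⟨hvS, hv0⟩, hv1⟩, rfl⟩
    refine h v hvS ?_ hv0
    rintro rfl
    simp at hv1)
  refine ⟨U, hD, ?_⟩
  have hunscale : ∀ t : ℝ, 0 < t → ∀ v, π (t • v) ∈ U → π v ∈ U := by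
    intro t ht v hv
    have := hD.2.1 t⁻¹ (inv_pos.2 ht) _ hv
    rwa [hπhom, smul_smul, inv_mul_cancel₀ ht.ne', one_smul] at this
  obtain ⟨δ, hδ, H⟩ := exists_mul_norm_le_of_cone (S := S ∩ π ⁻¹' Uᶜ)
    (hS.inter (hD.1.isClosed_compl.preimage hπ))
    (fun t ht v hv => ⟨hcone t ht v hv.1, fun hc => hv.2 (hunscale t ht v hc)⟩) hl hhom hnn
    (fun v hv h0 hlv => hv.2 (by
      have hn : 0 < ‖v‖ := norm_pos_iff.2 h0
      refine hunscale ‖v‖⁻¹ (inv_pos.2 hn) v (hU ⟨_, ⟨⟨hcone _ (inv_pos.2 hn) v hv.1, ?_⟩, ?_⟩, rfl⟩)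
      · rw [Set.mem_ofPred_eq, hhom _ (inv_pos.2 hn), hlv, mul_zero]
      · rw [mem_sphere_zero_iff_norm, norm_smul, norm_inv, norm_norm, inv_mul_cancel₀ hn.ne']))
  exact ⟨δ, hδ, fun v hv hvU => H v ⟨hv, hvU⟩⟩

/-- Linear inequalities between norms become inequalities between exponents, with `32 = 2 · 4 · 4`.
In the applications `a` is `‖p‖` where the coefficients decay and `0` elsewhere. -/
lemma rpow_add_rpow_le (hθ : 1 / 2 ≤ θ) {c a s₁ s₂ P Q : ℝ} (hc : 0 < c) (ha : 0 ≤ a)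
    (hs₁ : 0 ≤ s₁) (hs₂ : 0 ≤ s₂) (hP : 0 ≤ P) (hQ : 0 ≤ Q) (h : c * (P + Q) ≤ a + (s₁ + s₂)) :
    P ^ (1 / θ) + Q ^ (1 / θ) ≤
      32 / c ^ (1 / θ) * (a ^ (1 / θ) + (s₁ ^ (1 / θ) + s₂ ^ (1 / θ))) := by
  have hr : 0 ≤ 1 / θ := by positivity
  have hcr : 0 < c ^ (1 / θ) := Real.rpow_pos_of_pos hc _
  have h1 := Real.rpow_le_rpow (by positivity) h hr
  rw [Real.mul_rpow hc.le (by positivity)] at h1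
  have h2 := add_rpow_le_mul hθ ha (add_nonneg hs₁ hs₂)
  have h3 := add_rpow_le_mul hθ hs₁ hs₂
  have h4 : P ^ (1 / θ) ≤ (P + Q) ^ (1 / θ) := Real.rpow_le_rpow hP (by linarith) hr
  have h5 : Q ^ (1 / θ) ≤ (P + Q) ^ (1 / θ) := Real.rpow_le_rpow hQ (by linarith) hr
  have ha' : 0 ≤ a ^ (1 / θ) := by positivity
  rw [div_mul_eq_mul_div, le_div_iff₀ hcr]
  nlinarith

/-- The product of a function of subexponential growth, with decay at the conormals of the kernel
of the adjoint, and of the transform of a test function. -/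
lemma exists_mul_pullPacket_bound (hθ : 1 / 2 ≤ θ) (hθ' : θ < 1)
    (A : EuclideanSpace ℝ (Fin m) →ₗ[ℝ] EuclideanSpace ℝ (Fin d)) (hG : SubexpGrowth θ b)
    (hD : ∀ p, p ≠ 0 → p.1 = 0 → LinearMap.adjoint A p.2 = 0 → ∃ U, p ∈ U ∧ ConicDecay θ b U)
    {C : ℝ} (hC : 0 < C) :
    ∃ K > 0, ∃ ε > 0, ∀ (i : I) (h : EuclideanSpace ℝ (Fin m) → ℂ) (M : ℝ), 0 ≤ M →
      ContDiff ℝ ∞ h → GSBound θ C M h → ∀ p,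
      ‖b i p * pullPacket A h p‖ ≤ K * M * Real.exp (-ε * ‖p‖ ^ (1 / θ)) := by
  have hAt : Continuous (LinearMap.adjoint A) :=
    (LinearMap.toContinuousLinearMap (LinearMap.adjoint A)).continuous
  -- The function `l` measures the decay of `pullPacket A h`; its nonzero zeros are the points at
  -- which `hD` provides decay of the coefficients.
  obtain ⟨U, ⟨-, -, K₁, hK₁, ε₁, hε₁, hU⟩, δ, hδ, Hδ⟩ := exists_conicDecay_cover (θ := θ) (b := b)
    (E := EuclideanSpace ℝ (Fin d) × EuclideanSpace ℝ (Fin d)) isClosed_univ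
    (fun _ _ _ _ => trivial) (l := fun p => ‖p.1‖ + ‖LinearMap.adjoint A p.2‖)
    (by fun_prop) (fun t ht p => by
      simp only [Prod.smul_fst, Prod.smul_snd, map_smul, norm_smul, Real.norm_eq_abs,
        abs_of_pos ht]
      ring) (fun p => by positivity) (π := id) continuous_id (fun _ _ => rfl)
    (fun p _ hp0 hl => by
      have h1 := norm_nonneg p.1
      have h2 := norm_nonneg (LinearMap.adjoint A p.2)
      exact hD p hp0 (norm_eq_zero.1 (by linarith)) (norm_eq_zero.1 (by linarith)))
  obtain ⟨K₂, hK₂, ε₂, hε₂, H₂⟩ := exists_pullPacket_bound hθ hθ' A hC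
  set κ : ℝ := 32 / δ ^ (1 / θ) with hκ
  have hκ0 : 0 < κ := div_pos (by norm_num) (Real.rpow_pos_of_pos hδ _)
  -- Off `U` one has `‖p‖^{1/θ} ≤ κ s`, so half of the decay `e^{-ε₂ s}` absorbs this growth and the
  -- other half survives as decay in `p`.
  obtain ⟨K₃, hK₃, H₃⟩ := hG (ε₂ / (2 * κ)) (by positivity)
  refine ⟨(K₁ + K₃) * K₂, by positivity, min ε₁ (ε₂ / (2 * κ)), lt_min hε₁ (by positivity),
    fun i h M hM hs hb p => ?_⟩
  have hp : 0 ≤ ‖p‖ ^ (1 / θ) := by positivity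
  have hW := H₂ h M hM hs hb p
  set s := ‖p.1‖ ^ (1 / θ) + ‖LinearMap.adjoint A p.2‖ ^ (1 / θ)
  have hs0 : 0 ≤ s := by positivity
  rw [norm_mul]
  by_cases hpU : p ∈ U
  · have h1 := hU i p hpU
    have h2 : Real.exp (-ε₂ * s) ≤ 1 := Real.exp_le_one_iff.2 (by nlinarith)
    have h3 : Real.exp (-ε₁ * ‖p‖ ^ (1 / θ)) ≤
        Real.exp (-(min ε₁ (ε₂ / (2 * κ))) * ‖p‖ ^ (1 / θ)) :=
      Real.exp_le_exp.2 (by nlinarith [min_le_left ε₁ (ε₂ / (2 * κ))])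
    calc ‖b i p‖ * ‖pullPacket A h p‖
        ≤ (K₁ * Real.exp (-ε₁ * ‖p‖ ^ (1 / θ))) * (K₂ * M * Real.exp (-ε₂ * s)) := by gcongr
      _ ≤ ((K₁ + K₃) * Real.exp (-(min ε₁ (ε₂ / (2 * κ))) * ‖p‖ ^ (1 / θ))) * (K₂ * M * 1) := by
          gcongr
          linarith
      _ = _ := by ring
  · have h1 := H₃ i p
    have hδp : δ * (‖p‖ + 0) ≤ 0 + (‖p.1‖ + ‖LinearMap.adjoint A p.2‖) := by
      have := Hδ p trivial hpU
      simpa using this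
    have h2 := rpow_add_rpow_le hθ hδ le_rfl (norm_nonneg _) (norm_nonneg _) (norm_nonneg _) le_rfl
      hδp
    rw [Real.zero_rpow (by positivity), zero_add, add_zero] at h2
    change ‖p‖ ^ (1 / θ) ≤ κ * s at h2
    have h3 : Real.exp (ε₂ / (2 * κ) * ‖p‖ ^ (1 / θ)) * Real.exp (-ε₂ * s) ≤
        Real.exp (-(min ε₁ (ε₂ / (2 * κ))) * ‖p‖ ^ (1 / θ)) := by
      rw [← Real.exp_add]
      apply Real.exp_le_exp.2
      have h4 := mul_le_mul_of_nonneg_right (min_le_right ε₁ (ε₂ / (2 * κ))) hp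
      have h5 := mul_le_mul_of_nonneg_left h2 (show 0 ≤ ε₂ / κ by positivity)
      have h6 : ε₂ / κ * (κ * s) = ε₂ * s := by field_simp
      have h7 : ε₂ / κ = 2 * (ε₂ / (2 * κ)) := by field_simp
      rw [h6, h7] at h5
      linarith
    calc ‖b i p‖ * ‖pullPacket A h p‖
        ≤ (K₃ * Real.exp (ε₂ / (2 * κ) * ‖p‖ ^ (1 / θ))) * (K₂ * M * Real.exp (-ε₂ * s)) := by
          gcongr
      _ = K₃ * K₂ * M * (Real.exp (ε₂ / (2 * κ) * ‖p‖ ^ (1 / θ)) * Real.exp (-ε₂ * s)) := by ring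
      _ ≤ (K₁ + K₃) * K₂ * M * Real.exp (-(min ε₁ (ε₂ / (2 * κ))) * ‖p‖ ^ (1 / θ)) := by
          gcongr
          linarith

set_option maxHeartbeats 1000000 in
/-- The product of a function of subexponential growth and of the transform of a wave packet, in
a conic neighbourhood of a point `q₀`, if there is decay at all points related to `q₀`. -/
lemma exists_mul_pullPacket_wavePacket_bound (hθ : 1 / 2 ≤ θ) (hθ' : θ < 1)
    (A : EuclideanSpace ℝ (Fin m) →ₗ[ℝ] EuclideanSpace ℝ (Fin d)) (hG : SubexpGrowth θ b)
    {q₀ : EuclideanSpace ℝ (Fin m) × EuclideanSpace ℝ (Fin m)} (hq₀ : ¬(A q₀.1 = 0 ∧ q₀.2 = 0))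
    (hD : ∀ (p : EuclideanSpace ℝ (Fin d) × EuclideanSpace ℝ (Fin d)) (t : ℝ), p ≠ 0 → 0 ≤ t →
      p.1 = t • A q₀.1 → LinearMap.adjoint A p.2 = t • q₀.2 → ∃ U, p ∈ U ∧ ConicDecay θ b U) :
    ∃ V : Set (EuclideanSpace ℝ (Fin m) × EuclideanSpace ℝ (Fin m)), IsOpen V ∧ q₀ ∈ V ∧
      (∀ t : ℝ, 0 < t → ∀ q ∈ V, t • q ∈ V) ∧ ∃ K > 0, ∃ ε > 0, ∀ (i : I), ∀ q ∈ V, ∀ p,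
        ‖b i p * pullPacket A (wavePacket q) p‖ ≤
          K * Real.exp (-ε * (‖p‖ ^ (1 / θ) + ‖q‖ ^ (1 / θ))) := by
  have hAt : Continuous (LinearMap.adjoint A) :=
    (LinearMap.toContinuousLinearMap (LinearMap.adjoint A)).continuous
  obtain ⟨a, ha0, ha⟩ := (LinearMap.toContinuousLinearMap A).isBoundedLinearMap.bound
  obtain ⟨a', ha'0, ha'⟩ :=
    (LinearMap.toContinuousLinearMap (LinearMap.adjoint A)).isBoundedLinearMap.bound
  replace ha : ∀ y, ‖A y‖ ≤ a * ‖y‖ := ha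
  replace ha' : ∀ y, ‖LinearMap.adjoint A y‖ ≤ a' * ‖y‖ := ha'
  set w := ‖A q₀.1‖ + ‖q₀.2‖ with hw
  have hw0 : 0 < w := by
    by_contra hcon
    have h1 := norm_nonneg (A q₀.1)
    have h2 := norm_nonneg q₀.2
    exact hq₀ ⟨norm_eq_zero.1 (by linarith), norm_eq_zero.1 (by linarith)⟩
  -- The additional variable `t ≥ 0` makes the relation to the ray through `q₀` homogeneous: `l`
  -- vanishes at `(p, t)` exactly if `p` is related to `t q₀`. The value `t = 0` brings in the
  -- conormal directions.
  obtain ⟨U, ⟨-, -, K₁, hK₁, ε₁, hε₁, hU⟩, δ, hδ, Hδ⟩ := exists_conicDecay_cover (θ := θ) (b := b)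
    (E := (EuclideanSpace ℝ (Fin d) × EuclideanSpace ℝ (Fin d)) × ℝ) (S := {v | 0 ≤ v.2})
    (isClosed_le continuous_const continuous_snd)
    (fun t ht v hv => mul_nonneg ht.le hv)
    (l := fun v => ‖v.1.1 - v.2 • A q₀.1‖ + ‖LinearMap.adjoint A v.1.2 - v.2 • q₀.2‖)
    (by fun_prop) (fun t ht p => by
      simp only [Prod.smul_fst, Prod.smul_snd, map_smul, smul_assoc, ← smul_sub, norm_smul,
        Real.norm_eq_abs, abs_of_pos ht]
      ring) (fun p => by positivity) (π := Prod.fst) continuous_fst (fun _ _ => rfl)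
    (fun v hv hv0 hl => by
      have h1 := norm_nonneg (v.1.1 - v.2 • A q₀.1)
      have h2 := norm_nonneg (LinearMap.adjoint A v.1.2 - v.2 • q₀.2)
      have e1 : v.1.1 = v.2 • A q₀.1 := sub_eq_zero.1 (norm_eq_zero.1 (by linarith))
      have e2 : LinearMap.adjoint A v.1.2 = v.2 • q₀.2 :=
        sub_eq_zero.1 (norm_eq_zero.1 (by linarith))
      -- A zero `(0, t)` with `t ≠ 0` would force `A q₀.1 = 0` and `q₀.2 = 0`, which `hq₀` excludes.
      refine hD v.1 v.2 (fun h0 => hv0 ?_) hv e1 e2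
      refine Prod.ext h0 ?_
      by_contra hv2
      rw [h0] at e1 e2
      simp only [Prod.fst_zero, Prod.snd_zero, map_zero] at e1 e2
      exact hq₀ ⟨(smul_eq_zero.1 e1.symm).resolve_left hv2,
        (smul_eq_zero.1 e2.symm).resolve_left hv2⟩)
  obtain ⟨K₂, hK₂, ε₂, hε₂, H₂⟩ := exists_pullPacket_wavePacket_bound hθ hθ' A
  -- The opening of the cone about `q₀`: exchanging `q` for `t q₀` changes `A q.1` and `q.2` by at
  -- most `min δ w * t / 2` together, half of what either lower bound below can afford.
  set δ₁ : ℝ := min δ w / (2 * (a + 1)) with hδ₁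
  have hδ₁0 : 0 < δ₁ := div_pos (lt_min hδ hw0) (by positivity)
  have hδ₁' : (a + 1) * δ₁ = min δ w / 2 := by
    rw [hδ₁]; field_simp
  set c₁ : ℝ := ‖q₀‖ + δ₁ with hc₁
  have hc₁0 : 0 < c₁ := by positivity
  -- The first entry serves the points `p` outside `U`, the second those inside.
  set c : ℝ := min (δ / (4 * (1 + c₁))) (1 / (1 + 2 * c₁ * (2 + a') / w)) with hc
  have hc0 : 0 < c := lt_min (by positivity) (by positivity)
  set κ : ℝ := 32 / c ^ (1 / θ) with hκ
  have hκ0 : 0 < κ := div_pos (by norm_num) (Real.rpow_pos_of_pos hc0 _)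
  set e : ℝ := min ε₁ ε₂ / (2 * κ) with he
  have he0 : 0 < e := div_pos (lt_min hε₁ hε₂) (by positivity)
  obtain ⟨K₃, hK₃, H₃⟩ := hG e he0
  refine ⟨{q | ∃ t : ℝ, 0 < t ∧ ‖q - t • q₀‖ < δ₁ * t}, ?_, ⟨1, one_pos, by simpa using hδ₁0⟩, ?_,
    (K₁ + K₃) * K₂, by positivity, e, he0, ?_⟩
  · have : {q : EuclideanSpace ℝ (Fin m) × EuclideanSpace ℝ (Fin m) |
        ∃ t : ℝ, 0 < t ∧ ‖q - t • q₀‖ < δ₁ * t} =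
        ⋃ t : ℝ, ⋃ _ : 0 < t, {q | ‖q - t • q₀‖ < δ₁ * t} := by
      ext q; simp
    rw [this]
    exact isOpen_iUnion fun t => isOpen_iUnion fun _ =>
      isOpen_lt (by fun_prop) continuous_const
  · rintro s hs q ⟨t, ht, hq⟩
    refine ⟨s * t, by positivity, ?_⟩
    rw [mul_smul, ← smul_sub, norm_smul, Real.norm_eq_abs, abs_of_pos hs]
    nlinarith
  rintro i q ⟨t, ht, hq⟩ p
  have hp : 0 ≤ ‖p‖ ^ (1 / θ) := by positivity
  have hqr : 0 ≤ ‖q‖ ^ (1 / θ) := by positivity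
  have hW := H₂ p q
  set s₁ := ‖p.1 - A q.1‖ with hs₁
  set s₂ := ‖LinearMap.adjoint A p.2 - q.2‖ with hs₂
  have hs₁0 : 0 ≤ s₁ := norm_nonneg _
  have hs₂0 : 0 ≤ s₂ := norm_nonneg _
  set s := s₁ ^ (1 / θ) + s₂ ^ (1 / θ)
  have hs0 : 0 ≤ s := by positivity
  have hq1 : ‖q.1 - t • q₀.1‖ ≤ δ₁ * t := (norm_fst_le (q - t • q₀)).trans hq.le
  have hq2 : ‖q.2 - t • q₀.2‖ ≤ δ₁ * t := (norm_snd_le (q - t • q₀)).trans hq.le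
  have hAq : ‖A q.1 - t • A q₀.1‖ ≤ a * (δ₁ * t) := by
    rw [← map_smul, ← map_sub]
    exact (ha _).trans (by gcongr)
  have hqt : ‖q‖ ≤ c₁ * t := by
    have h1 : ‖q‖ ≤ ‖q - t • q₀‖ + ‖t • q₀‖ := by
      have := norm_add_le (q - t • q₀) (t • q₀)
      rwa [sub_add_cancel] at this
    rw [norm_smul, Real.norm_eq_abs, abs_of_pos ht] at h1
    rw [hc₁]
    linarith
  have hmin1 : min δ w ≤ δ := min_le_left _ _
  have hmin2 : min δ w ≤ w := min_le_right _ _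
  have hmt1 := mul_le_mul_of_nonneg_right hmin1 ht.le
  have hmt2 := mul_le_mul_of_nonneg_right hmin2 ht.le
  have hsum : a * (δ₁ * t) + δ₁ * t = min δ w * t / 2 := by
    rw [show a * (δ₁ * t) + δ₁ * t = (a + 1) * δ₁ * t by ring, hδ₁']; ring
  -- Outside `U` the mismatch `s₁ + s₂` between `p` and `q` controls both points, so the decay of
  -- the packet pairing outweighs the growth of the coefficients.
  have hPQ : p ∉ U → c * (‖p‖ + ‖q‖) ≤ 0 + (s₁ + s₂) := by
    intro hpU
    have h1 := Hδ (p, t) ht.le hpU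
    have h2 : ‖p‖ ≤ ‖(p, t)‖ := norm_fst_le (p, t)
    have h3 : t ≤ ‖(p, t)‖ := (le_abs_self t).trans (norm_snd_le (p, t))
    simp only at h1
    have h4 : ‖p.1 - t • A q₀.1‖ ≤ s₁ + a * (δ₁ * t) := by
      have := norm_add_le (p.1 - A q.1) (A q.1 - t • A q₀.1)
      rw [sub_add_sub_cancel] at this
      linarith
    have h5 : ‖LinearMap.adjoint A p.2 - t • q₀.2‖ ≤ s₂ + δ₁ * t := by
      have := norm_add_le (LinearMap.adjoint A p.2 - q.2) (q.2 - t • q₀.2)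
      rw [sub_add_sub_cancel] at this
      linarith
    have h6 : δ / 2 * ‖(p, t)‖ ≤ s₁ + s₂ := by
      have := mul_le_mul_of_nonneg_left h3 hδ.le
      linarith
    have h7 : ‖p‖ + ‖q‖ ≤ 2 * (1 + c₁) * ‖(p, t)‖ := by
      have e1 := mul_le_mul_of_nonneg_left h3 hc₁0.le
      have e2 := mul_nonneg hc₁0.le (norm_nonneg (p, t))
      have e3 : 2 * (1 + c₁) * ‖(p, t)‖ = 2 * ‖(p, t)‖ + 2 * (c₁ * ‖(p, t)‖) := by ring
      rw [e3]
      linarith [norm_nonneg (p, t)]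
    calc c * (‖p‖ + ‖q‖) ≤ δ / (4 * (1 + c₁)) * (2 * (1 + c₁) * ‖(p, t)‖) :=
          mul_le_mul (min_le_left _ _) h7 (by positivity) (by positivity)
      _ = δ / 2 * ‖(p, t)‖ := by field_simp; ring
      _ ≤ _ := by linarith
  -- Inside `U` the coefficients decay in `p`, but decay in `q` is wanted too. As `w > 0`, the size
  -- of `q` is controlled by `A q.1` and `q.2`, hence by `p` and the mismatch.
  have hPQ' : c * (‖p‖ + ‖q‖) ≤ ‖p‖ + (s₁ + s₂) := by
    have h1 : t * w ≤ ‖A q.1‖ + ‖q.2‖ + min δ w * t / 2 := by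
      have e1 : ‖t • A q₀.1‖ ≤ ‖A q.1‖ + a * (δ₁ * t) := by
        have := norm_sub_le (A q.1) (A q.1 - t • A q₀.1)
        rw [sub_sub_cancel] at this
        linarith
      have e2 : ‖t • q₀.2‖ ≤ ‖q.2‖ + δ₁ * t := by
        have := norm_sub_le q.2 (q.2 - t • q₀.2)
        rw [sub_sub_cancel] at this
        linarith
      rw [norm_smul, Real.norm_eq_abs, abs_of_pos ht] at e1 e2
      rw [hw]
      linarith
    have h2 : ‖A q.1‖ ≤ ‖p‖ + s₁ := by
      have := norm_sub_le p.1 (p.1 - A q.1)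
      rw [sub_sub_cancel] at this
      have := norm_fst_le p
      linarith
    have h3 : ‖q.2‖ ≤ a' * ‖p‖ + s₂ := by
      have e1 := norm_sub_le (LinearMap.adjoint A p.2) (LinearMap.adjoint A p.2 - q.2)
      rw [sub_sub_cancel] at e1
      have e2 := ha' p.2
      have e3 := mul_le_mul_of_nonneg_left (norm_snd_le p) ha'0.le
      linarith
    have h4 : t * w / 2 ≤ (2 + a') * (‖p‖ + (s₁ + s₂)) := by
      have e1 := mul_nonneg ha'0.le hs₁0
      have e2 := mul_nonneg ha'0.le hs₂0
      have e3 : (2 + a') * (‖p‖ + (s₁ + s₂)) =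
        2 * ‖p‖ + 2 * s₁ + 2 * s₂ + a' * ‖p‖ + a' * s₁ + a' * s₂ := by ring
      rw [e3]
      linarith [norm_nonneg p]
    have h5 : ‖q‖ ≤ 2 * c₁ * (2 + a') / w * (‖p‖ + (s₁ + s₂)) := by
      rw [div_mul_eq_mul_div, le_div_iff₀ hw0]
      calc ‖q‖ * w ≤ c₁ * t * w := by gcongr
        _ = 2 * c₁ * (t * w / 2) := by ring
        _ ≤ 2 * c₁ * ((2 + a') * (‖p‖ + (s₁ + s₂))) := by gcongr
        _ = _ := by ring
    have h6 : ‖p‖ + ‖q‖ ≤ (1 + 2 * c₁ * (2 + a') / w) * (‖p‖ + (s₁ + s₂)) := by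
      rw [add_mul, one_mul]
      linarith
    calc c * (‖p‖ + ‖q‖) ≤ 1 / (1 + 2 * c₁ * (2 + a') / w) *
          ((1 + 2 * c₁ * (2 + a') / w) * (‖p‖ + (s₁ + s₂))) :=
          mul_le_mul (min_le_right _ _) h6 (by positivity) (by positivity)
      _ = _ := by
          rw [← mul_assoc, one_div_mul_cancel (by positivity), one_mul]
  have hem : 2 * e * κ = min ε₁ ε₂ := by rw [he]; field_simp
  have hm1 : min ε₁ ε₂ ≤ ε₁ := min_le_left _ _
  have hm2 : min ε₁ ε₂ ≤ ε₂ := min_le_right _ _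
  rw [norm_mul]
  by_cases hpU : p ∈ U
  · have h1 := hU i p hpU
    have h2 := rpow_add_rpow_le hθ hc0 (norm_nonneg p) hs₁0 hs₂0 (norm_nonneg p) (norm_nonneg q)
      hPQ'
    change _ ≤ κ * (‖p‖ ^ (1 / θ) + s) at h2
    have h3 : Real.exp (-ε₁ * ‖p‖ ^ (1 / θ)) * Real.exp (-ε₂ * s) ≤
        Real.exp (-e * (‖p‖ ^ (1 / θ) + ‖q‖ ^ (1 / θ))) := by
      rw [← Real.exp_add]
      apply Real.exp_le_exp.2
      have h4 := mul_le_mul_of_nonneg_left h2 (show 0 ≤ 2 * e by positivity)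
      rw [← mul_assoc, hem] at h4
      have h5 := mul_le_mul_of_nonneg_right hm1 hp
      have h6 := mul_le_mul_of_nonneg_right hm2 hs0
      have h7 := mul_nonneg he0.le (add_nonneg hp hqr)
      linarith
    calc ‖b i p‖ * ‖pullPacket A (wavePacket q) p‖
        ≤ (K₁ * Real.exp (-ε₁ * ‖p‖ ^ (1 / θ))) * (K₂ * Real.exp (-ε₂ * s)) := by gcongr
      _ = K₁ * K₂ * (Real.exp (-ε₁ * ‖p‖ ^ (1 / θ)) * Real.exp (-ε₂ * s)) := by ring
      _ ≤ (K₁ + K₃) * K₂ * Real.exp (-e * (‖p‖ ^ (1 / θ) + ‖q‖ ^ (1 / θ))) := by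
          gcongr
          linarith
  · have h1 := H₃ i p
    have h2 := rpow_add_rpow_le hθ hc0 le_rfl hs₁0 hs₂0 (norm_nonneg p) (norm_nonneg q) (hPQ hpU)
    rw [Real.zero_rpow (by positivity), zero_add] at h2
    change _ ≤ κ * s at h2
    have h3 : Real.exp (e * ‖p‖ ^ (1 / θ)) * Real.exp (-ε₂ * s) ≤
        Real.exp (-e * (‖p‖ ^ (1 / θ) + ‖q‖ ^ (1 / θ))) := by
      rw [← Real.exp_add]
      apply Real.exp_le_exp.2
      have h4 := mul_le_mul_of_nonneg_left h2 (show 0 ≤ 2 * e by positivity)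
      rw [← mul_assoc, hem] at h4
      have h6 := mul_le_mul_of_nonneg_right hm2 hs0
      have h7 := mul_nonneg he0.le hqr
      linarith
    calc ‖b i p‖ * ‖pullPacket A (wavePacket q) p‖
        ≤ (K₃ * Real.exp (e * ‖p‖ ^ (1 / θ))) * (K₂ * Real.exp (-ε₂ * s)) := by gcongr
      _ = K₃ * K₂ * (Real.exp (e * ‖p‖ ^ (1 / θ)) * Real.exp (-ε₂ * s)) := by ring
      _ ≤ (K₁ + K₃) * K₂ * Real.exp (-e * (‖p‖ ^ (1 / θ) + ‖q‖ ^ (1 / θ))) := by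
          gcongr
          linarith

end Cones

/-! ## The pull-back -/

section Pullback

variable {d m : ℕ} {θ : ℝ} {I : Type}
  {A : EuclideanSpace ℝ (Fin m) →ₗ[ℝ] EuclideanSpace ℝ (Fin d)}
  {Γ : Set (EuclideanSpace ℝ (Fin d) × EuclideanSpace ℝ (Fin d))}
  {b : I → EuclideanSpace ℝ (Fin d) × EuclideanSpace ℝ (Fin d) → ℂ}

/-! ### The cone `Δ` -/

/-- With the origin adjoined to both cones, the kernel part is merely what the origin of `Γ ∪ {0}`
contributes. This uniform description is the one suited to taking limits. -/
lemma mem_insert_zero_pullCone_union_kerCone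
    {q : EuclideanSpace ℝ (Fin m) × EuclideanSpace ℝ (Fin m)} :
    q ∈ insert 0 (pullCone A Γ ∪ kerCone A) ↔
      ∃ ξ, (A q.1, ξ) ∈ insert 0 Γ ∧ q.2 = LinearMap.adjoint A ξ := by
  constructor
  · rintro (rfl | ⟨x, ξ, h, rfl⟩ | ⟨-, h1, h2⟩)
    · exact ⟨0, Or.inl (by simp), by simp⟩
    · exact ⟨ξ, Or.inr h, rfl⟩
    · exact ⟨0, Or.inl (by simp [h1]), by simp [h2]⟩
  · rintro ⟨ξ, h | h, h2⟩
    · obtain ⟨h3, rfl⟩ := Prod.mk_eq_zero.1 h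
      rw [map_zero] at h2
      by_cases hq : q.1 = 0
      · exact Or.inl (Prod.ext hq h2)
      · exact Or.inr (Or.inr ⟨hq, h3, h2⟩)
    · exact Or.inr (Or.inl ⟨q.1, ξ, h, Prod.ext rfl h2⟩)

lemma notMem_of_conormal (hA : Γ ∩ {p | p.1 = 0 ∧ LinearMap.adjoint A p.2 = 0} = ∅)
    {p : EuclideanSpace ℝ (Fin d) × EuclideanSpace ℝ (Fin d)} (h1 : p.1 = 0)
    (h2 : LinearMap.adjoint A p.2 = 0) : p ∉ Γ := fun hp =>
  Set.eq_empty_iff_forall_notMem.1 hA p ⟨hp, h1, h2⟩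

/-- The pull-back of a closed cone, together with the kernel, is a closed cone. -/
lemma isClosedCone_pullCone_union_kerCone (hΓ : IsClosedCone Γ)
    (hA : Γ ∩ {p | p.1 = 0 ∧ LinearMap.adjoint A p.2 = 0} = ∅) :
    IsClosedCone (pullCone A Γ ∪ kerCone A) := by
  obtain ⟨h0, hcone, hcl⟩ := hΓ
  have hAc : Continuous A := (LinearMap.toContinuousLinearMap A).continuous
  have hAt : Continuous (LinearMap.adjoint A) :=
    (LinearMap.toContinuousLinearMap (LinearMap.adjoint A)).continuous
  refine ⟨?_, ?_, ?_⟩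
  · rintro (⟨x, ξ, h, he⟩ | ⟨h, -⟩)
    · obtain ⟨rfl, h2⟩ := Prod.mk_eq_zero.1 he.symm
      exact notMem_of_conormal hA (p := (A 0, ξ)) (by simp) h2 h
    · exact h rfl
  · rintro t ht q (⟨x, ξ, h, rfl⟩ | ⟨h, h1, h2⟩)
    · refine Or.inl ⟨t • x, t • ξ, ?_, ?_⟩
      · rw [map_smul]
        exact hcone t ht _ h
      · rw [map_smul]
        rfl
    · exact Or.inr ⟨smul_ne_zero ht.ne' h, by simp [h1], by simp [h2]⟩
  -- On `Γ` the function `l` has no zeros, so `ξ` is bounded by `A x` and `ᵗAξ`. The covectors of a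
  -- convergent sequence thus stay in a compact ball and have a limit point.
  · obtain ⟨δ, hδ, H⟩ := exists_mul_norm_le_of_cone hcl
      (fun t ht v hv => hv.elim (fun h => Or.inl (by rw [h, smul_zero]))
        fun h => Or.inr (hcone t ht v h))
      (l := fun p => ‖p.1‖ + ‖LinearMap.adjoint A p.2‖) (by fun_prop)
      (fun t ht p => by
        simp only [Prod.smul_fst, Prod.smul_snd, map_smul, norm_smul, Real.norm_eq_abs,
          abs_of_pos ht]
        ring) (fun p => by positivity)
      (fun p hp hp0 hl => by
        have h1 := norm_nonneg p.1
        have h2 := norm_nonneg (LinearMap.adjoint A p.2)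
        exact notMem_of_conormal hA (norm_eq_zero.1 (by linarith)) (norm_eq_zero.1 (by linarith))
          (hp.resolve_left hp0))
    refine IsSeqClosed.isClosed fun q q₀ hq hlim => ?_
    choose ξ hξ hqξ using fun n => mem_insert_zero_pullCone_union_kerCone.1 (hq n)
    have hl1 : Filter.Tendsto (fun n => A (q n).1) Filter.atTop (nhds (A q₀.1)) :=
      ((hAc.comp continuous_fst).tendsto q₀).comp hlim
    have hl2 : Filter.Tendsto (fun n => (q n).2) Filter.atTop (nhds q₀.2) :=
      (continuous_snd.tendsto q₀).comp hlim
    obtain ⟨R, hR⟩ := (hl1.norm.add hl2.norm).bddAbove_range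
    have hbd : ∀ n, ξ n ∈ Metric.closedBall (0 : EuclideanSpace ℝ (Fin d)) (R / δ) := by
      intro n
      have h1 := H _ (hξ n)
      have h2 : ‖A (q n).1‖ + ‖(q n).2‖ ≤ R := hR ⟨n, rfl⟩
      rw [hqξ n] at h2
      rw [mem_closedBall_zero_iff, le_div_iff₀ hδ, mul_comm]
      exact (mul_le_mul_of_nonneg_left (norm_snd_le (A (q n).1, ξ n)) hδ.le).trans (h1.trans h2)
    obtain ⟨ξ₀, -, φ, hφ, hξ₀⟩ := (isCompact_closedBall _ _).tendsto_subseq hbd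
    refine mem_insert_zero_pullCone_union_kerCone.2 ⟨ξ₀, ?_, ?_⟩
    · exact hcl.mem_of_tendsto ((hl1.comp hφ.tendsto_atTop).prodMk_nhds hξ₀)
        (Filter.Eventually.of_forall fun n => hξ (φ n))
    · refine tendsto_nhds_unique (hl2.comp hφ.tendsto_atTop) ?_
      have h3 := (hAt.tendsto ξ₀).comp hξ₀
      refine h3.congr fun n => ?_
      simp only [Function.comp_apply]
      exact (hqξ (φ n)).symm

lemma kerCone_eq_empty (hA : Function.Injective A) : kerCone A = ∅ :=
  Set.eq_empty_iff_forall_notMem.2 fun q hq => hq.1 (hA (by rw [hq.2.1, map_zero]))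

lemma pullCone_id : pullCone (LinearMap.id : EuclideanSpace ℝ (Fin d) →ₗ[ℝ]
    EuclideanSpace ℝ (Fin d)) Γ = Γ := by
  ext q
  constructor
  · rintro ⟨x, ξ, h, rfl⟩
    rw [adjoint_id]
    exact h
  · intro h
    exact ⟨q.1, q.2, h, by rw [adjoint_id]; rfl⟩

/-! ### Pairings over phase space -/

lemma exists_conicDecay_of_mem {hθ : 1 / 2 ≤ θ} (u : GSDualCone hθ Γ)
    {p : EuclideanSpace ℝ (Fin d) × EuclideanSpace ℝ (Fin d)} (hp0 : p ≠ 0) (hp : p ∉ Γ) :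
    ∃ U, p ∈ U ∧ ConicDecay θ (fun _ : Unit => stft hθ u.1) U := by
  refine (decaysAt_iff hθ _ p).1 ?_
  by_contra h
  exact hp (u.2 ⟨hp0, h⟩)

lemma mem_gsDualCone_of_decaysAt {hθ : 1 / 2 ≤ θ} {u : GSDual θ d}
    (h : ∀ p, p ≠ 0 → p ∉ Γ → DecaysAt hθ (fun _ : Unit => u) p) : u ∈ GSDualCone hθ Γ := by
  rintro p ⟨hp0, hp⟩
  by_contra hΓ
  exact hp (h p hp0 hΓ)

lemma exists_pairing_bound (hθ : 1 / 2 ≤ θ) (hθ' : θ < 1)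
    (hA : Γ ∩ {p | p.1 = 0 ∧ LinearMap.adjoint A p.2 = 0} = ∅) (hG : SubexpGrowth θ b)
    (hD : ∀ p, p ≠ 0 → p ∉ Γ → ∃ U, p ∈ U ∧ ConicDecay θ b U) {C : ℝ} (hC : 0 < C) :
    ∃ K > 0, ∃ ε > 0, ∀ (i : I) (h : EuclideanSpace ℝ (Fin m) → ℂ) (M : ℝ), 0 ≤ M →
      ContDiff ℝ ∞ h → GSBound θ C M h → ∀ p,
      ‖b i p * pullPacket A h p‖ ≤ K * M * Real.exp (-ε * ‖p‖ ^ (1 / θ)) :=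
  exists_mul_pullPacket_bound hθ hθ' A hG
    (fun p hp0 h1 h2 => hD p hp0 (notMem_of_conormal hA h1 h2)) hC

lemma integrable_pairing (hθ : 1 / 2 ≤ θ) (hθ' : θ < 1)
    (hA : Γ ∩ {p | p.1 = 0 ∧ LinearMap.adjoint A p.2 = 0} = ∅) (hG : SubexpGrowth θ b)
    (hD : ∀ p, p ≠ 0 → p ∉ Γ → ∃ U, p ∈ U ∧ ConicDecay θ b U) {i : I}
    (hm : AEStronglyMeasurable (b i)) (h : GS θ m) :
    Integrable fun p => b i p * pullPacket A h.1 p := by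
  obtain ⟨C, hC, M, hM, hb⟩ := IsGS.exists_bound h.2
  obtain ⟨K, hK, ε, hε, H⟩ := exists_pairing_bound hθ hθ' hA hG hD hC
  exact Integrable.mono' ((integrable_exp_neg_norm_rpow_phase (d := d) hθ hθ'.le hε).const_mul
    (K * M)) (hm.mul (stronglyMeasurable_pullPacket A h.2.1.continuous).aestronglyMeasurable)
    (Filter.Eventually.of_forall fun p => H i h.1 M hM h.2.1 hb p)

/-- Dominated convergence: the bound of `exists_pairing_bound` is uniform over the family and serves
as the majorant. -/
lemma tendsto_integral_pairing (hθ : 1 / 2 ≤ θ) (hθ' : θ < 1)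
    {b : ℕ → EuclideanSpace ℝ (Fin d) × EuclideanSpace ℝ (Fin d) → ℂ}
    (hA : Γ ∩ {p | p.1 = 0 ∧ LinearMap.adjoint A p.2 = 0} = ∅) (hG : SubexpGrowth θ b)
    (hD : ∀ p, p ≠ 0 → p ∉ Γ → ∃ U, p ∈ U ∧ ConicDecay θ b U)
    (hm : ∀ n, AEStronglyMeasurable (b n))
    (hlim : ∀ p, Filter.Tendsto (fun n => b n p) Filter.atTop (nhds 0)) (h : GS θ m) :
    Filter.Tendsto (fun n => ∫ p, b n p * pullPacket A h.1 p) Filter.atTop (nhds 0) := by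
  obtain ⟨C, hC, M, hM, hb⟩ := IsGS.exists_bound h.2
  obtain ⟨K, hK, ε, hε, H⟩ := exists_pairing_bound hθ hθ' hA hG hD hC
  have := tendsto_integral_of_dominated_convergence (μ := volume)
    (F := fun n p => b n p * pullPacket A h.1 p) (f := fun _ => 0)
    (fun p => K * M * Real.exp (-ε * ‖p‖ ^ (1 / θ)))
    (fun n => (hm n).mul
      (stronglyMeasurable_pullPacket A h.2.1.continuous).aestronglyMeasurable)
    ((integrable_exp_neg_norm_rpow_phase (d := d) hθ hθ'.le hε).const_mul (K * M))
    (fun n => Filter.Eventually.of_forall fun p => H n h.1 M hM h.2.1 hb p)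
    (Filter.Eventually.of_forall fun p => by simpa using (hlim p).mul_const (pullPacket A h.1 p))
  simpa using this

/-- The decay of ultradistributions obtained by pairing with pulled back wave packets. -/
lemma decaysAt_of_pairing (hθ : 1 / 2 ≤ θ) (hθ' : θ < 1) (hΓ : IsClosedCone Γ)
    (hA : Γ ∩ {p | p.1 = 0 ∧ LinearMap.adjoint A p.2 = 0} = ∅) (hG : SubexpGrowth θ b)
    (hD : ∀ p, p ≠ 0 → p ∉ Γ → ∃ U, p ∈ U ∧ ConicDecay θ b U) (v : I → GSDual θ m)
    (hv : ∀ i (h : GS θ m), (v i).1 h = (invConst d : ℂ) * ∫ p, b i p * pullPacket A h.1 p)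
    {q₀ : EuclideanSpace ℝ (Fin m) × EuclideanSpace ℝ (Fin m)} (hq0 : q₀ ≠ 0)
    (hq₀ : q₀ ∉ pullCone A Γ ∪ kerCone A) : DecaysAt hθ v q₀ := by
  obtain ⟨V, hV1, hV2, hV3, K, hK, ε, hε, H⟩ := exists_mul_pullPacket_wavePacket_bound hθ hθ' A hG
    (q₀ := q₀)
    (fun h => hq₀ (Or.inr ⟨fun h1 => hq0 (Prod.ext h1 h.2), h.1, h.2⟩))
    (fun p t hp0 ht h1 h2 => by
      refine hD p hp0 ?_
      -- For `t = 0` the point is conormal and hence outside `Γ`. For `t > 0` membership in `Γ`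
      -- would, after division by `t`, place `q₀` in `A^*Γ`.
      rcases ht.eq_or_lt with rfl | ht
      · rw [zero_smul] at h1 h2
        exact notMem_of_conormal hA h1 h2
      · intro hp
        refine hq₀ (Or.inl ⟨q₀.1, t⁻¹ • p.2, ?_, ?_⟩)
        · have := hΓ.2.1 t⁻¹ (inv_pos.2 ht) p hp
          rwa [← Prod.mk.eta (p := t⁻¹ • p), Prod.smul_fst, Prod.smul_snd, h1, smul_smul,
            inv_mul_cancel₀ ht.ne', one_smul] at this
        · rw [map_smul, h2, smul_smul, inv_mul_cancel₀ ht.ne', one_smul])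
  have hI := integrable_exp_neg_norm_rpow_phase (d := d) hθ hθ'.le hε
  set J := ∫ p : EuclideanSpace ℝ (Fin d) × EuclideanSpace ℝ (Fin d),
    Real.exp (-ε * ‖p‖ ^ (1 / θ))
  have hJ : 0 ≤ J := integral_nonneg fun p => (Real.exp_pos _).le
  have hc := invConst_pos d
  refine (decaysAt_iff hθ v q₀).2 ⟨V, hV2, hV1, hV3, invConst d * K * (J + 1), by positivity, ε, hε,
    fun i q hq => ?_⟩
  change ‖(v i).1 ⟨wavePacket q, isGS_wavePacket hθ q⟩‖ ≤ _
  rw [hv, norm_mul, Complex.norm_real, Real.norm_eq_abs, abs_of_pos hc]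
  have h1 : ‖∫ p, b i p * pullPacket A (wavePacket q) p‖ ≤
      K * Real.exp (-ε * ‖q‖ ^ (1 / θ)) * J := by
    rw [← integral_const_mul]
    refine norm_integral_le_of_norm_le (hI.const_mul _) (Filter.Eventually.of_forall fun p => ?_)
    refine (H i q hq p).trans (le_of_eq ?_)
    rw [mul_assoc, ← Real.exp_add]
    congr 2
    ring
  calc invConst d * ‖∫ p, b i p * pullPacket A (wavePacket q) p‖
      ≤ invConst d * (K * Real.exp (-ε * ‖q‖ ^ (1 / θ)) * (J + 1)) := by
        gcongr
        exact h1.trans (by gcongr; linarith)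
    _ = _ := by ring

lemma aestronglyMeasurable_stft (hθ : 1 / 2 ≤ θ) (hθ' : θ < 1) (u : GSDual θ d) :
    AEStronglyMeasurable (stft hθ u) := (continuous_stft hθ hθ' u).aestronglyMeasurable

lemma integrable_stft_mul_pullPacket {hθ : 1 / 2 ≤ θ} (hθ' : θ < 1)
    (hA : Γ ∩ {p | p.1 = 0 ∧ LinearMap.adjoint A p.2 = 0} = ∅) (u : GSDualCone hθ Γ)
    (h : GS θ m) : Integrable fun p => stft hθ u.1 p * pullPacket A h.1 p :=
  integrable_pairing (b := fun _ : Unit => stft hθ u.1) (i := ()) hθ hθ' hA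
    (subexpGrowth_stft_single hθ hθ' u.1) (fun _ h0 h1 => exists_conicDecay_of_mem u h0 h1)
    (aestronglyMeasurable_stft hθ hθ' u.1) h

lemma pullPacket_add (hθ : 1 / 2 ≤ θ) (hθ' : θ < 1)
    (A : EuclideanSpace ℝ (Fin m) →ₗ[ℝ] EuclideanSpace ℝ (Fin d)) (h k : GS θ m)
    (p : EuclideanSpace ℝ (Fin d) × EuclideanSpace ℝ (Fin d)) :
    pullPacket A (h + k).1 p = pullPacket A h.1 p + pullPacket A k.1 p := by
  have hw := isGS_wavePacket hθ (flipFreq p)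
  rw [pullPacket, pullPacket, pullPacket, ← integral_add (hw.integrable_comp_mul hθ hθ' A h.2)
    (hw.integrable_comp_mul hθ hθ' A k.2)]
  congr 1
  funext y
  exact mul_add _ _ _

lemma pullPacket_smul (A : EuclideanSpace ℝ (Fin m) →ₗ[ℝ] EuclideanSpace ℝ (Fin d)) (c : ℂ)
    (h : GS θ m) (p : EuclideanSpace ℝ (Fin d) × EuclideanSpace ℝ (Fin d)) :
    pullPacket A (c • h).1 p = c * pullPacket A h.1 p := by
  rw [pullPacket, pullPacket, ← integral_const_mul]
  congr 1
  funext y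
  exact mul_left_comm _ _ _

/-! ### Construction and continuity of the pull-back -/

/-- The pull-back of an ultradistribution, as an ultradistribution. -/
def pullbackDual {hθ : 1 / 2 ≤ θ} (hθ' : θ < 1)
    (hA : Γ ∩ {p | p.1 = 0 ∧ LinearMap.adjoint A p.2 = 0} = ∅) (u : GSDualCone hθ Γ) :
    GSDual θ m :=
  ⟨{ toFun := fun h => (invConst d : ℂ) * ∫ p, stft hθ u.1 p * pullPacket A h.1 p
     map_add' := fun h k => by
      simp only [pullPacket_add hθ hθ', mul_add]
      rw [integral_add (integrable_stft_mul_pullPacket hθ' hA u h) (integrable_stft_mul_pullPacket hθ' hA u k), mul_add]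
     map_smul' := fun c h => by
      simp only [pullPacket_smul, mul_left_comm _ c]
      rw [integral_const_mul, RingHom.id_apply, smul_eq_mul, mul_left_comm] }, by
    intro C hC
    obtain ⟨K, hK, ε, hε, H⟩ := exists_pairing_bound (b := fun _ : Unit => stft hθ u.1) hθ hθ' hA
      (subexpGrowth_stft_single hθ hθ' u.1) (fun _ h0 h1 => exists_conicDecay_of_mem u h0 h1) hC
    have hI := integrable_exp_neg_norm_rpow_phase (d := d) hθ hθ'.le hε
    refine ⟨invConst d * (K * ∫ p : EuclideanSpace ℝ (Fin d) × EuclideanSpace ℝ (Fin d),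
      Real.exp (-ε * ‖p‖ ^ (1 / θ))), fun h M hM hb => ?_⟩
    have hc := invConst_pos d
    change ‖(invConst d : ℂ) * ∫ p, stft hθ u.1 p * pullPacket A h.1 p‖ ≤ _
    rw [norm_mul, Complex.norm_real, Real.norm_eq_abs, abs_of_pos hc, mul_assoc]
    gcongr
    have := norm_integral_le_of_norm_le (hI.const_mul (K * M))
      (Filter.Eventually.of_forall fun p => H () h.1 M hM h.2.1 hb p)
    rw [integral_const_mul] at this
    linarith⟩

lemma pullbackDual_apply {hθ : 1 / 2 ≤ θ} (hθ' : θ < 1)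
    (hA : Γ ∩ {p | p.1 = 0 ∧ LinearMap.adjoint A p.2 = 0} = ∅) (u : GSDualCone hθ Γ)
    (h : GS θ m) : (pullbackDual hθ' hA u).1 h =
      (invConst d : ℂ) * ∫ p, stft hθ u.1 p * pullPacket A h.1 p := rfl

/-- The pull-back of ultradistributions by a linear map. -/
def pullback {hθ : 1 / 2 ≤ θ} (hθ' : θ < 1) (hΓ : IsClosedCone Γ)
    (hA : Γ ∩ {p | p.1 = 0 ∧ LinearMap.adjoint A p.2 = 0} = ∅) :
    GSDualCone hθ Γ →ₗ[ℂ] GSDualCone hθ (pullCone A Γ ∪ kerCone A) where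
  toFun u := ⟨pullbackDual hθ' hA u, mem_gsDualCone_of_decaysAt fun _ h0 h1 =>
    decaysAt_of_pairing (b := fun _ : Unit => stft hθ u.1) hθ hθ' hΓ hA
      (subexpGrowth_stft_single hθ hθ' u.1) (fun _ h0 h1 => exists_conicDecay_of_mem u h0 h1) _
      (fun _ _ => rfl) h0 h1⟩
  map_add' u v := by
    refine Subtype.ext (Subtype.ext (LinearMap.ext fun h => ?_))
    change (pullbackDual hθ' hA (u + v)).1 h =
      (pullbackDual hθ' hA u).1 h + (pullbackDual hθ' hA v).1 h
    rw [pullbackDual_apply, pullbackDual_apply, pullbackDual_apply, ← mul_add,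
      ← integral_add (integrable_stft_mul_pullPacket hθ' hA u h) (integrable_stft_mul_pullPacket hθ' hA v h)]
    congr 2
    funext p
    exact add_mul _ _ _
  map_smul' c u := by
    refine Subtype.ext (Subtype.ext (LinearMap.ext fun h => ?_))
    change (pullbackDual hθ' hA (c • u)).1 h = c * (pullbackDual hθ' hA u).1 h
    rw [pullbackDual_apply, pullbackDual_apply, mul_left_comm, ← integral_const_mul c]
    congr 2
    funext p
    exact mul_assoc _ _ _

lemma pullback_apply {hθ : 1 / 2 ≤ θ} (hθ' : θ < 1) (hΓ : IsClosedCone Γ)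
    (hA : Γ ∩ {p | p.1 = 0 ∧ LinearMap.adjoint A p.2 = 0} = ∅) (u : GSDualCone hθ Γ)
    (h : GS θ m) : (pullback hθ' hΓ hA u).1.1 h =
      (invConst d : ℂ) * ∫ p, stft hθ u.1 p * pullPacket A h.1 p := rfl

lemma IsFunction.unique {u v : GSDual θ d} {g : EuclideanSpace ℝ (Fin d) → ℂ}
    (hu : IsFunction u g) (hv : IsFunction v g) : u = v :=
  Subtype.ext (LinearMap.ext fun h => (hu h).2.trans (hv h).2.symm)

/-- The ultradistribution defined by a test function. -/
def ofTest {hθ : 1 / 2 ≤ θ} (hθ' : θ < 1)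
    (Γ : Set (EuclideanSpace ℝ (Fin d) × EuclideanSpace ℝ (Fin d))) (f : GS θ d) :
    GSDualCone hθ Γ :=
  ⟨pairPull hθ hθ' LinearMap.id f, mem_gsDualCone_of_decaysAt fun p _ _ => by
    obtain ⟨K, hK, ε, hε, H⟩ := exists_pullPacket_id_bound hθ hθ' f.2
    refine (decaysAt_iff hθ _ p).2 ⟨Set.univ, trivial, isOpen_univ, fun _ _ _ _ => trivial, K, hK,
      ε, hε, fun _ q _ => ?_⟩
    change ‖stft hθ (pairPull hθ hθ' LinearMap.id f) q‖ ≤ _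
    rw [stft_pairPull, ← norm_flipFreq q]
    exact H _⟩

lemma isFunction_ofTest {hθ : 1 / 2 ≤ θ} (hθ' : θ < 1) (f : GS θ d) :
    IsFunction (ofTest (hθ := hθ) hθ' Γ f).1 f.1 := fun h => by
  refine ⟨f.2.integrable_comp_mul hθ hθ' LinearMap.id h.2, ?_⟩
  change ∫ y, h.1 y * f.1 y = _
  simp only [mul_comm]

/-- For fixed `h` the form `f ↦ ∫ f(Ay) h(y) dy` is an ultradistribution. Its inversion formula,
evaluated at `f` and reflected in the frequency, is the integral defining the pull-back of `f`. -/
lemma extendsPullback_pullback {hθ : 1 / 2 ≤ θ} (hθ' : θ < 1) (hΓ : IsClosedCone Γ)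
    (hA : Γ ∩ {p | p.1 = 0 ∧ LinearMap.adjoint A p.2 = 0} = ∅) :
    ExtendsPullback A (pullback (hθ := hθ) hθ' hΓ hA) := by
  refine fun f => ⟨ofTest hθ' Γ f, isFunction_ofTest hθ' f, fun h =>
    ⟨f.2.integrable_comp_mul hθ hθ' A h.2, ?_⟩⟩
  rw [← pairPull_apply hθ hθ' A h f, inversion hθ hθ' (pairPull hθ hθ' A h), pullback_apply,
    ← integral_comp_flipFreq]
  congr 2
  funext p
  rw [ofTest, stft_pairPull, stft_pairPull, flipFreq_flipFreq, mul_comm]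

/-- By linearity only `u n - v` matters. Banach–Steinhaus gives its transforms a common growth bound
and convergence in the cone space gives common decay outside `Γ`, so the pairing estimates apply to
the whole sequence. -/
lemma isContinuousMap_pullback {hθ : 1 / 2 ≤ θ} (hθ' : θ < 1) (hΓ : IsClosedCone Γ)
    (hA : Γ ∩ {p | p.1 = 0 ∧ LinearMap.adjoint A p.2 = 0} = ∅) :
    IsContinuousMap (pullback (hθ := hθ) hθ' hΓ hA) := by
  rintro u v ⟨hw, hd⟩
  have hG : SubexpGrowth θ fun n => stft hθ (u n - v).1 :=
    subexpGrowth_stft hθ hθ' _ fun C hC => exists_uniform_bound hC (fun n => (u n - v).1) fun f => by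
      obtain ⟨K, hK⟩ := (hw f).norm.bddAbove_range
      exact ⟨K, fun n => hK ⟨n, rfl⟩⟩
  have hD : ∀ p, p ≠ 0 → p ∉ Γ → ∃ U, p ∈ U ∧ ConicDecay θ (fun n => stft hθ (u n - v).1) U :=
    fun p h0 h1 => (decaysAt_iff hθ _ p).1 (hd p h0 h1)
  have e : ∀ n, pullback hθ' hΓ hA (u n) - pullback hθ' hΓ hA v = pullback hθ' hΓ hA (u n - v) :=
    fun n => by
      have h : pullback hθ' hΓ hA (u n - v) + pullback hθ' hΓ hA v = pullback hθ' hΓ hA (u n) := by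
        rw [← map_add]
        exact congrArg _ (Subtype.ext (sub_add_cancel (u n).1 v.1))
      rw [← h]
      exact Subtype.ext (add_sub_cancel_right (pullback hθ' hΓ hA (u n - v)).1 _)
  constructor
  · intro h
    simp only [e, pullback_apply]
    have := (tendsto_integral_pairing hθ hθ' hA hG hD
      (fun n => aestronglyMeasurable_stft hθ hθ' (u n - v).1) (fun p => hw _) h).const_mul
      (invConst d : ℂ)
    simpa using this
  · intro q h0 h1
    simp only [e]
    exact decaysAt_of_pairing hθ hθ' hΓ hA hG hD _ (fun _ _ => rfl) h0 h1

/-! ### Density of test functions and uniqueness -/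

/-- Test functions are sequentially dense in the ultradistributions with wave front set in a
closed cone. -/
lemma exists_test_convergesTo {hθ : 1 / 2 ≤ θ} (hθ' : θ < 1) (hΓ : IsClosedCone Γ)
    (u : GSDualCone hθ Γ) :
    ∃ f : ℕ → GS θ d, ConvergesTo (fun n => ofTest hθ' Γ (f n)) u := by
  set B : ℕ → Set (EuclideanSpace ℝ (Fin d) × EuclideanSpace ℝ (Fin d)) :=
    fun n => Metric.closedBall 0 n
  have hBm : ∀ n, MeasurableSet (B n) := fun n => Metric.isClosed_closedBall.measurableSet
  have hBf : ∀ n p, flipFreq p ∈ B n ↔ p ∈ B n := fun n p => by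
    simp only [B, mem_closedBall_zero_iff, norm_flipFreq]
  have hu := continuous_stft hθ hθ' u.1
  -- The transform is cut off to a ball and resynthesised. The reflection in the coefficients stands
  -- for the conjugate packets of the inversion formula.
  have hsyn : ∀ n, ∃ g : GS θ d, ∀ v : GSDual θ d, v.1 g =
      ∫ p, (B n).indicator (fun p => stft hθ u.1 (flipFreq p)) p * stft hθ v p := by
    intro n
    have hc : Continuous fun p => stft hθ u.1 (flipFreq p) := hu.comp continuous_flipFreq
    obtain ⟨g, -, hg⟩ := exists_synthesis hθ hθ'
      (b := (B n).indicator fun p => stft hθ u.1 (flipFreq p))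
      (hc.aestronglyMeasurable.indicator (hBm n)) one_pos (by
        have hc2 : Continuous fun p => ‖stft hθ u.1 (flipFreq p)‖ *
            Real.exp (1 * ‖p‖ ^ (1 / θ)) :=
          hc.norm.mul (Real.continuous_exp.comp (continuous_const.mul
            (continuous_norm.rpow_const fun _ => Or.inr (by positivity))))
        have h1 : Integrable ((B n).indicator _) := (hc2.continuousOn.integrableOn_compact (μ := volume)
          (isCompact_closedBall 0 (n : ℝ))).integrable_indicator (hBm n)
        refine h1.congr (Filter.Eventually.of_forall fun p => ?_)
        by_cases hp : p ∈ B n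
        · simp only [Set.indicator_of_mem hp]
        · simp only [Set.indicator_of_notMem hp, norm_zero, zero_mul])
    exact ⟨g, hg⟩
  choose g hg using hsyn
  -- The coefficients of the error. They are dominated by the transform of `u`, so growth and conic
  -- decay are inherited uniformly in `n`, and at each point they vanish for large `n`.
  set c : ℕ → EuclideanSpace ℝ (Fin d) × EuclideanSpace ℝ (Fin d) → ℂ :=
    fun n => (B n)ᶜ.indicator fun p => -stft hθ u.1 p
  have hcn : ∀ n p, ‖c n p‖ ≤ ‖stft hθ u.1 p‖ := fun n p =>
    (norm_indicator_le_norm_self _ _).trans_eq (norm_neg _)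
  have hG : SubexpGrowth θ c := fun ε hε => by
    obtain ⟨K, hK, H⟩ := subexpGrowth_stft_single hθ hθ' u.1 ε hε
    exact ⟨K, hK, fun n p => (hcn n p).trans (H () p)⟩
  have hD : ∀ p, p ≠ 0 → p ∉ Γ → ∃ U, p ∈ U ∧ ConicDecay θ c U := fun p h0 h1 => by
    obtain ⟨U, hpU, hU1, hU2, K, hK, ε, hε, H⟩ := exists_conicDecay_of_mem u h0 h1
    exact ⟨U, hpU, hU1, hU2, K, hK, ε, hε, fun n q hq => (hcn n q).trans (H () q hq)⟩
  have hid : Γ ∩ {p | p.1 = 0 ∧ LinearMap.adjoint (LinearMap.id : EuclideanSpace ℝ (Fin d) →ₗ[ℝ]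
      EuclideanSpace ℝ (Fin d)) p.2 = 0} = ∅ := by
    refine Set.eq_empty_iff_forall_notMem.2 fun p hp => hΓ.1 ?_
    have h2 := hp.2.2
    rw [adjoint_id] at h2
    rw [← show p = 0 from Prod.ext hp.2.1 h2]
    exact hp.1
  have hcm : ∀ n, AEStronglyMeasurable (c n) := fun n =>
    hu.neg.aestronglyMeasurable.indicator (hBm n).compl
  -- The error is a pairing of the type already estimated, now with `A = id`, for which the conormal
  -- condition `hid` reduces to `0 ∉ Γ`.
  have e : ∀ n (h : GS θ d), (ofTest hθ' Γ ((invConst d : ℂ) • g n) - u).1.1 h =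
      (invConst d : ℂ) * ∫ p, c n p * pullPacket LinearMap.id h.1 p := by
    intro n h
    have h1 : (ofTest (hθ := hθ) hθ' Γ ((invConst d : ℂ) • g n)).1.1 h =
        (invConst d : ℂ) * ∫ p, (B n).indicator (stft hθ u.1) p *
          pullPacket LinearMap.id h.1 p := by
      rw [(isFunction_ofTest hθ' _ h).2]
      change (pairPull hθ hθ' LinearMap.id h).1 ((invConst d : ℂ) • g n) = _
      rw [map_smul, smul_eq_mul, hg, ← integral_comp_flipFreq]
      congr 2
      funext p
      rw [stft_pairPull, flipFreq_flipFreq]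
      congr 1
      by_cases hp : p ∈ B n
      · rw [Set.indicator_of_mem hp, Set.indicator_of_mem ((hBf n p).2 hp), flipFreq_flipFreq]
      · rw [Set.indicator_of_notMem hp, Set.indicator_of_notMem fun h => hp ((hBf n p).1 h)]
    change (ofTest (hθ := hθ) hθ' Γ ((invConst d : ℂ) • g n)).1.1 h - u.1.1 h = _
    have hI := integrable_stft_mul_pullPacket hθ' hid u h
    have hI' : Integrable fun p => (B n).indicator (stft hθ u.1) p *
        pullPacket LinearMap.id h.1 p := by
      refine (hI.indicator (hBm n)).congr (Filter.Eventually.of_forall fun p => ?_)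
      exact Set.indicator_mul_left _ _ _
    rw [h1, inversion hθ hθ' u.1 h, ← mul_sub, ← integral_sub hI' hI]
    congr 2
    funext p
    rw [← sub_mul]
    congr 1
    by_cases hp : p ∈ B n
    · simp [c, hp]
    · simp [c, hp]
  refine ⟨fun n => (invConst d : ℂ) • g n, fun h => ?_, fun p h0 h1 => ?_⟩
  · simp only [e]
    have := (tendsto_integral_pairing hθ hθ' hid hG hD hcm (fun p => ?_) h).const_mul
      (invConst d : ℂ)
    · simpa using this
    · obtain ⟨N, hN⟩ := exists_nat_ge ‖p‖
      refine tendsto_const_nhds.congr' ?_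
      filter_upwards [Filter.eventually_ge_atTop N] with n hn
      have : p ∈ B n := by
        rw [mem_closedBall_zero_iff]
        exact hN.trans (by exact_mod_cast hn)
      simp [c, this]
  · refine decaysAt_of_pairing hθ hθ' hΓ hid hG hD _ e h0 ?_
    rwa [pullCone_id, kerCone_eq_empty Function.injective_id, Set.union_empty]

lemma ConvergesTo.unique {hθ : 1 / 2 ≤ θ} {u : ℕ → GSDualCone hθ Γ} {v w : GSDualCone hθ Γ}
    (hv : ConvergesTo u v) (hw : ConvergesTo u w) : v = w := by
  refine Subtype.ext (Subtype.ext (LinearMap.ext fun f => ?_))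
  have h := (hw.1 f).sub (hv.1 f)
  have e : (fun n => (u n - w).1.1 f - (u n - v).1.1 f) = fun _ => v.1.1 f - w.1.1 f := by
    funext n
    change ((u n).1.1 f - w.1.1 f) - ((u n).1.1 f - v.1.1 f) = _
    ring
  rw [e, sub_zero] at h
  exact sub_eq_zero.1 (tendsto_nhds_unique tendsto_const_nhds h)

/-- A continuous extension of the pull-back of test functions is unique. -/
lemma ExtendsPullback.unique {hθ : 1 / 2 ≤ θ} (hθ' : θ < 1) (hΓ : IsClosedCone Γ)
    {Δ : Set (EuclideanSpace ℝ (Fin m) × EuclideanSpace ℝ (Fin m))}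
    {F G : GSDualCone hθ Γ → GSDualCone hθ Δ} (hF : ExtendsPullback A F)
    (hG : ExtendsPullback A G) (hF' : IsContinuousMap F) (hG' : IsContinuousMap G) : G = F := by
  -- An ultradistribution is determined by the function that represents it, so the existential in
  -- the extension property can only refer to `ofTest`.
  have key : ∀ f : GS θ d, G (ofTest hθ' Γ f) = F (ofTest hθ' Γ f) := by
    intro f
    obtain ⟨u, hu, hu'⟩ := hF f
    obtain ⟨v, hv, hv'⟩ := hG f
    have eu : u = ofTest hθ' Γ f := Subtype.ext (hu.unique (isFunction_ofTest hθ' f))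
    have ev : v = ofTest hθ' Γ f := Subtype.ext (hv.unique (isFunction_ofTest hθ' f))
    subst eu
    rw [ev] at hv'
    exact Subtype.ext (hv'.unique hu')
  funext u
  obtain ⟨f, hf⟩ := exists_test_convergesTo hθ' hΓ u
  have h1 := hG' _ _ hf
  simp only [key] at h1
  exact h1.unique (hF' _ _ hf)

end Pullback

end GelfandShilov

end

open GelfandShilov in
theorem mainTheorem2 {θ : ℝ} (hθ : 1 / 2 ≤ θ) (hθ' : θ < 1) {d m : ℕ}
    (A : EuclideanSpace ℝ (Fin m) →ₗ[ℝ] EuclideanSpace ℝ (Fin d))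
    (Γ : Set (EuclideanSpace ℝ (Fin d) × EuclideanSpace ℝ (Fin d)))
    (hΓ : IsClosedCone Γ)
    (hA : Γ ∩ {p | p.1 = 0 ∧ LinearMap.adjoint A p.2 = 0} = ∅) :
    IsClosedCone (pullCone A Γ ∪ kerCone A) ∧
    (Function.Injective A →
      pullCone A Γ ∪ kerCone A = pullCone A Γ ∧
      ∀ f ∈ GS θ d, (fun x => f (A x)) ∈ GS θ m) ∧
    ∃ F : GSDualCone hθ Γ →ₗ[ℂ] GSDualCone hθ (pullCone A Γ ∪ kerCone A),
      ExtendsPullback A F ∧ IsContinuousMap F ∧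
      ∀ G : GSDualCone hθ Γ → GSDualCone hθ (pullCone A Γ ∪ kerCone A),
        ExtendsPullback A G → IsContinuousMap G → G = F := by
  refine ⟨isClosedCone_pullCone_union_kerCone hΓ hA, fun hinj => ⟨?_, fun f hf => ?_⟩,
    pullback hθ' hΓ hA, extendsPullback_pullback hθ' hΓ hA, isContinuousMap_pullback hθ' hΓ hA,
    fun G hG hG' => ?_⟩
  · rw [kerCone_eq_empty hinj, Set.union_empty]
  · exact IsGS.comp_injective (by linarith) hθ'.le hinj hf
  · exact (extendsPullback_pullback hθ' hΓ hA).unique hθ' hΓ hG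
      (isContinuousMap_pullback hθ' hΓ hA) hG'
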